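/- Let $n,p\in\mathbb N$, $X\in\mathbb R^{n\times p}$ with rows $x_i'$, $y\in\{0,1\}^n$, $\kappa>0$, and consider Bayesian probit regression with prior $\beta\sim N(0,\kappa^{-1}I_p)$ and Albert--Chib latent variables $z\in\mathbb R^n$, i.e. the augmented posterior density on $\mathbb R^p\times\mathbb R^n$ $$\pi_n(\beta,z)\ \propto\ \prod_{i=1}^n\big\{y_i\mathbb 1(z_i>0)+(1-y_i)\mathbb 1(z_i\le 0)\big\}\,e^{-(z_i-x_i'\beta)^2/2}\; e^{-\kappa\|\beta\|^2/2}.$$ Let $\mathcal Q_{\rm MF}$ be the set of products $q=q_\beta\otimes q_z$ of probability measures with $F(q):=D_{\rm KL}(q\,\|\,\pi_n)<\infty$. Let $\bar{\mathcal Q}_\beta=\{N(m,(X'X+\kappa I_p)^{-1}):m\in\mathbb R^p\}$ and $\bar{\mathcal Q}_z=\{\bigotimes_{i=1}^n TN_{y_i}(\alpha_i,1):\alpha\in\mathbb R^n\}$, where $TN_1(a,1)$, $TN_0(a,1)$ denote $N(a,1)$ truncated to $(0,\infty)$, $(-\infty,0)$. Put $D_{{\rm KL},\alpha}(q\|r)=\alpha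 D_{\rm KL}(q\|r)+(1-\alpha)D_{\rm KL}(r\|q)$. For a global minimizer $q^\star=q_\beta^\star\otimes q_z^\star$ of $F$ over $\mathcal Q_{\rm MF}$ let $$\Delta_n(q_\beta,q_z)=\int\log\pi_n\; d\,(q_\beta-q_\beta^\star)\otimes(q_z-q_z^\star),$$ $$\mathrm{GCorr}_\alpha(\pi_n)=\sup_{q_\beta\in\bar{\mathcal Q}_\beta\setminus\{q_\beta^\star\},\ q_z\in\bar{\mathcal Q}_z\setminus\{q_z^\star\}}\frac{|\Delta_n(q_\beta,q_z)|}{\sqrt{D_{{\rm KL},\alpha}(q_\beta\|q_\beta^\star)}\sqrt{D_{{\rm KL},1-\alpha}(q_z\|q_z^\star)}},$$ $$\mathrm{GCorr}(\pi_n)=\inf_{\alpha\in[0,1]}\max\{\mathrm{GCorr}_\alpha(\pi_n),\mathrm{GCorr}_{1-\alpha}(\pi_n)\}$$ (suprema are in $[0,\infty]$, with $\sup\emptyset=0$). Then: 1. $F$ has a unique global minimizer $q^\star$ over $\mathcal Q_{\rm MF}$; it satisfies $q^\star_\beta\in\bar{\mathcal Q}_\beta$, $q^\star_z\in\bar{\mathcal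 Q}_z$, and $\log\pi_n$ is integrable under $q_\beta\otimes q_z$ for all $q_\beta\in\bar{\mathcal Q}_\beta$, $q_z\in\bar{\mathcal Q}_z$. 2. $$\mathrm{GCorr}(\pi_n)\ \le\ 2\,\lambda_{\max}^{1/2}\big((X'X+\kappa I_p)^{-1/2}X'X(X'X+\kappa I_p)^{-1/2}\big)\ <\ 2,$$ where $\lambda_{\max}$ is the largest eigenvalue (equal to $0$ for the empty matrix). 3. From every $q^{(0)}\in\mathcal Q_{\rm MF}$ the parallel CAVI algorithm $q_\beta^{(t+1)}\in\arg\min_{q_\beta}F(q_\beta\otimes q_z^{(t)})$, $q_z^{(t+1)}\in\arg\min_{q_z}F(q_\beta^{(t)}\otimes q_z)$ can be run, and each of its runs satisfies: $q_\beta^{(t)}\in\bar{\mathcal Q}_\beta$ and $q_z^{(t)}\in\bar{\mathcal Q}_z$ for all $t\ge1$; whenever $q_\beta^{(t)}\in\bar{\mathcal Q}_\beta$ and $q_z^{(t)}\in\bar{\mathcal Q}_z$ (so for all $t\ge1$, and for $t=0$ if the initialization lies in these families), $$D_{{\rm KL},1/2}(q^{(t+1)}\|q^\star)\le\tfrac14\,\mathrm{GCorr}(\pi_n)^2\,D_{{\rm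 KL},1/2}(q^{(t)}\|q^\star);$$ and $D_{{\rm KL},1/2}(q^{(t)}\|q^\star)\to0$ as $t\to\infty$. -/

import Mathlib

open MeasureTheory ProbabilityTheory InformationTheory Filter Topology
open scoped ENNReal Matrix

noncomputable section

namespace MeanField

/-! ### Two-block mean-field variational inference for a target density -/

/-- The weighted divergence `D_{KL,α}(q ‖ p) = α D_KL(q ‖ p) + (1 - α) D_KL(p ‖ q)`. -/
def weightedKL {E : Type*} [MeasurableSpace E] (α : ℝ) (q p : Measure E) : ℝ≥0∞ :=
  ENNReal.ofReal α * klDiv q p + ENNReal.ofReal (1 - α) * klDiv p q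

variable {E₁ E₂ : Type*} [MeasureSpace E₁] [MeasureSpace E₂]

/-- The target measure with density `f` with respect to the reference (Lebesgue) measure. -/
def target (f : E₁ × E₂ → ℝ) : Measure (E₁ × E₂) :=
  (volume : Measure (E₁ × E₂)).withDensity (fun u => ENNReal.ofReal (f u))

/-- The variational objective `F(q₁ ⊗ q₂) = D_KL(q₁ ⊗ q₂ ‖ π)`. -/
def objective (f : E₁ × E₂ → ℝ) (q₁ : Measure E₁) (q₂ : Measure E₂) : ℝ≥0∞ :=
  klDiv (q₁.prod q₂) (target f)

/-- Membership of `q₁ ⊗ q₂` in the mean-field class `Q_MF`. The value of `klDiv` is `∞` unless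
`q₁ ⊗ q₂` is absolutely continuous with respect to the target. -/
structure IsMeanField (f : E₁ × E₂ → ℝ) (q₁ : Measure E₁) (q₂ : Measure E₂) : Prop where
  prob₁ : IsProbabilityMeasure q₁
  prob₂ : IsProbabilityMeasure q₂
  finite : objective f q₁ q₂ ≠ ∞

/-- `q₁ ⊗ q₂` is a global minimiser of `F` over the mean-field class. -/
structure IsOptimal (f : E₁ × E₂ → ℝ) (q₁ : Measure E₁) (q₂ : Measure E₂) : Prop where
  mem : IsMeanField f q₁ q₂
  le : ∀ (p₁ : Measure E₁) (p₂ : Measure E₂), IsMeanField f p₁ p₂ →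
    objective f q₁ q₂ ≤ objective f p₁ p₂

/-- The interaction term `Δ(q₁, q₂) = ∫ (q₁ - q₁⋆) ⊗ (q₂ - q₂⋆) log π`, with the product of the
two signed measures expanded. -/
def interaction (f : E₁ × E₂ → ℝ) (r₁ : Measure E₁) (r₂ : Measure E₂)
    (q₁ : Measure E₁) (q₂ : Measure E₂) : ℝ :=
  (∫ u, Real.log (f u) ∂(q₁.prod q₂)) - (∫ u, Real.log (f u) ∂(q₁.prod r₂))
    - (∫ u, Real.log (f u) ∂(r₁.prod q₂)) + ∫ u, Real.log (f u) ∂(r₁.prod r₂)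

/-- The `α`-generalized correlation over the families `𝒬₁`, `𝒬₂`, relative to the mean-field
optimum `r₁ ⊗ r₂`. The supremum is taken in `[0, ∞]`. -/
def gcorrAt (f : E₁ × E₂ → ℝ) (r₁ : Measure E₁) (r₂ : Measure E₂)
    (𝒬₁ : Set (Measure E₁)) (𝒬₂ : Set (Measure E₂)) (α : ℝ) : ℝ≥0∞ :=
  ⨆ q₁ ∈ 𝒬₁ \ {r₁}, ⨆ q₂ ∈ 𝒬₂ \ {r₂},
    ENNReal.ofReal |interaction f r₁ r₂ q₁ q₂| /
      (weightedKL α q₁ r₁ ^ (1 / 2 : ℝ) * weightedKL (1 - α) q₂ r₂ ^ (1 / 2 : ℝ))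

/-- The generalized correlation `GCorr = inf_{α ∈ [0,1]} max {GCorr_α, GCorr_{1-α}}`. -/
def gcorr (f : E₁ × E₂ → ℝ) (r₁ : Measure E₁) (r₂ : Measure E₂)
    (𝒬₁ : Set (Measure E₁)) (𝒬₂ : Set (Measure E₂)) : ℝ≥0∞ :=
  ⨅ α ∈ Set.Icc (0 : ℝ) 1,
    max (gcorrAt f r₁ r₂ 𝒬₁ 𝒬₂ α) (gcorrAt f r₁ r₂ 𝒬₁ 𝒬₂ (1 - α))

/-- A run of the parallel CAVI algorithm, started in the mean-field class:
`q₁^(t+1) ∈ argmin F(· ⊗ q₂^(t))` and `q₂^(t+1) ∈ argmin F(q₁^(t) ⊗ ·)`, where the minima are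
over all probability measures on the respective block. -/
structure IsParallelCAVI (f : E₁ × E₂ → ℝ) (q₁ : ℕ → Measure E₁) (q₂ : ℕ → Measure E₂) :
    Prop where
  init : IsMeanField f (q₁ 0) (q₂ 0)
  prob₁ : ∀ t, IsProbabilityMeasure (q₁ t)
  prob₂ : ∀ t, IsProbabilityMeasure (q₂ t)
  step₁ : ∀ t, ∀ p : Measure E₁, IsProbabilityMeasure p →
    objective f (q₁ (t + 1)) (q₂ t) ≤ objective f p (q₂ t)
  step₂ : ∀ t, ∀ p : Measure E₂, IsProbabilityMeasure p →
    objective f (q₁ t) (q₂ (t + 1)) ≤ objective f (q₁ t) p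

end MeanField

namespace Probit

/-! ### Bayesian probit regression with Albert–Chib augmentation -/

variable {n p : ℕ}

/-- The augmented likelihood `L(β, z)`. -/
def likelihood (X : Matrix (Fin n) (Fin p) ℝ) (y : Fin n → Fin 2)
    (β : EuclideanSpace ℝ (Fin p)) (z : Fin n → ℝ) : ℝ :=
  (∏ i, (((y i : ℕ) : ℝ) * (Set.Ioi (0 : ℝ)).indicator 1 (z i) +
      (1 - ((y i : ℕ) : ℝ)) * (Set.Iic (0 : ℝ)).indicator 1 (z i))) *
    ∏ i, Real.exp (-(z i - (X *ᵥ β.ofLp) i) ^ 2 / 2)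

/-- Augmented likelihood times the (unnormalised) `N(0, κ⁻¹ I)` prior density. -/
def joint (X : Matrix (Fin n) (Fin p) ℝ) (y : Fin n → Fin 2) (κ : ℝ)
    (u : EuclideanSpace ℝ (Fin p) × (Fin n → ℝ)) : ℝ :=
  likelihood X y u.1 u.2 * Real.exp (-κ * ‖u.1‖ ^ 2 / 2)

/-- The Lebesgue density `π_n(β, z)` of the augmented posterior. -/
def posterior (X : Matrix (Fin n) (Fin p) ℝ) (y : Fin n → Fin 2) (κ : ℝ)
    (u : EuclideanSpace ℝ (Fin p) × (Fin n → ℝ)) : ℝ :=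
  joint X y κ u / ∫ v, joint X y κ v

/-- `X'X + κ I`. -/
def precision (X : Matrix (Fin n) (Fin p) ℝ) (κ : ℝ) : Matrix (Fin p) (Fin p) ℝ :=
  Xᵀ * X + κ • (1 : Matrix (Fin p) (Fin p) ℝ)

/-- The family `{N(m, Σ) : m ∈ ℝᵖ}` with `Σ = (X'X + κ I)⁻¹`. -/
def gaussianFamily (X : Matrix (Fin n) (Fin p) ℝ) (κ : ℝ) :
    Set (Measure (EuclideanSpace ℝ (Fin p))) :=
  {q | ∃ m : EuclideanSpace ℝ (Fin p), q = multivariateGaussian m (precision X κ)⁻¹}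

/-- The truncated normal `TN_y(a, 1)`: `N(a, 1)` conditioned on `(0, ∞)` if `y = 1` and on
`(-∞, 0)` if `y = 0`. -/
def truncNormal (y : Fin 2) (a : ℝ) : Measure ℝ :=
  cond (gaussianReal a 1) (if y = 1 then Set.Ioi 0 else Set.Iio 0)

/-- The family `{⨂ᵢ TN_{yᵢ}(αᵢ, 1) : α ∈ ℝⁿ}`. -/
def truncNormalFamily (y : Fin n → Fin 2) : Set (Measure (Fin n → ℝ)) :=
  {q | ∃ a : Fin n → ℝ, q = Measure.pi (fun i => truncNormal (y i) (a i))}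

/-- The largest eigenvalue of a real symmetric matrix (whose spectrum is the finite set of its
eigenvalues). -/
def lambdaMax (A : Matrix (Fin p) (Fin p) ℝ) : ℝ := sSup (spectrum ℝ A)

/-- The inverse square root of a symmetric positive definite matrix, by functional calculus. -/
def invSqrt (A : Matrix (Fin p) (Fin p) ℝ) : Matrix (Fin p) (Fin p) ℝ :=
  cfc (fun t : ℝ => t ^ (-(1 / 2) : ℝ)) A

/-- `2 λ_max^{1/2}((X'X + κI)^{-1/2} X'X (X'X + κI)^{-1/2})`. -/
def corrBound (X : Matrix (Fin n) (Fin p) ℝ) (κ : ℝ) : ℝ :=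
  2 * Real.sqrt (lambdaMax (invSqrt (precision X κ) * (Xᵀ * X) * invSqrt (precision X κ)))

/-- `GCorr(π_n)` for the probit posterior, over the Gaussian and truncated normal families. -/
def probitGCorr (X : Matrix (Fin n) (Fin p) ℝ) (y : Fin n → Fin 2) (κ : ℝ)
    (r₁ : Measure (EuclideanSpace ℝ (Fin p))) (r₂ : Measure (Fin n → ℝ)) : ℝ≥0∞ :=
  MeanField.gcorr (posterior X y κ) r₁ r₂ (gaussianFamily X κ) (truncNormalFamily y)

end Probit

end

/-! Completing the square shows that `π_n` is the product of `ρ₁ = N(0, (X'X + κI)⁻¹)` and the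
normals `ρ₂` centred at `0` and truncated to the orthant of `y`, tilted by `exp ⟨Xβ, z⟩` alone. With
the statistics `T₁ = Xβ` and `T₂ = z`, the objective is therefore `F(q₁ ⊗ q₂) = KL(q₁‖ρ₁) +
KL(q₂‖ρ₂) - ⟨E T₁, E T₂⟩ + const`. The blocks interact only through these two means. The best
response in a block is the exponential tilt of its base measure whose parameter is the other block's
mean, and `Δ_n` is the inner product of the two mean shifts.

The analytic input is sub-Gaussianity: `log E_q exp ⟨T - E_q T, θ⟩ ≤ c |θ|² / 2` for every member
`q` of a block's family. Let `λ` be the largest eigenvalue in the statement. For `Xβ` one may take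
`c₁ = λ`. For the truncated normals `c₂ = 1`, because each coordinate and all its tilts have
variance at most one (`variance_truncNormal_le`, `cgf_le_of_variance_tilted_le_one`). By
Donsker–Varadhan this yields the transport inequality `|E_p T - E_q T|² ≤ 2c KL(p‖q)`
(`dotProduct_sub_self_le`), with three consequences. The map from tilt parameter to mean is
`c`-Lipschitz, so, since `c₁c₂ = λ < 1`, Banach's theorem produces a pair of mutually optimal tilts.
The objective exceeds its value at this pair by at least `1 - √λ` times the divergence to it
(`mul_add_le_objective_sub`), so the pair is the unique minimiser. Finally `|Δ_n| ≤ 2√λ √D_{1/2}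
√D_{1/2}`, which bounds `GCorr`.

For the contraction, let `s₁` be the response to `q₂`. Then `Δ(s₁, q₂)` equals the symmetrised
divergence between `s₁` and `q₁⋆`, which is `D_α + D_{1-α}` for every `α`. Bounding it through both
`GCorr_α` and `GCorr_{1-α}` and applying `four_mul_add_le` compares the symmetrised divergences of
`s₁` and `q₂` with factor `GCorr²/4`; the other block is symmetric, and the two bounds add. -/

namespace InformationTheory

/-! ### Relative entropy under exponential tilts and products. -/

variable {α β : Type*} [MeasurableSpace α] [MeasurableSpace β]

lemma klDiv_tilted_right_ne_top {μ ν : Measure α} [IsProbabilityMeasure μ]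
    [IsProbabilityMeasure ν] {f : α → ℝ} (h : klDiv μ ν ≠ ∞) (hf : Integrable f μ)
    (hν : Integrable (fun x => Real.exp (f x)) ν) : klDiv μ (ν.tilted f) ≠ ∞ := by
  obtain ⟨hac, hint⟩ := klDiv_ne_top_iff.1 h
  exact klDiv_ne_top (hac.trans (absolutelyContinuous_tilted hν))
    (integrable_llr_tilted_right hac hf hint hν)

lemma toReal_klDiv_tilted_right {μ ν : Measure α} [IsProbabilityMeasure μ]
    [IsProbabilityMeasure ν] {f : α → ℝ} (h : klDiv μ ν ≠ ∞) (hf : Integrable f μ)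
    (hν : Integrable (fun x => Real.exp (f x)) ν) :
    (klDiv μ (ν.tilted f)).toReal =
      (klDiv μ ν).toReal - ∫ x, f x ∂μ + Real.log (∫ x, Real.exp (f x) ∂ν) := by
  obtain ⟨hac, hint⟩ := klDiv_ne_top_iff.1 h
  have := isProbabilityMeasure_tilted hν
  rw [toReal_klDiv_of_measure_eq (hac.trans (absolutelyContinuous_tilted hν)) (by simp),
    toReal_klDiv_of_measure_eq hac (by simp), integral_llr_tilted_right hac hf hν hint]

/-- Tilting by `-f` undoes the tilt by `f`. -/
lemma klDiv_ne_top_of_tilted_right {μ ν : Measure α} [IsProbabilityMeasure μ]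
    [IsProbabilityMeasure ν] {f : α → ℝ} (h : klDiv μ (ν.tilted f) ≠ ∞) (hf : Integrable f μ)
    (hν : Integrable (fun x => Real.exp (f x)) ν) : klDiv μ ν ≠ ∞ := by
  have := isProbabilityMeasure_tilted hν
  have h2 := klDiv_tilted_right_ne_top (f := -f) h hf.neg (by
    rw [integrable_tilted_iff hν]
    simp [← Real.exp_add])
  rwa [tilted_neg_same hν] at h2

lemma klDiv_tilted_self_ne_top {ν : Measure α} [IsProbabilityMeasure ν] {f : α → ℝ}
    (hν : Integrable (fun x => Real.exp (f x)) ν) (hf : Integrable f (ν.tilted f)) :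
    klDiv (ν.tilted f) ν ≠ ∞ := by
  have := isProbabilityMeasure_tilted hν
  exact klDiv_ne_top_of_tilted_right (f := f) (by simp [klDiv_self]) hf hν

/-- One side of the Donsker–Varadhan variational formula. -/
lemma integral_sub_log_le_toReal_klDiv {μ ν : Measure α} [IsProbabilityMeasure μ]
    [IsProbabilityMeasure ν] {f : α → ℝ} (h : klDiv μ ν ≠ ∞) (hf : Integrable f μ)
    (hν : Integrable (fun x => Real.exp (f x)) ν) :
    ∫ x, f x ∂μ - Real.log (∫ x, Real.exp (f x) ∂ν) ≤ (klDiv μ ν).toReal := by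
  have h1 := toReal_klDiv_tilted_right h hf hν
  have h2 : 0 ≤ (klDiv μ (ν.tilted f)).toReal := ENNReal.toReal_nonneg
  linarith

/-- Fenchel–Young: the convex conjugate of `klFun` is `exp b - 1`. -/
lemma mul_le_klFun_add_exp {a b : ℝ} (ha : 0 ≤ a) : a * b ≤ klFun a + Real.exp b := by
  rcases ha.eq_or_lt with rfl | ha
  · have := Real.exp_pos b
    simp [klFun_zero]; linarith
  · have h := Real.add_one_le_exp (b - Real.log a)
    rw [Real.exp_sub, Real.exp_log ha, le_div_iff₀ ha] at h
    rw [klFun_apply]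
    nlinarith

/-- Entropy inequality: by Fenchel–Young the density times `φ` is dominated by `klFun` of the
density plus `exp φ`. -/
lemma integrable_of_klDiv_ne_top {μ ν : Measure α} [IsFiniteMeasure μ] [IsFiniteMeasure ν]
    {φ : α → ℝ} (h : klDiv μ ν ≠ ∞) (hφ : Measurable φ) (h0 : ∀ x, 0 ≤ φ x)
    (hν : Integrable (fun x => Real.exp (φ x)) ν) : Integrable φ μ := by
  obtain ⟨hac, hint⟩ := klDiv_ne_top_iff.1 h
  rw [← integrable_rnDeriv_smul_iff hac]
  refine (((integrable_klFun_rnDeriv_iff hac).2 hint).add hν).mono'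
    ((μ.measurable_rnDeriv ν).ennreal_toReal.smul hφ).aestronglyMeasurable ?_
  filter_upwards with x
  rw [smul_eq_mul, Real.norm_eq_abs, abs_of_nonneg (mul_nonneg ENNReal.toReal_nonneg (h0 x))]
  exact mul_le_klFun_add_exp ENNReal.toReal_nonneg

lemma klDiv_prod_swap (μ ν : Measure (α × β)) [IsFiniteMeasure μ] [IsFiniteMeasure ν] :
    klDiv (μ.map Prod.swap) (ν.map Prod.swap) = klDiv μ ν := by
  refine le_antisymm (klDiv_map_le _ _ measurable_swap) ?_
  have h := klDiv_map_le (μ.map Prod.swap) (ν.map Prod.swap)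
    (measurable_swap (α := β) (β := α))
  rwa [Measure.map_map measurable_swap measurable_swap,
    Measure.map_map measurable_swap measurable_swap, Prod.swap_swap_eq, Measure.map_id,
    Measure.map_id] at h

/-- Chain rule with constant kernels. After swapping the factors, the conditional term compares two
measures with a common kernel, which drops out. -/
lemma klDiv_prod (μ₁ ν₁ : Measure α) (μ₂ ν₂ : Measure β) [IsProbabilityMeasure μ₁]
    [IsProbabilityMeasure ν₁] [IsProbabilityMeasure μ₂] [IsProbabilityMeasure ν₂] :
    klDiv (μ₁.prod μ₂) (ν₁.prod ν₂) = klDiv μ₁ ν₁ + klDiv μ₂ ν₂ := by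
  have h1 := klDiv_compProd_eq_add μ₁ ν₁ (Kernel.const α μ₂) (Kernel.const α ν₂)
  have h2 := klDiv_compProd_left μ₂ ν₂ (Kernel.const β μ₁)
  simp only [Measure.compProd_const] at h1 h2
  rw [h1, ← h2, ← klDiv_prod_swap (μ₁.prod μ₂), Measure.prod_swap, Measure.prod_swap]

end InformationTheory

/-! ### Exponential families with a sub-Gaussian statistic. -/

namespace MeanField

variable {ι E : Type*} [Fintype ι] [MeasurableSpace E]

lemma sq_dotProduct_le (u v : ι → ℝ) : (u ⬝ᵥ v) ^ 2 ≤ (u ⬝ᵥ u) * (v ⬝ᵥ v) := by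
  simpa [dotProduct, sq] using Finset.sum_mul_sq_le_sq_mul_sq Finset.univ u v

lemma dotProduct_self_nonneg' (u : ι → ℝ) : 0 ≤ u ⬝ᵥ u :=
  Finset.sum_nonneg fun i _ => mul_self_nonneg (u i)

/-- The vector of means of the statistic `T`. -/
noncomputable def statMean (T : E → ι → ℝ) (q : Measure E) : ι → ℝ := fun i => ∫ x, T x i ∂q

/-- The exponential family with base measure `ρ` and sufficient statistic `T`. -/
noncomputable def expTilt (T : E → ι → ℝ) (ρ : Measure E) (w : ι → ℝ) : Measure E :=
  ρ.tilted (fun x => T x ⬝ᵥ w)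

/-- A block of a two-block model: a base measure `ρ`, a statistic `T` with Gaussian tails, and a
family `𝒬` containing the exponential family, along which `T` is sub-Gaussian with proxy `c`. -/
structure IsExpBlock (T : E → ι → ℝ) (ρ : Measure E) (𝒬 : Set (Measure E)) (c : ℝ) : Prop where
  measurable : Measurable T
  prob : IsProbabilityMeasure ρ
  nonneg : 0 ≤ c
  exp_sq : ∃ ε > 0, Integrable (fun x => Real.exp (ε * (T x ⬝ᵥ T x))) ρ
  prob_mem : ∀ q ∈ 𝒬, IsProbabilityMeasure q
  klDiv_base : ∀ q ∈ 𝒬, klDiv q ρ ≠ ∞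
  -- With `klDiv_base`, this makes every divergence inside `𝒬` finite, so `toReal` loses nothing.
  klDiv_mem : ∀ q ∈ 𝒬, ∀ p : Measure E, IsProbabilityMeasure p → klDiv p ρ ≠ ∞ → klDiv p q ≠ ∞
  integrable_exp : ∀ q ∈ 𝒬, ∀ θ : ι → ℝ, Integrable (fun x => Real.exp (T x ⬝ᵥ θ)) q
  log_le : ∀ q ∈ 𝒬, ∀ θ : ι → ℝ,
    Real.log (∫ x, Real.exp (T x ⬝ᵥ θ) ∂q) ≤ statMean T q ⬝ᵥ θ + c / 2 * (θ ⬝ᵥ θ)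
  tilt_mem : ∀ w, expTilt T ρ w ∈ 𝒬

namespace IsExpBlock

variable {T : E → ι → ℝ} {ρ : Measure E} {𝒬 : Set (Measure E)} {c : ℝ}

lemma base_mem (B : IsExpBlock T ρ 𝒬 c) : ρ ∈ 𝒬 := by
  have := B.prob
  have h := B.tilt_mem 0
  simpa [expTilt, tilted_const'] using h

lemma integrable_exp_base (B : IsExpBlock T ρ 𝒬 c) (w : ι → ℝ) :
    Integrable (fun x => Real.exp (T x ⬝ᵥ w)) ρ :=
  B.integrable_exp ρ B.base_mem w

lemma measurable_apply (B : IsExpBlock T ρ 𝒬 c) (i : ι) : Measurable fun x => T x i :=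
  (measurable_pi_apply i).comp B.measurable

lemma measurable_dotProduct_self (B : IsExpBlock T ρ 𝒬 c) : Measurable fun x => T x ⬝ᵥ T x :=
  Finset.measurable_sum _ fun i _ => (B.measurable_apply i).mul (B.measurable_apply i)

lemma integrable_dotProduct_self (B : IsExpBlock T ρ 𝒬 c) {p : Measure E}
    [IsProbabilityMeasure p] (hp : klDiv p ρ ≠ ∞) : Integrable (fun x => T x ⬝ᵥ T x) p := by
  have := B.prob
  obtain ⟨ε, hε, h⟩ := B.exp_sq
  have h1 := integrable_of_klDiv_ne_top hp (B.measurable_dotProduct_self.const_mul ε)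
    (fun x => mul_nonneg hε.le (dotProduct_self_nonneg' _)) h
  simpa [hε.ne'] using h1.const_mul ε⁻¹

lemma integrable_apply (B : IsExpBlock T ρ 𝒬 c) {p : Measure E}
    [IsProbabilityMeasure p] (hp : klDiv p ρ ≠ ∞) (i : ι) : Integrable (fun x => T x i) p := by
  refine ((B.integrable_dotProduct_self hp).add (integrable_const 1)).mono'
    (B.measurable_apply i).aestronglyMeasurable ?_
  filter_upwards with x
  have h : T x i * T x i ≤ T x ⬝ᵥ T x :=
    Finset.single_le_sum (f := fun j => T x j * T x j) (fun j _ => mul_self_nonneg _)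
      (Finset.mem_univ i)
  simp only [Pi.add_apply, Real.norm_eq_abs]
  rw [abs_le]
  constructor <;> nlinarith [sq_nonneg (T x i - 1), sq_nonneg (T x i + 1)]

lemma integrable_dotProduct (B : IsExpBlock T ρ 𝒬 c) {p : Measure E}
    [IsProbabilityMeasure p] (hp : klDiv p ρ ≠ ∞) (w : ι → ℝ) :
    Integrable (fun x => T x ⬝ᵥ w) p :=
  integrable_finsetSum _ fun i _ => (B.integrable_apply hp i).mul_const _

lemma integral_dotProduct (B : IsExpBlock T ρ 𝒬 c) {p : Measure E}
    [IsProbabilityMeasure p] (hp : klDiv p ρ ≠ ∞) (w : ι → ℝ) :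
    ∫ x, T x ⬝ᵥ w ∂p = statMean T p ⬝ᵥ w := by
  simp only [dotProduct, statMean]
  rw [integral_finsetSum _ fun i _ => (B.integrable_apply hp i).mul_const _]
  simp [integral_mul_const]

lemma toReal_klDiv_expTilt (B : IsExpBlock T ρ 𝒬 c) {p : Measure E}
    [IsProbabilityMeasure p] (hp : klDiv p ρ ≠ ∞) (w : ι → ℝ) :
    (klDiv p (expTilt T ρ w)).toReal = (klDiv p ρ).toReal - statMean T p ⬝ᵥ w +
      Real.log (∫ x, Real.exp (T x ⬝ᵥ w) ∂ρ) := by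
  have := B.prob
  rw [expTilt, toReal_klDiv_tilted_right hp (B.integrable_dotProduct hp w)
    (B.integrable_exp_base w), B.integral_dotProduct hp]

lemma toReal_klDiv_expTilt_base (B : IsExpBlock T ρ 𝒬 c) (w : ι → ℝ) :
    (klDiv (expTilt T ρ w) ρ).toReal - statMean T (expTilt T ρ w) ⬝ᵥ w =
      - Real.log (∫ x, Real.exp (T x ⬝ᵥ w) ∂ρ) := by
  have := B.prob_mem _ (B.tilt_mem w)
  have h := B.toReal_klDiv_expTilt (B.klDiv_base _ (B.tilt_mem w)) w
  rw [klDiv_self, ENNReal.toReal_zero] at h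
  linarith

/-- Gibbs variational principle: `KL(·‖ρ) - ⟨mean, w⟩` is minimal at the tilt, and the excess over
the minimum is exactly the divergence to the tilt. -/
lemma toReal_klDiv_expTilt_eq (B : IsExpBlock T ρ 𝒬 c) {p : Measure E}
    [IsProbabilityMeasure p] (hp : klDiv p ρ ≠ ∞) (w : ι → ℝ) :
    (klDiv p (expTilt T ρ w)).toReal = (klDiv p ρ).toReal - statMean T p ⬝ᵥ w -
      ((klDiv (expTilt T ρ w) ρ).toReal - statMean T (expTilt T ρ w) ⬝ᵥ w) := by
  rw [B.toReal_klDiv_expTilt hp, B.toReal_klDiv_expTilt_base]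
  ring

/-- `toReal` also sends `∞` to `0`; finiteness from `klDiv_mem` rules this out. -/
lemma eq_of_toReal_klDiv_eq_zero (B : IsExpBlock T ρ 𝒬 c) {p q : Measure E}
    [IsProbabilityMeasure p] (hp : klDiv p ρ ≠ ∞) (hq : q ∈ 𝒬)
    (h : (klDiv p q).toReal = 0) : p = q := by
  have := B.prob_mem q hq
  rw [← klDiv_eq_zero_iff]
  exact ((ENNReal.toReal_eq_zero_iff _).1 h).resolve_right (B.klDiv_mem q hq p inferInstance hp)

/-- The `T₁` transport inequality for the statistic `T`. -/
lemma dotProduct_sub_self_le (B : IsExpBlock T ρ 𝒬 c) {p q : Measure E}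
    [IsProbabilityMeasure p] (hp : klDiv p ρ ≠ ∞) (hq : q ∈ 𝒬) :
    (statMean T p - statMean T q) ⬝ᵥ (statMean T p - statMean T q) ≤
      2 * c * (klDiv p q).toReal := by
  have := B.prob_mem q hq
  set u := statMean T p - statMean T q with hu
  set K := (klDiv p q).toReal with hK
  have hK0 : 0 ≤ K := ENNReal.toReal_nonneg
  have hc := B.nonneg
  have hU : 0 ≤ u ⬝ᵥ u := dotProduct_self_nonneg' u
  -- Donsker–Varadhan with test function `⟨T, t u⟩` for all real `t` gives a nonnegative quadratic.
  -- Its discriminant condition is the claim multiplied by `u ⬝ᵥ u`, so `u = 0` is treated apart.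
  have key : ∀ t : ℝ, 0 ≤ (c / 2 * (u ⬝ᵥ u)) * (t * t) + (-(u ⬝ᵥ u)) * t + K := by
    intro t
    have h1 := integral_sub_log_le_toReal_klDiv (B.klDiv_mem q hq p inferInstance hp)
      (B.integrable_dotProduct hp (t • u)) (B.integrable_exp q hq (t • u))
    have h2 := B.log_le q hq (t • u)
    rw [B.integral_dotProduct hp] at h1
    have h3 : u ⬝ᵥ u = statMean T p ⬝ᵥ u - statMean T q ⬝ᵥ u := by
      conv_lhs => rw [hu, sub_dotProduct]
    simp only [dotProduct_smul, smul_dotProduct, smul_eq_mul, ← hK] at h1 h2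
    have h4 := congrArg (t * ·) h3
    simp only [mul_sub] at h4
    linarith
  have h := discrim_le_zero key
  rw [discrim] at h
  rcases hU.eq_or_lt with h0 | h0
  · rw [← h0]; positivity
  · by_contra! hlt
    nlinarith

/-- The log-normalisers cancel on symmetrising, leaving the pairing of means with parameters. -/
lemma symm_klDiv_expTilt (B : IsExpBlock T ρ 𝒬 c) (w w' : ι → ℝ) :
    (klDiv (expTilt T ρ w) (expTilt T ρ w')).toReal +
      (klDiv (expTilt T ρ w') (expTilt T ρ w)).toReal =
      (statMean T (expTilt T ρ w) - statMean T (expTilt T ρ w')) ⬝ᵥ (w - w') := by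
  have := B.prob_mem _ (B.tilt_mem w)
  have := B.prob_mem _ (B.tilt_mem w')
  rw [B.toReal_klDiv_expTilt_eq (B.klDiv_base _ (B.tilt_mem w)),
    B.toReal_klDiv_expTilt_eq (B.klDiv_base _ (B.tilt_mem w'))]
  simp only [sub_dotProduct, dotProduct_sub]
  ring

/-- The mean is a `c`-Lipschitz function of the parameter: adding the transport inequalities in both
directions gives `|u|² ≤ c ⟨u, w - w'⟩`, and Cauchy–Schwarz finishes. -/
lemma dotProduct_sub_expTilt_le (B : IsExpBlock T ρ 𝒬 c) (w w' : ι → ℝ) :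
    (statMean T (expTilt T ρ w) - statMean T (expTilt T ρ w')) ⬝ᵥ
      (statMean T (expTilt T ρ w) - statMean T (expTilt T ρ w')) ≤
      c ^ 2 * ((w - w') ⬝ᵥ (w - w')) := by
  have := B.prob_mem _ (B.tilt_mem w)
  have := B.prob_mem _ (B.tilt_mem w')
  have h1 := B.dotProduct_sub_self_le (B.klDiv_base _ (B.tilt_mem w)) (B.tilt_mem w')
  have h2 := B.dotProduct_sub_self_le (B.klDiv_base _ (B.tilt_mem w')) (B.tilt_mem w)
  have h3 := B.symm_klDiv_expTilt w w'
  have h5 : (statMean T (expTilt T ρ w') - statMean T (expTilt T ρ w)) ⬝ᵥ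
      (statMean T (expTilt T ρ w') - statMean T (expTilt T ρ w)) =
      (statMean T (expTilt T ρ w) - statMean T (expTilt T ρ w')) ⬝ᵥ
      (statMean T (expTilt T ρ w) - statMean T (expTilt T ρ w')) := by
    rw [← neg_sub, neg_dotProduct_neg]
  rw [h5] at h2
  set u := statMean T (expTilt T ρ w) - statMean T (expTilt T ρ w')
  have h4 := sq_dotProduct_le u (w - w')
  have hU := dotProduct_self_nonneg' u
  have hW := dotProduct_self_nonneg' (w - w')
  have hc := B.nonneg
  have h6 : u ⬝ᵥ u ≤ c * (u ⬝ᵥ (w - w')) := by nlinarith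
  rcases hU.eq_or_lt with h0 | h0
  · rw [← h0]; positivity
  · have h7 : (u ⬝ᵥ u) ^ 2 ≤ (c * (u ⬝ᵥ (w - w'))) ^ 2 := by gcongr
    rw [mul_pow] at h7
    have h8 : (u ⬝ᵥ u) * (u ⬝ᵥ u) ≤ (u ⬝ᵥ u) * (c ^ 2 * ((w - w') ⬝ᵥ (w - w'))) := by
      have := mul_le_mul_of_nonneg_left h4 (sq_nonneg c)
      nlinarith
    exact le_of_mul_le_mul_left h8 h0

end IsExpBlock

lemma exists_fixedPoint_expTilt {E₁ E₂ : Type*} [MeasurableSpace E₁] [MeasurableSpace E₂]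
    {T₁ : E₁ → ι → ℝ} {T₂ : E₂ → ι → ℝ} {ρ₁ : Measure E₁} {ρ₂ : Measure E₂}
    {𝒬₁ : Set (Measure E₁)} {𝒬₂ : Set (Measure E₂)} {c₁ c₂ : ℝ}
    (B₁ : IsExpBlock T₁ ρ₁ 𝒬₁ c₁) (B₂ : IsExpBlock T₂ ρ₂ 𝒬₂ c₂) (hc : c₁ * c₂ < 1) :
    ∃ w₁ w₂, w₁ = statMean T₂ (expTilt T₂ ρ₂ w₂) ∧ w₂ = statMean T₁ (expTilt T₁ ρ₁ w₁) := by
  -- The Lipschitz bounds are Euclidean, whereas `ι → ℝ` carries the sup norm. A fixed point of this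
  -- two-block response is the required pair.
  let g : EuclideanSpace ℝ ι → EuclideanSpace ℝ ι := fun w => WithLp.toLp 2
    (statMean T₁ (expTilt T₁ ρ₁ (statMean T₂ (expTilt T₂ ρ₂ w.ofLp))))
  have hc0 : 0 ≤ c₁ * c₂ := mul_nonneg B₁.nonneg B₂.nonneg
  have hg : ContractingWith ⟨c₁ * c₂, hc0⟩ g := by
    refine ⟨by exact_mod_cast hc, LipschitzWith.of_dist_le_mul fun w w' => ?_⟩
    rw [dist_eq_norm, dist_eq_norm]
    refine abs_le_of_sq_le_sq' ?_ (by positivity) |>.2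
    rw [mul_pow, EuclideanSpace.real_norm_sq_eq, EuclideanSpace.real_norm_sq_eq]
    have h1 := B₁.dotProduct_sub_expTilt_le (statMean T₂ (expTilt T₂ ρ₂ w.ofLp))
      (statMean T₂ (expTilt T₂ ρ₂ w'.ofLp))
    have h2 := B₂.dotProduct_sub_expTilt_le w.ofLp w'.ofLp
    have h3 := h1.trans (mul_le_mul_of_nonneg_left h2 (sq_nonneg c₁))
    simp only [dotProduct, ← sq, ← mul_assoc, ← mul_pow] at h3
    exact h3
  have hfix := hg.fixedPoint_isFixedPt
  refine ⟨_, (ContractingWith.fixedPoint g hg).ofLp, rfl, ?_⟩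
  exact (congrArg WithLp.ofLp hfix).symm

end MeanField

/-! ### Weighted divergences and the interaction term. -/

namespace MeanField

section weightedKL

variable {E : Type*} [MeasurableSpace E] {p q : Measure E} {α : ℝ}

lemma weightedKL_ne_top (hqp : klDiv q p ≠ ∞) (hpq : klDiv p q ≠ ∞) : weightedKL α q p ≠ ∞ := by
  unfold weightedKL
  exact ENNReal.add_ne_top.2 ⟨ENNReal.mul_ne_top ENNReal.ofReal_ne_top hqp,
    ENNReal.mul_ne_top ENNReal.ofReal_ne_top hpq⟩

lemma toReal_weightedKL (hqp : klDiv q p ≠ ∞) (hpq : klDiv p q ≠ ∞) (hα : α ∈ Set.Icc (0 : ℝ) 1) :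
    (weightedKL α q p).toReal = α * (klDiv q p).toReal + (1 - α) * (klDiv p q).toReal := by
  unfold weightedKL
  rw [ENNReal.toReal_add (ENNReal.mul_ne_top ENNReal.ofReal_ne_top hqp)
    (ENNReal.mul_ne_top ENNReal.ofReal_ne_top hpq), ENNReal.toReal_mul, ENNReal.toReal_mul,
    ENNReal.toReal_ofReal hα.1, ENNReal.toReal_ofReal (by linarith [hα.2])]

lemma weightedKL_ne_zero [IsFiniteMeasure p] [IsFiniteMeasure q] (h : q ≠ p) : weightedKL α q p ≠ 0 := by
  unfold weightedKL
  intro h0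
  rw [add_eq_zero, mul_eq_zero, mul_eq_zero, klDiv_eq_zero_iff, klDiv_eq_zero_iff] at h0
  simp only [h, h.symm, or_false, ENNReal.ofReal_eq_zero] at h0
  linarith [h0.1, h0.2]

lemma weightedKL_prod {F : Type*} [MeasurableSpace F] {p' q' : Measure F}
    [IsProbabilityMeasure p] [IsProbabilityMeasure q] [IsProbabilityMeasure p']
    [IsProbabilityMeasure q'] :
    weightedKL α (q.prod q') (p.prod p') = weightedKL α q p + weightedKL α q' p' := by
  simp only [weightedKL, klDiv_prod]
  ring

end weightedKL

variable {ι E₁ E₂ : Type*} [Fintype ι] [MeasureSpace E₁] [MeasureSpace E₂]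

lemma interaction_self_left (f : E₁ × E₂ → ℝ) (r₁ : Measure E₁) (r₂ q₂ : Measure E₂) :
    interaction f r₁ r₂ r₁ q₂ = 0 := by
  unfold interaction; ring

lemma interaction_self_right (f : E₁ × E₂ → ℝ) (r₁ q₁ : Measure E₁) (r₂ : Measure E₂) :
    interaction f r₁ r₂ q₁ r₂ = 0 := by
  unfold interaction; ring

/-- The supremum skips `q = r`, where the interaction vanishes. Elsewhere the denominator is neither
`0` nor `∞`, so the division can be cleared. -/
lemma ofReal_abs_interaction_le {f : E₁ × E₂ → ℝ} {r₁ q₁ : Measure E₁} {r₂ q₂ : Measure E₂}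
    [IsFiniteMeasure r₁] [IsFiniteMeasure q₁] [IsFiniteMeasure r₂] [IsFiniteMeasure q₂]
    {𝒬₁ : Set (Measure E₁)} {𝒬₂ : Set (Measure E₂)} (h₁ : q₁ ∈ 𝒬₁) (h₂ : q₂ ∈ 𝒬₂)
    (hq₁ : klDiv q₁ r₁ ≠ ∞) (hr₁ : klDiv r₁ q₁ ≠ ∞) (hq₂ : klDiv q₂ r₂ ≠ ∞)
    (hr₂ : klDiv r₂ q₂ ≠ ∞) {α : ℝ} (hα : α ∈ Set.Icc (0 : ℝ) 1) :
    ENNReal.ofReal |interaction f r₁ r₂ q₁ q₂| ≤ gcorrAt f r₁ r₂ 𝒬₁ 𝒬₂ α *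
      (weightedKL α q₁ r₁ ^ (1 / 2 : ℝ) * weightedKL (1 - α) q₂ r₂ ^ (1 / 2 : ℝ)) := by
  have hα' : 1 - α ∈ Set.Icc (0 : ℝ) 1 := ⟨by linarith [hα.2], by linarith [hα.1]⟩
  by_cases e₁ : q₁ = r₁
  · rw [e₁, interaction_self_left]; simp
  by_cases e₂ : q₂ = r₂
  · rw [e₂, interaction_self_right]; simp
  have n₁ := weightedKL_ne_zero (α := α) e₁
  have n₂ := weightedKL_ne_zero (α := 1 - α) e₂
  have t₁ := weightedKL_ne_top (α := α) hq₁ hr₁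
  have t₂ := weightedKL_ne_top (α := 1 - α) hq₂ hr₂
  rw [← ENNReal.div_le_iff]
  · exact le_iSup₂_of_le q₁ ⟨h₁, e₁⟩ (le_iSup₂_of_le q₂ ⟨h₂, e₂⟩ le_rfl)
  · exact mul_ne_zero (by simp [n₁, t₁]) (by simp [n₂, t₂])
  · exact ENNReal.mul_ne_top (by simp [n₁, t₁]) (by simp [n₂, t₂])

lemma interaction_sq_le {f : E₁ × E₂ → ℝ} {r₁ q₁ : Measure E₁} {r₂ q₂ : Measure E₂}
    [IsFiniteMeasure r₁] [IsFiniteMeasure q₁] [IsFiniteMeasure r₂] [IsFiniteMeasure q₂]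
    {𝒬₁ : Set (Measure E₁)} {𝒬₂ : Set (Measure E₂)} (h₁ : q₁ ∈ 𝒬₁) (h₂ : q₂ ∈ 𝒬₂)
    (hq₁ : klDiv q₁ r₁ ≠ ∞) (hr₁ : klDiv r₁ q₁ ≠ ∞) (hq₂ : klDiv q₂ r₂ ≠ ∞)
    (hr₂ : klDiv r₂ q₂ ≠ ∞) {α g : ℝ} (hα : α ∈ Set.Icc (0 : ℝ) 1) (hg : 0 ≤ g)
    (hle : gcorrAt f r₁ r₂ 𝒬₁ 𝒬₂ α ≤ ENNReal.ofReal g) :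
    interaction f r₁ r₂ q₁ q₂ ^ 2 ≤
      g ^ 2 * ((α * (klDiv q₁ r₁).toReal + (1 - α) * (klDiv r₁ q₁).toReal) *
        ((1 - α) * (klDiv q₂ r₂).toReal + α * (klDiv r₂ q₂).toReal)) := by
  have hα' : 1 - α ∈ Set.Icc (0 : ℝ) 1 := ⟨by linarith [hα.2], by linarith [hα.1]⟩
  have t₁ := weightedKL_ne_top (α := α) hq₁ hr₁
  have t₂ := weightedKL_ne_top (α := 1 - α) hq₂ hr₂
  have h := (ofReal_abs_interaction_le (f := f) h₁ h₂ hq₁ hr₁ hq₂ hr₂ hα).trans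
    (mul_le_mul_left hle _)
  have h' := ENNReal.toReal_mono (by
    refine ENNReal.mul_ne_top ENNReal.ofReal_ne_top (ENNReal.mul_ne_top ?_ ?_) <;>
    simp [t₁, t₂]) h
  rw [ENNReal.toReal_mul, ENNReal.toReal_mul, ENNReal.toReal_ofReal (abs_nonneg _),
    ENNReal.toReal_ofReal hg, ← ENNReal.toReal_rpow, ← ENNReal.toReal_rpow,
    ← Real.sqrt_eq_rpow, ← Real.sqrt_eq_rpow, toReal_weightedKL hq₁ hr₁ hα,
    toReal_weightedKL hq₂ hr₂ hα', sub_sub_cancel] at h'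
  have h2 := pow_le_pow_left₀ (abs_nonneg _) h' 2
  rw [sq_abs, mul_pow, mul_pow, Real.sq_sqrt, Real.sq_sqrt] at h2
  · exact h2
  · exact add_nonneg (mul_nonneg hα'.1 ENNReal.toReal_nonneg)
      (mul_nonneg hα.1 ENNReal.toReal_nonneg)
  · exact add_nonneg (mul_nonneg hα.1 ENNReal.toReal_nonneg)
      (mul_nonneg hα'.1 ENNReal.toReal_nonneg)

/-- Here `a`, `b` stand for `D_α`, `D_{1-α}` of an updated block and `c`, `d` for those of the other
block. Weighting the hypotheses by `b` and `a` and adding gives `(a + b)³ ≤ g² (c + d) ab`; then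
`4ab ≤ (a + b)²`. -/
lemma four_mul_add_le {a b c d g : ℝ} (ha : 0 ≤ a) (hb : 0 ≤ b) (hc : 0 ≤ c) (hd : 0 ≤ d)
    (h₁ : (a + b) ^ 2 ≤ g ^ 2 * (a * c)) (h₂ : (a + b) ^ 2 ≤ g ^ 2 * (b * d)) :
    4 * (a + b) ≤ g ^ 2 * (c + d) := by
  rcases (add_nonneg ha hb).eq_or_lt with h0 | h0
  · have : 0 ≤ g ^ 2 * (c + d) := by positivity
    linarith
  have ha' : 0 < a := by
    refine ha.lt_of_ne fun h => ?_
    rw [← h] at h₁ h0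
    nlinarith [pow_pos h0 2]
  have hb' : 0 < b := by
    refine hb.lt_of_ne fun h => ?_
    rw [← h] at h₂ h0
    nlinarith [pow_pos h0 2]
  have h3 : (a + b) ^ 2 * (a + b) ≤ g ^ 2 * (c + d) * (a * b) := by nlinarith
  have h4 : 4 * (a * b) ≤ (a + b) ^ 2 := by nlinarith [sq_nonneg (a - b)]
  have h5 : (4 * (a + b)) * (a * b) ≤ g ^ 2 * (c + d) * (a * b) := by nlinarith
  exact le_of_mul_le_mul_right h5 (by positivity)

end MeanField

/-! ### The two-block model: objective, coordinate updates, optimum, bound on the correlation. -/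

namespace MeanField

variable {ι E₁ E₂ : Type*} [Fintype ι] [MeasureSpace E₁] [MeasureSpace E₂]

/-- The product statistic is integrable under products of measures of finite divergence. -/
lemma IsExpBlock.integrable_dotProduct_prod {E₁ E₂ : Type*} [MeasurableSpace E₁]
    [MeasurableSpace E₂] {T₁ : E₁ → ι → ℝ} {T₂ : E₂ → ι → ℝ} {ρ₁ : Measure E₁} {ρ₂ : Measure E₂}
    {𝒬₁ : Set (Measure E₁)} {𝒬₂ : Set (Measure E₂)} {c₁ c₂ : ℝ}
    (B₁ : IsExpBlock T₁ ρ₁ 𝒬₁ c₁) (B₂ : IsExpBlock T₂ ρ₂ 𝒬₂ c₂)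
    {p₁ : Measure E₁} {p₂ : Measure E₂} [IsProbabilityMeasure p₁] [IsProbabilityMeasure p₂]
    (h₁ : klDiv p₁ ρ₁ ≠ ∞) (h₂ : klDiv p₂ ρ₂ ≠ ∞) :
    Integrable (fun u : E₁ × E₂ => T₁ u.1 ⬝ᵥ T₂ u.2) (p₁.prod p₂) :=
  integrable_finsetSum _ fun i _ =>
    (B₁.integrable_apply h₁ i).mul_prod (B₂.integrable_apply h₂ i)

lemma IsExpBlock.integral_dotProduct_prod {E₁ E₂ : Type*} [MeasurableSpace E₁]
    [MeasurableSpace E₂] {T₁ : E₁ → ι → ℝ} {T₂ : E₂ → ι → ℝ} {ρ₁ : Measure E₁} {ρ₂ : Measure E₂}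
    {𝒬₁ : Set (Measure E₁)} {𝒬₂ : Set (Measure E₂)} {c₁ c₂ : ℝ}
    (B₁ : IsExpBlock T₁ ρ₁ 𝒬₁ c₁) (B₂ : IsExpBlock T₂ ρ₂ 𝒬₂ c₂)
    {p₁ : Measure E₁} {p₂ : Measure E₂} [IsProbabilityMeasure p₁] [IsProbabilityMeasure p₂]
    (h₁ : klDiv p₁ ρ₁ ≠ ∞) (h₂ : klDiv p₂ ρ₂ ≠ ∞) :
    ∫ u, T₁ u.1 ⬝ᵥ T₂ u.2 ∂(p₁.prod p₂) = statMean T₁ p₁ ⬝ᵥ statMean T₂ p₂ := by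
  simp only [dotProduct]
  rw [integral_finsetSum _ fun i _ =>
    (B₁.integrable_apply h₁ i).mul_prod (B₂.integrable_apply h₂ i)]
  exact Finset.sum_congr rfl fun i _ => integral_prod_mul (fun x => T₁ x i) (fun x => T₂ x i)

/-- A density on `E₁ × E₂` proportional to `exp (T₁ ⬝ᵥ T₂)` with respect to `ρ₁ ⊗ ρ₂`. -/
structure IsTwoBlock (f : E₁ × E₂ → ℝ) (T₁ : E₁ → ι → ℝ) (T₂ : E₂ → ι → ℝ)
    (ρ₁ : Measure E₁) (ρ₂ : Measure E₂) (𝒬₁ : Set (Measure E₁)) (𝒬₂ : Set (Measure E₂))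
    (c₁ c₂ : ℝ) : Prop where
  block₁ : IsExpBlock T₁ ρ₁ 𝒬₁ c₁
  block₂ : IsExpBlock T₂ ρ₂ 𝒬₂ c₂
  mul_lt_one : c₁ * c₂ < 1
  target_eq : target f = (ρ₁.prod ρ₂).tilted (fun u => T₁ u.1 ⬝ᵥ T₂ u.2)
  integrable_exp : Integrable (fun u => Real.exp (T₁ u.1 ⬝ᵥ T₂ u.2)) (ρ₁.prod ρ₂)
  -- Gaussian tails under the target itself, needed to recover finite marginal divergences from a
  -- finite objective.
  integrable_exp_add : ∃ ε > 0, Integrable (fun u => Real.exp (T₁ u.1 ⬝ᵥ T₂ u.2 +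
    ε * (T₁ u.1 ⬝ᵥ T₁ u.1 + T₂ u.2 ⬝ᵥ T₂ u.2))) (ρ₁.prod ρ₂)
  interaction_eq : ∀ r₁ ∈ 𝒬₁, ∀ r₂ ∈ 𝒬₂, ∀ q₁ ∈ 𝒬₁, ∀ q₂ ∈ 𝒬₂,
    interaction f r₁ r₂ q₁ q₂ = (statMean T₁ q₁ - statMean T₁ r₁) ⬝ᵥ
      (statMean T₂ q₂ - statMean T₂ r₂)

namespace IsTwoBlock

variable {f : E₁ × E₂ → ℝ} {T₁ : E₁ → ι → ℝ} {T₂ : E₂ → ι → ℝ}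
  {ρ₁ : Measure E₁} {ρ₂ : Measure E₂} {𝒬₁ : Set (Measure E₁)} {𝒬₂ : Set (Measure E₂)}
  {c₁ c₂ : ℝ}

/-- The entropy inequality relative to the target makes `|T₁|² + |T₂|²`, hence `⟨T₁, T₂⟩`,
integrable under `p₁ ⊗ p₂`. The tilt can then be undone and the divergence splits over the factors.
-/
lemma klDiv_ne_top_of_objective (M : IsTwoBlock f T₁ T₂ ρ₁ ρ₂ 𝒬₁ 𝒬₂ c₁ c₂)
    {p₁ : Measure E₁} {p₂ : Measure E₂} [IsProbabilityMeasure p₁] [IsProbabilityMeasure p₂]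
    (h : objective f p₁ p₂ ≠ ∞) : klDiv p₁ ρ₁ ≠ ∞ ∧ klDiv p₂ ρ₂ ≠ ∞ := by
  have := M.block₁.prob
  have := M.block₂.prob
  obtain ⟨ε, hε, hint⟩ := M.integrable_exp_add
  have hexp := M.integrable_exp
  have hprob := isProbabilityMeasure_tilted hexp
  rw [objective, M.target_eq] at h
  have m₁ : Measurable fun u : E₁ × E₂ => T₁ u.1 ⬝ᵥ T₁ u.1 :=
    M.block₁.measurable_dotProduct_self.comp measurable_fst
  have m₂ : Measurable fun u : E₁ × E₂ => T₂ u.2 ⬝ᵥ T₂ u.2 :=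
    M.block₂.measurable_dotProduct_self.comp measurable_snd
  have m : Measurable fun u : E₁ × E₂ => T₁ u.1 ⬝ᵥ T₂ u.2 :=
    Finset.measurable_sum _ fun i _ => ((M.block₁.measurable_apply i).comp measurable_fst).mul
      ((M.block₂.measurable_apply i).comp measurable_snd)
  have h1 := integrable_of_klDiv_ne_top h ((m₁.add m₂).const_mul ε)
    (fun u => mul_nonneg hε.le (add_nonneg (dotProduct_self_nonneg' _)
      (dotProduct_self_nonneg' _))) (by
    rw [integrable_tilted_iff hexp]
    simpa [← Real.exp_add] using hint)
  have h2 : Integrable (fun u => T₁ u.1 ⬝ᵥ T₁ u.1 + T₂ u.2 ⬝ᵥ T₂ u.2) (p₁.prod p₂) := by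
    have h := h1.const_mul ε⁻¹
    simpa only [Pi.add_apply, inv_mul_cancel_left₀ hε.ne'] using h
  have h3 : Integrable (fun u => T₁ u.1 ⬝ᵥ T₂ u.2) (p₁.prod p₂) := by
    refine h2.mono' m.aestronglyMeasurable ?_
    filter_upwards with u
    rw [Real.norm_eq_abs]
    have a := dotProduct_self_nonneg' (T₁ u.1)
    have b := dotProduct_self_nonneg' (T₂ u.2)
    refine abs_le_of_sq_le_sq ?_ (add_nonneg a b)
    nlinarith [sq_dotProduct_le (T₁ u.1) (T₂ u.2)]
  have h4 := klDiv_ne_top_of_tilted_right h h3 hexp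
  rwa [klDiv_prod, ENNReal.add_ne_top] at h4

lemma objective_ne_top (M : IsTwoBlock f T₁ T₂ ρ₁ ρ₂ 𝒬₁ 𝒬₂ c₁ c₂)
    {p₁ : Measure E₁} {p₂ : Measure E₂} [IsProbabilityMeasure p₁] [IsProbabilityMeasure p₂]
    (h₁ : klDiv p₁ ρ₁ ≠ ∞) (h₂ : klDiv p₂ ρ₂ ≠ ∞) : objective f p₁ p₂ ≠ ∞ := by
  have := M.block₁.prob
  have := M.block₂.prob
  rw [objective, M.target_eq]
  exact klDiv_tilted_right_ne_top (by rw [klDiv_prod]; exact ENNReal.add_ne_top.2 ⟨h₁, h₂⟩)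
    (M.block₁.integrable_dotProduct_prod M.block₂ h₁ h₂) M.integrable_exp

lemma toReal_objective (M : IsTwoBlock f T₁ T₂ ρ₁ ρ₂ 𝒬₁ 𝒬₂ c₁ c₂)
    {p₁ : Measure E₁} {p₂ : Measure E₂} [IsProbabilityMeasure p₁] [IsProbabilityMeasure p₂]
    (h₁ : klDiv p₁ ρ₁ ≠ ∞) (h₂ : klDiv p₂ ρ₂ ≠ ∞) :
    (objective f p₁ p₂).toReal = (klDiv p₁ ρ₁).toReal + (klDiv p₂ ρ₂).toReal -
      statMean T₁ p₁ ⬝ᵥ statMean T₂ p₂ +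
      Real.log (∫ u, Real.exp (T₁ u.1 ⬝ᵥ T₂ u.2) ∂(ρ₁.prod ρ₂)) := by
  have := M.block₁.prob
  have := M.block₂.prob
  have h : klDiv (p₁.prod p₂) (ρ₁.prod ρ₂) ≠ ∞ := by
    rw [klDiv_prod]; exact ENNReal.add_ne_top.2 ⟨h₁, h₂⟩
  rw [objective, M.target_eq, toReal_klDiv_tilted_right h (M.block₁.integrable_dotProduct_prod M.block₂ h₁ h₂)
    M.integrable_exp, M.block₁.integral_dotProduct_prod M.block₂ h₁ h₂, klDiv_prod, ENNReal.toReal_add h₁ h₂]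

lemma objective_le_iff (M : IsTwoBlock f T₁ T₂ ρ₁ ρ₂ 𝒬₁ 𝒬₂ c₁ c₂)
    {p₁ q₁ : Measure E₁} {p₂ q₂ : Measure E₂} [IsProbabilityMeasure p₁] [IsProbabilityMeasure p₂]
    [IsProbabilityMeasure q₁] [IsProbabilityMeasure q₂]
    (h₁ : klDiv p₁ ρ₁ ≠ ∞) (h₂ : klDiv p₂ ρ₂ ≠ ∞) (k₁ : klDiv q₁ ρ₁ ≠ ∞)
    (k₂ : klDiv q₂ ρ₂ ≠ ∞) :
    objective f p₁ p₂ ≤ objective f q₁ q₂ ↔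
      (klDiv p₁ ρ₁).toReal + (klDiv p₂ ρ₂).toReal - statMean T₁ p₁ ⬝ᵥ statMean T₂ p₂ ≤
      (klDiv q₁ ρ₁).toReal + (klDiv q₂ ρ₂).toReal - statMean T₁ q₁ ⬝ᵥ statMean T₂ q₂ := by
  rw [← ENNReal.toReal_le_toReal (M.objective_ne_top h₁ h₂) (M.objective_ne_top k₁ k₂),
    M.toReal_objective h₁ h₂, M.toReal_objective k₁ k₂, add_le_add_iff_right]

/-- By the Gibbs principle the gap is a divergence to the tilt; an infinite right side is trivial.
-/
lemma objective_expTilt_left_le (M : IsTwoBlock f T₁ T₂ ρ₁ ρ₂ 𝒬₁ 𝒬₂ c₁ c₂)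
    {p₂ : Measure E₂} [IsProbabilityMeasure p₂] (h₂ : klDiv p₂ ρ₂ ≠ ∞) (p : Measure E₁)
    [IsProbabilityMeasure p] :
    objective f (expTilt T₁ ρ₁ (statMean T₂ p₂)) p₂ ≤ objective f p p₂ := by
  have hr := M.block₁.tilt_mem (statMean T₂ p₂)
  have := M.block₁.prob_mem _ hr
  by_cases hp : objective f p p₂ = ∞
  · rw [hp]; exact le_top
  have hp := (M.klDiv_ne_top_of_objective hp).1
  rw [M.objective_le_iff (M.block₁.klDiv_base _ hr) h₂ hp h₂]
  have h := M.block₁.toReal_klDiv_expTilt_eq hp (statMean T₂ p₂)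
  have h0 : 0 ≤ (klDiv p (expTilt T₁ ρ₁ (statMean T₂ p₂))).toReal := ENNReal.toReal_nonneg
  linarith

lemma objective_expTilt_right_le (M : IsTwoBlock f T₁ T₂ ρ₁ ρ₂ 𝒬₁ 𝒬₂ c₁ c₂)
    {p₁ : Measure E₁} [IsProbabilityMeasure p₁] (h₁ : klDiv p₁ ρ₁ ≠ ∞) (p : Measure E₂)
    [IsProbabilityMeasure p] :
    objective f p₁ (expTilt T₂ ρ₂ (statMean T₁ p₁)) ≤ objective f p₁ p := by
  have hr := M.block₂.tilt_mem (statMean T₁ p₁)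
  have := M.block₂.prob_mem _ hr
  by_cases hp : objective f p₁ p = ∞
  · rw [hp]; exact le_top
  have hp := (M.klDiv_ne_top_of_objective hp).2
  rw [M.objective_le_iff h₁ (M.block₂.klDiv_base _ hr) h₁ hp]
  have h := M.block₂.toReal_klDiv_expTilt_eq hp (statMean T₁ p₁)
  have h0 : 0 ≤ (klDiv p (expTilt T₂ ρ₂ (statMean T₁ p₁))).toReal := ENNReal.toReal_nonneg
  rw [dotProduct_comm (statMean T₁ p₁), dotProduct_comm (statMean T₁ p₁)]
  linarith

/-- A minimiser has zero gap, so its divergence to the tilt vanishes. -/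
lemma eq_expTilt_left (M : IsTwoBlock f T₁ T₂ ρ₁ ρ₂ 𝒬₁ 𝒬₂ c₁ c₂)
    {p₂ : Measure E₂} [IsProbabilityMeasure p₂] (h₂ : klDiv p₂ ρ₂ ≠ ∞) {q : Measure E₁}
    [IsProbabilityMeasure q]
    (hq : ∀ p : Measure E₁, IsProbabilityMeasure p → objective f q p₂ ≤ objective f p p₂) :
    q = expTilt T₁ ρ₁ (statMean T₂ p₂) := by
  have hr := M.block₁.tilt_mem (statMean T₂ p₂)
  have := M.block₁.prob_mem _ hr
  have hle := hq _ this
  have hr' := M.block₁.klDiv_base _ hr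
  have hp := (M.klDiv_ne_top_of_objective (ne_top_of_le_ne_top (M.objective_ne_top hr' h₂) hle)).1
  rw [M.objective_le_iff hp h₂ hr' h₂] at hle
  have h := M.block₁.toReal_klDiv_expTilt_eq hp (statMean T₂ p₂)
  have h0 : 0 ≤ (klDiv q (expTilt T₁ ρ₁ (statMean T₂ p₂))).toReal := ENNReal.toReal_nonneg
  exact M.block₁.eq_of_toReal_klDiv_eq_zero hp hr (by linarith)

lemma eq_expTilt_right (M : IsTwoBlock f T₁ T₂ ρ₁ ρ₂ 𝒬₁ 𝒬₂ c₁ c₂)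
    {p₁ : Measure E₁} [IsProbabilityMeasure p₁] (h₁ : klDiv p₁ ρ₁ ≠ ∞) {q : Measure E₂}
    [IsProbabilityMeasure q]
    (hq : ∀ p : Measure E₂, IsProbabilityMeasure p → objective f p₁ q ≤ objective f p₁ p) :
    q = expTilt T₂ ρ₂ (statMean T₁ p₁) := by
  have hr := M.block₂.tilt_mem (statMean T₁ p₁)
  have := M.block₂.prob_mem _ hr
  have hle := hq _ this
  have hr' := M.block₂.klDiv_base _ hr
  have hp := (M.klDiv_ne_top_of_objective (ne_top_of_le_ne_top (M.objective_ne_top h₁ hr') hle)).2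
  rw [M.objective_le_iff h₁ hp h₁ hr', dotProduct_comm (statMean T₁ p₁),
    dotProduct_comm (statMean T₁ p₁)] at hle
  have h := M.block₂.toReal_klDiv_expTilt_eq hp (statMean T₁ p₁)
  have h0 : 0 ≤ (klDiv q (expTilt T₂ ρ₂ (statMean T₁ p₁))).toReal := ENNReal.toReal_nonneg
  exact M.block₂.eq_of_toReal_klDiv_eq_zero hp hr (by linarith)

lemma exists_isParallelCAVI (M : IsTwoBlock f T₁ T₂ ρ₁ ρ₂ 𝒬₁ 𝒬₂ c₁ c₂) {p₁ : Measure E₁}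
    {p₂ : Measure E₂} (hp : IsMeanField f p₁ p₂) :
    ∃ q₁ q₂, IsParallelCAVI f q₁ q₂ ∧ q₁ 0 = p₁ ∧ q₂ 0 = p₂ := by
  let q : ℕ → Measure E₁ × Measure E₂ := fun t => Nat.rec (p₁, p₂)
    (fun _ u => (expTilt T₁ ρ₁ (statMean T₂ u.2), expTilt T₂ ρ₂ (statMean T₁ u.1))) t
  have hq : ∀ t, (IsProbabilityMeasure (q t).1 ∧ klDiv (q t).1 ρ₁ ≠ ∞) ∧
      (IsProbabilityMeasure (q t).2 ∧ klDiv (q t).2 ρ₂ ≠ ∞) := by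
    intro t
    cases t with
    | zero =>
      have := hp.prob₁
      have := hp.prob₂
      have h := M.klDiv_ne_top_of_objective hp.finite
      exact ⟨⟨hp.prob₁, h.1⟩, ⟨hp.prob₂, h.2⟩⟩
    | succ t =>
      have h₁ := M.block₁.tilt_mem (statMean T₂ (q t).2)
      have h₂ := M.block₂.tilt_mem (statMean T₁ (q t).1)
      exact ⟨⟨M.block₁.prob_mem _ h₁, M.block₁.klDiv_base _ h₁⟩,
        ⟨M.block₂.prob_mem _ h₂, M.block₂.klDiv_base _ h₂⟩⟩
  refine ⟨fun t => (q t).1, fun t => (q t).2, ⟨hp, fun t => (hq t).1.1, fun t => (hq t).2.1,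
    fun t p _ => ?_, fun t p _ => ?_⟩, rfl, rfl⟩
  · have := (hq t).2.1
    exact M.objective_expTilt_left_le (hq t).2.2 p
  · have := (hq t).1.1
    exact M.objective_expTilt_right_le (hq t).1.2 p

lemma cavi_klDiv_ne_top (M : IsTwoBlock f T₁ T₂ ρ₁ ρ₂ 𝒬₁ 𝒬₂ c₁ c₂) {q₁ : ℕ → Measure E₁}
    {q₂ : ℕ → Measure E₂} (h : IsParallelCAVI f q₁ q₂) (t : ℕ) :
    klDiv (q₁ t) ρ₁ ≠ ∞ ∧ klDiv (q₂ t) ρ₂ ≠ ∞ := by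
  have := h.prob₁
  have := h.prob₂
  induction t with
  | zero => exact M.klDiv_ne_top_of_objective h.init.finite
  | succ t ih =>
    rw [M.eq_expTilt_left ih.2 (h.step₁ t), M.eq_expTilt_right ih.1 (h.step₂ t)]
    exact ⟨M.block₁.klDiv_base _ (M.block₁.tilt_mem _),
      M.block₂.klDiv_base _ (M.block₂.tilt_mem _)⟩

lemma cavi_eq_left (M : IsTwoBlock f T₁ T₂ ρ₁ ρ₂ 𝒬₁ 𝒬₂ c₁ c₂) {q₁ : ℕ → Measure E₁}
    {q₂ : ℕ → Measure E₂} (h : IsParallelCAVI f q₁ q₂) (t : ℕ) :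
    q₁ (t + 1) = expTilt T₁ ρ₁ (statMean T₂ (q₂ t)) := by
  have := h.prob₁
  have := h.prob₂
  exact M.eq_expTilt_left (M.cavi_klDiv_ne_top h t).2 (h.step₁ t)

lemma cavi_eq_right (M : IsTwoBlock f T₁ T₂ ρ₁ ρ₂ 𝒬₁ 𝒬₂ c₁ c₂) {q₁ : ℕ → Measure E₁}
    {q₂ : ℕ → Measure E₂} (h : IsParallelCAVI f q₁ q₂) (t : ℕ) :
    q₂ (t + 1) = expTilt T₂ ρ₂ (statMean T₁ (q₁ t)) := by
  have := h.prob₁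
  have := h.prob₂
  exact M.eq_expTilt_right (M.cavi_klDiv_ne_top h t).1 (h.step₂ t)

/-- Growth of the objective around a fixed point. The gap equals the two divergences minus `⟨u, v⟩`,
with `u`, `v` the mean shifts; the transport inequalities and AM–GM bound `⟨u, v⟩` by `√(c₁c₂)`
times the sum of the divergences. -/
lemma mul_add_le_objective_sub (M : IsTwoBlock f T₁ T₂ ρ₁ ρ₂ 𝒬₁ 𝒬₂ c₁ c₂) {r₁ : Measure E₁}
    {r₂ : Measure E₂} (hr₁ : r₁ = expTilt T₁ ρ₁ (statMean T₂ r₂))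
    (hr₂ : r₂ = expTilt T₂ ρ₂ (statMean T₁ r₁)) {p₁ : Measure E₁} {p₂ : Measure E₂}
    [IsProbabilityMeasure p₁] [IsProbabilityMeasure p₂]
    (h₁ : klDiv p₁ ρ₁ ≠ ∞) (h₂ : klDiv p₂ ρ₂ ≠ ∞) :
    (1 - √(c₁ * c₂)) * ((klDiv p₁ r₁).toReal + (klDiv p₂ r₂).toReal) ≤
      ((klDiv p₁ ρ₁).toReal + (klDiv p₂ ρ₂).toReal - statMean T₁ p₁ ⬝ᵥ statMean T₂ p₂) -
      ((klDiv r₁ ρ₁).toReal + (klDiv r₂ ρ₂).toReal - statMean T₁ r₁ ⬝ᵥ statMean T₂ r₂) := by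
  have m₁ := M.block₁.tilt_mem (statMean T₂ r₂)
  have m₂ := M.block₂.tilt_mem (statMean T₁ r₁)
  have e₁ := M.block₁.toReal_klDiv_expTilt_eq h₁ (statMean T₂ r₂)
  have e₂ := M.block₂.toReal_klDiv_expTilt_eq h₂ (statMean T₁ r₁)
  rw [← hr₁] at m₁ e₁
  rw [← hr₂] at m₂ e₂
  have b₁ := M.block₁.dotProduct_sub_self_le h₁ m₁
  have b₂ := M.block₂.dotProduct_sub_self_le h₂ m₂
  have k₁ : 0 ≤ (klDiv p₁ r₁).toReal := ENNReal.toReal_nonneg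
  have k₂ : 0 ≤ (klDiv p₂ r₂).toReal := ENNReal.toReal_nonneg
  have hcs := sq_dotProduct_le (statMean T₁ p₁ - statMean T₁ r₁) (statMean T₂ p₂ - statMean T₂ r₂)
  have hexp : (statMean T₁ p₁ - statMean T₁ r₁) ⬝ᵥ (statMean T₂ p₂ - statMean T₂ r₂) =
      statMean T₁ p₁ ⬝ᵥ statMean T₂ p₂ - statMean T₁ p₁ ⬝ᵥ statMean T₂ r₂ -
      statMean T₂ p₂ ⬝ᵥ statMean T₁ r₁ + statMean T₁ r₁ ⬝ᵥ statMean T₂ r₂ := by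
    rw [dotProduct_comm (statMean T₂ p₂)]
    simp only [sub_dotProduct, dotProduct_sub]
    ring
  rw [dotProduct_comm (statMean T₂ r₂)] at e₂
  have hc : 0 ≤ c₁ * c₂ := mul_nonneg M.block₁.nonneg M.block₂.nonneg
  set u := statMean T₁ p₁ - statMean T₁ r₁
  set v := statMean T₂ p₂ - statMean T₂ r₂
  set K₁ := (klDiv p₁ r₁).toReal
  set K₂ := (klDiv p₂ r₂).toReal
  have hle : u ⬝ᵥ v ≤ √(c₁ * c₂) * (K₁ + K₂) := by
    refine le_of_sq_le_sq ?_ (by positivity)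
    rw [mul_pow, Real.sq_sqrt hc]
    calc (u ⬝ᵥ v) ^ 2 ≤ (2 * c₁ * K₁) * (2 * c₂ * K₂) :=
          hcs.trans (mul_le_mul b₁ b₂ (dotProduct_self_nonneg' v)
            ((dotProduct_self_nonneg' u).trans b₁))
      _ = c₁ * c₂ * (4 * (K₁ * K₂)) := by ring
      _ ≤ c₁ * c₂ * (K₁ + K₂) ^ 2 := by
          gcongr; nlinarith [sq_nonneg (K₁ - K₂)]
  linarith

/-- A pair of mutually optimal tilts is the unique global minimiser. -/
lemma isOptimal_of_fixedPoint (M : IsTwoBlock f T₁ T₂ ρ₁ ρ₂ 𝒬₁ 𝒬₂ c₁ c₂) {r₁ : Measure E₁}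
    {r₂ : Measure E₂} (hr₁ : r₁ = expTilt T₁ ρ₁ (statMean T₂ r₂))
    (hr₂ : r₂ = expTilt T₂ ρ₂ (statMean T₁ r₁)) :
    IsOptimal f r₁ r₂ ∧ ∀ p₁ p₂, IsOptimal f p₁ p₂ → p₁ = r₁ ∧ p₂ = r₂ := by
  have m₁ := M.block₁.tilt_mem (statMean T₂ r₂)
  have m₂ := M.block₂.tilt_mem (statMean T₁ r₁)
  rw [← hr₁] at m₁
  rw [← hr₂] at m₂
  have i₁ := M.block₁.prob_mem _ m₁
  have i₂ := M.block₂.prob_mem _ m₂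
  have f₁ := M.block₁.klDiv_base _ m₁
  have f₂ := M.block₂.klDiv_base _ m₂
  have hs : 0 < 1 - √(c₁ * c₂) := by
    have := Real.sqrt_lt_sqrt (mul_nonneg M.block₁.nonneg M.block₂.nonneg) M.mul_lt_one
    rw [Real.sqrt_one] at this
    linarith
  have hmem : IsMeanField f r₁ r₂ := ⟨i₁, i₂, M.objective_ne_top f₁ f₂⟩
  refine ⟨⟨hmem, fun p₁ p₂ hp => ?_⟩, fun p₁ p₂ hp => ?_⟩
  · have := hp.prob₁
    have := hp.prob₂
    obtain ⟨h₁, h₂⟩ := M.klDiv_ne_top_of_objective hp.finite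
    rw [M.objective_le_iff f₁ f₂ h₁ h₂]
    have h := M.mul_add_le_objective_sub hr₁ hr₂ h₁ h₂
    have h0 : 0 ≤ (1 - √(c₁ * c₂)) * ((klDiv p₁ r₁).toReal + (klDiv p₂ r₂).toReal) :=
      mul_nonneg hs.le (add_nonneg ENNReal.toReal_nonneg ENNReal.toReal_nonneg)
    linarith
  · have := hp.mem.prob₁
    have := hp.mem.prob₂
    obtain ⟨h₁, h₂⟩ := M.klDiv_ne_top_of_objective hp.mem.finite
    have hle := hp.le _ _ hmem
    rw [M.objective_le_iff h₁ h₂ f₁ f₂] at hle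
    have h := M.mul_add_le_objective_sub hr₁ hr₂ h₁ h₂
    have k₁ : 0 ≤ (klDiv p₁ r₁).toReal := ENNReal.toReal_nonneg
    have k₂ : 0 ≤ (klDiv p₂ r₂).toReal := ENNReal.toReal_nonneg
    have h0 : (klDiv p₁ r₁).toReal + (klDiv p₂ r₂).toReal ≤ 0 := by
      by_contra! hlt
      have := mul_pos hs hlt
      linarith
    exact ⟨M.block₁.eq_of_toReal_klDiv_eq_zero h₁ m₁ (by linarith),
      M.block₂.eq_of_toReal_klDiv_eq_zero h₂ m₂ (by linarith)⟩

lemma exists_fixedPoint (M : IsTwoBlock f T₁ T₂ ρ₁ ρ₂ 𝒬₁ 𝒬₂ c₁ c₂) :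
    ∃ r₁ r₂, r₁ = expTilt T₁ ρ₁ (statMean T₂ r₂) ∧ r₂ = expTilt T₂ ρ₂ (statMean T₁ r₁) := by
  obtain ⟨w₁, w₂, h₁, h₂⟩ := exists_fixedPoint_expTilt M.block₁ M.block₂ M.mul_lt_one
  exact ⟨expTilt T₁ ρ₁ w₁, expTilt T₂ ρ₂ w₂, by rw [← h₁], by rw [← h₂]⟩

/-- The generalized correlation is bounded through the sub-Gaussian constants of the blocks. -/
lemma gcorr_le (M : IsTwoBlock f T₁ T₂ ρ₁ ρ₂ 𝒬₁ 𝒬₂ c₁ c₂) {r₁ : Measure E₁}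
    {r₂ : Measure E₂} (m₁ : r₁ ∈ 𝒬₁) (m₂ : r₂ ∈ 𝒬₂) :
    gcorr f r₁ r₂ 𝒬₁ 𝒬₂ ≤ ENNReal.ofReal (2 * √(c₁ * c₂)) := by
  have hhalf : (1 / 2 : ℝ) ∈ Set.Icc (0 : ℝ) 1 := by constructor <;> norm_num
  have i₁ := M.block₁.prob_mem _ m₁
  have i₂ := M.block₂.prob_mem _ m₂
  -- At `α = 1/2` both entries of the maximum coincide. Averaging the transport inequality over its
  -- two directions gives `|mean shift|² ≤ 2c D_{1/2}` in each block; Cauchy–Schwarz then yields the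
  -- constant `√(2c₁ · 2c₂)`.
  have key : gcorrAt f r₁ r₂ 𝒬₁ 𝒬₂ (1 / 2) ≤ ENNReal.ofReal (2 * √(c₁ * c₂)) := by
    refine iSup₂_le fun q₁ hq₁ => iSup₂_le fun q₂ hq₂ => ?_
    have j₁ := M.block₁.prob_mem _ hq₁.1
    have j₂ := M.block₂.prob_mem _ hq₂.1
    have a₁ := M.block₁.klDiv_mem _ m₁ q₁ j₁ (M.block₁.klDiv_base _ hq₁.1)
    have a₂ := M.block₂.klDiv_mem _ m₂ q₂ j₂ (M.block₂.klDiv_base _ hq₂.1)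
    have b₁ := M.block₁.klDiv_mem _ hq₁.1 r₁ i₁ (M.block₁.klDiv_base _ m₁)
    have b₂ := M.block₂.klDiv_mem _ hq₂.1 r₂ i₂ (M.block₂.klDiv_base _ m₂)
    have s₁ := M.block₁.dotProduct_sub_self_le (M.block₁.klDiv_base _ hq₁.1) m₁
    have s₂ := M.block₂.dotProduct_sub_self_le (M.block₂.klDiv_base _ hq₂.1) m₂
    have t₁ := M.block₁.dotProduct_sub_self_le (M.block₁.klDiv_base _ m₁) hq₁.1
    have t₂ := M.block₂.dotProduct_sub_self_le (M.block₂.klDiv_base _ m₂) hq₂.1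
    rw [← neg_sub, neg_dotProduct_neg] at t₁ t₂
    have w₁ := toReal_weightedKL a₁ b₁ hhalf
    have w₂ := toReal_weightedKL a₂ b₂ hhalf
    have hcs := sq_dotProduct_le (statMean T₁ q₁ - statMean T₁ r₁)
      (statMean T₂ q₂ - statMean T₂ r₂)
    rw [M.interaction_eq _ m₁ _ m₂ _ hq₁.1 _ hq₂.1, show (1 : ℝ) - 1 / 2 = 1 / 2 by norm_num]
    have n₁ := weightedKL_ne_top (α := 1 / 2) a₁ b₁
    have n₂ := weightedKL_ne_top (α := 1 / 2) a₂ b₂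
    refine ENNReal.div_le_of_le_mul ?_
    have hW : weightedKL (1 / 2) q₁ r₁ ^ (1 / 2 : ℝ) * weightedKL (1 / 2) q₂ r₂ ^ (1 / 2 : ℝ) =
        ENNReal.ofReal (√(weightedKL (1 / 2) q₁ r₁).toReal *
          √(weightedKL (1 / 2) q₂ r₂).toReal) := by
      rw [ENNReal.ofReal_mul (Real.sqrt_nonneg _), Real.sqrt_eq_rpow, Real.sqrt_eq_rpow,
        ← ENNReal.ofReal_rpow_of_nonneg ENNReal.toReal_nonneg (by norm_num),
        ← ENNReal.ofReal_rpow_of_nonneg ENNReal.toReal_nonneg (by norm_num),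
        ENNReal.ofReal_toReal n₁, ENNReal.ofReal_toReal n₂]
    rw [hW, ← ENNReal.ofReal_mul (by positivity)]
    refine ENNReal.ofReal_le_ofReal (abs_le_of_sq_le_sq ?_ (by positivity))
    have hc : 0 ≤ c₁ * c₂ := mul_nonneg M.block₁.nonneg M.block₂.nonneg
    rw [mul_pow, mul_pow, mul_pow, Real.sq_sqrt hc, Real.sq_sqrt ENNReal.toReal_nonneg,
      Real.sq_sqrt ENNReal.toReal_nonneg]
    calc _ ≤ (2 * c₁ * (weightedKL (1 / 2) q₁ r₁).toReal) *
          (2 * c₂ * (weightedKL (1 / 2) q₂ r₂).toReal) := by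
          refine hcs.trans (mul_le_mul ?_ ?_ (dotProduct_self_nonneg' _) ?_)
          · rw [w₁]; linarith
          · rw [w₂]; linarith
          · have := M.block₁.nonneg
            positivity
      _ = _ := by ring
  unfold gcorr
  refine iInf₂_le_of_le (1 / 2) hhalf (max_le key ?_)
  rwa [show (1 : ℝ) - 1 / 2 = 1 / 2 by norm_num]

end IsTwoBlock

end MeanField

/-! ### Contraction of the parallel updates. -/

namespace MeanField

/-- The infimum over `α` need not be attained: each `g` above it admits a suitable `α`, and `g` is
then let down to the infimum. -/
lemma toReal_mul_le_of_gcorr {E₁ E₂ : Type*} [MeasureSpace E₁] [MeasureSpace E₂]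
    {f : E₁ × E₂ → ℝ} {r₁ : Measure E₁} {r₂ : Measure E₂} {𝒬₁ : Set (Measure E₁)}
    {𝒬₂ : Set (Measure E₂)} (hG : gcorr f r₁ r₂ 𝒬₁ 𝒬₂ ≠ ∞) {a b : ℝ}
    (h : ∀ α ∈ Set.Icc (0 : ℝ) 1, ∀ g : ℝ, 0 ≤ g →
      gcorrAt f r₁ r₂ 𝒬₁ 𝒬₂ α ≤ ENNReal.ofReal g →
      gcorrAt f r₁ r₂ 𝒬₁ 𝒬₂ (1 - α) ≤ ENNReal.ofReal g → a ≤ g ^ 2 * b) :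
    a ≤ (gcorr f r₁ r₂ 𝒬₁ 𝒬₂).toReal ^ 2 * b := by
  set G := (gcorr f r₁ r₂ 𝒬₁ 𝒬₂).toReal with hGdef
  have ht : Tendsto (fun g : ℝ => g ^ 2 * b) (𝓝[>] G) (𝓝 (G ^ 2 * b)) :=
    ((continuous_id.pow 2).mul continuous_const).continuousAt.tendsto.mono_left
      nhdsWithin_le_nhds
  refine ge_of_tendsto ht ?_
  filter_upwards [self_mem_nhdsWithin] with g hg
  have hg' : G < g := hg
  have hg0 : 0 ≤ g := ENNReal.toReal_nonneg.trans hg'.le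
  have hlt : gcorr f r₁ r₂ 𝒬₁ 𝒬₂ < ENNReal.ofReal g := by
    rw [← ENNReal.ofReal_toReal hG, ← hGdef]
    exact (ENNReal.ofReal_lt_ofReal_iff (ENNReal.toReal_nonneg.trans_lt hg')).2 hg'
  rw [gcorr] at hlt
  simp only [iInf_lt_iff, max_lt_iff] at hlt
  obtain ⟨α, hα, h1, h2⟩ := hlt
  exact h α hα g hg0 h1.le h2.le

namespace IsTwoBlock

variable {ι E₁ E₂ : Type*} [Fintype ι] [MeasureSpace E₁] [MeasureSpace E₂]
variable {f : E₁ × E₂ → ℝ} {T₁ : E₁ → ι → ℝ} {T₂ : E₂ → ι → ℝ}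
  {ρ₁ : Measure E₁} {ρ₂ : Measure E₂} {𝒬₁ : Set (Measure E₁)} {𝒬₂ : Set (Measure E₂)}
  {c₁ c₂ : ℝ}

/-- The parameter shift of the response is the mean shift of `q₂`, so the pairing in
`symm_klDiv_expTilt` is the interaction. -/
lemma interaction_expTilt_left (M : IsTwoBlock f T₁ T₂ ρ₁ ρ₂ 𝒬₁ 𝒬₂ c₁ c₂) {r₁ : Measure E₁}
    {r₂ q₂ : Measure E₂} (hr₁ : r₁ = expTilt T₁ ρ₁ (statMean T₂ r₂))
    (hr₂ : r₂ = expTilt T₂ ρ₂ (statMean T₁ r₁)) (hq₂ : q₂ ∈ 𝒬₂) :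
    interaction f r₁ r₂ (expTilt T₁ ρ₁ (statMean T₂ q₂)) q₂ =
      (klDiv (expTilt T₁ ρ₁ (statMean T₂ q₂)) r₁).toReal +
        (klDiv r₁ (expTilt T₁ ρ₁ (statMean T₂ q₂))).toReal := by
  have m₁ := M.block₁.tilt_mem (statMean T₂ r₂)
  have m₂ := M.block₂.tilt_mem (statMean T₁ r₁)
  have h := M.block₁.symm_klDiv_expTilt (statMean T₂ q₂) (statMean T₂ r₂)
  rw [← hr₁] at m₁ h
  rw [← hr₂] at m₂
  rw [h, M.interaction_eq _ m₁ _ m₂ _ (M.block₁.tilt_mem _) _ hq₂]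

lemma interaction_expTilt_right (M : IsTwoBlock f T₁ T₂ ρ₁ ρ₂ 𝒬₁ 𝒬₂ c₁ c₂) {r₁ q₁ : Measure E₁}
    {r₂ : Measure E₂} (hr₁ : r₁ = expTilt T₁ ρ₁ (statMean T₂ r₂))
    (hr₂ : r₂ = expTilt T₂ ρ₂ (statMean T₁ r₁)) (hq₁ : q₁ ∈ 𝒬₁) :
    interaction f r₁ r₂ q₁ (expTilt T₂ ρ₂ (statMean T₁ q₁)) =
      (klDiv (expTilt T₂ ρ₂ (statMean T₁ q₁)) r₂).toReal +
        (klDiv r₂ (expTilt T₂ ρ₂ (statMean T₁ q₁))).toReal := by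
  have m₁ := M.block₁.tilt_mem (statMean T₂ r₂)
  have m₂ := M.block₂.tilt_mem (statMean T₁ r₁)
  have h := M.block₂.symm_klDiv_expTilt (statMean T₁ q₁) (statMean T₁ r₁)
  rw [← hr₁] at m₁
  rw [← hr₂] at m₂ h
  rw [h, M.interaction_eq _ m₁ _ m₂ _ hq₁ _ (M.block₂.tilt_mem _), dotProduct_comm]

lemma weightedKL_half_eq (M : IsTwoBlock f T₁ T₂ ρ₁ ρ₂ 𝒬₁ 𝒬₂ c₁ c₂) {q₁ r₁ : Measure E₁}
    {q₂ r₂ : Measure E₂} (hq₁ : q₁ ∈ 𝒬₁) (hq₂ : q₂ ∈ 𝒬₂) (hr₁ : r₁ ∈ 𝒬₁) (hr₂ : r₂ ∈ 𝒬₂) :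
    weightedKL (1 / 2) (q₁.prod q₂) (r₁.prod r₂) =
      ENNReal.ofReal ((((klDiv q₁ r₁).toReal + (klDiv r₁ q₁).toReal) +
        ((klDiv q₂ r₂).toReal + (klDiv r₂ q₂).toReal)) / 2) := by
  have hhalf : (1 / 2 : ℝ) ∈ Set.Icc (0 : ℝ) 1 := by constructor <;> norm_num
  have i₁ := M.block₁.prob_mem _ hr₁
  have i₂ := M.block₂.prob_mem _ hr₂
  have j₁ := M.block₁.prob_mem _ hq₁
  have j₂ := M.block₂.prob_mem _ hq₂
  have a₁ := M.block₁.klDiv_mem _ hr₁ q₁ j₁ (M.block₁.klDiv_base _ hq₁)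
  have a₂ := M.block₂.klDiv_mem _ hr₂ q₂ j₂ (M.block₂.klDiv_base _ hq₂)
  have b₁ := M.block₁.klDiv_mem _ hq₁ r₁ i₁ (M.block₁.klDiv_base _ hr₁)
  have b₂ := M.block₂.klDiv_mem _ hq₂ r₂ i₂ (M.block₂.klDiv_base _ hr₂)
  rw [weightedKL_prod, ← ENNReal.ofReal_toReal (weightedKL_ne_top (α := 1 / 2) a₁ b₁),
    ← ENNReal.ofReal_toReal (weightedKL_ne_top (α := 1 / 2) a₂ b₂),
    ← ENNReal.ofReal_add ENNReal.toReal_nonneg ENNReal.toReal_nonneg,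
    toReal_weightedKL a₁ b₁ hhalf, toReal_weightedKL a₂ b₂ hhalf]
  congr 1
  ring

/-- One parallel step contracts the symmetrised divergence to the optimum. -/
lemma weightedKL_step_le (M : IsTwoBlock f T₁ T₂ ρ₁ ρ₂ 𝒬₁ 𝒬₂ c₁ c₂) {r₁ q₁ : Measure E₁}
    {r₂ q₂ : Measure E₂} (hr₁ : r₁ = expTilt T₁ ρ₁ (statMean T₂ r₂))
    (hr₂ : r₂ = expTilt T₂ ρ₂ (statMean T₁ r₁)) (hq₁ : q₁ ∈ 𝒬₁) (hq₂ : q₂ ∈ 𝒬₂) :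
    weightedKL (1 / 2) ((expTilt T₁ ρ₁ (statMean T₂ q₂)).prod (expTilt T₂ ρ₂ (statMean T₁ q₁)))
      (r₁.prod r₂) ≤
      gcorr f r₁ r₂ 𝒬₁ 𝒬₂ ^ 2 / 4 * weightedKL (1 / 2) (q₁.prod q₂) (r₁.prod r₂) := by
  have Δ₁ := M.interaction_expTilt_left hr₁ hr₂ hq₂
  have Δ₂ := M.interaction_expTilt_right hr₁ hr₂ hq₁
  have m₁ : r₁ ∈ 𝒬₁ := hr₁ ▸ M.block₁.tilt_mem (statMean T₂ r₂)
  have m₂ : r₂ ∈ 𝒬₂ := hr₂ ▸ M.block₂.tilt_mem (statMean T₁ r₁)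
  have n₁ := M.block₁.tilt_mem (statMean T₂ q₂)
  have n₂ := M.block₂.tilt_mem (statMean T₁ q₁)
  set s₁ := expTilt T₁ ρ₁ (statMean T₂ q₂)
  set s₂ := expTilt T₂ ρ₂ (statMean T₁ q₁)
  have i₁ := M.block₁.prob_mem _ m₁
  have i₂ := M.block₂.prob_mem _ m₂
  have j₁ := M.block₁.prob_mem _ hq₁
  have j₂ := M.block₂.prob_mem _ hq₂
  have l₁ := M.block₁.prob_mem _ n₁
  have l₂ := M.block₂.prob_mem _ n₂
  have fin₁ : ∀ p ∈ 𝒬₁, ∀ q ∈ 𝒬₁, klDiv p q ≠ ∞ := fun p hp q hq =>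
    M.block₁.klDiv_mem _ hq p (M.block₁.prob_mem _ hp) (M.block₁.klDiv_base _ hp)
  have fin₂ : ∀ p ∈ 𝒬₂, ∀ q ∈ 𝒬₂, klDiv p q ≠ ∞ := fun p hp q hq =>
    M.block₂.klDiv_mem _ hq p (M.block₂.prob_mem _ hp) (M.block₂.klDiv_base _ hp)
  have hG : gcorr f r₁ r₂ 𝒬₁ 𝒬₂ ≠ ∞ :=
    ne_top_of_le_ne_top ENNReal.ofReal_ne_top (M.gcorr_le m₁ m₂)
  rw [M.weightedKL_half_eq n₁ n₂ m₁ m₂, M.weightedKL_half_eq hq₁ hq₂ m₁ m₂]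
  have key := toReal_mul_le_of_gcorr hG
    (a := 4 * (((klDiv s₁ r₁).toReal + (klDiv r₁ s₁).toReal) +
      ((klDiv s₂ r₂).toReal + (klDiv r₂ s₂).toReal)))
    (b := ((klDiv q₁ r₁).toReal + (klDiv r₁ q₁).toReal) +
      ((klDiv q₂ r₂).toReal + (klDiv r₂ q₂).toReal)) (by
    intro α hα g hg h1 h2
    have hα' : 1 - α ∈ Set.Icc (0 : ℝ) 1 := ⟨by linarith [hα.2], by linarith [hα.1]⟩
    -- Each updated block is paired with the old other block, once with `α` and once with `1 - α`.
    -- Both bounds have the same left side, the squared symmetrised divergence, as `four_mul_add_le`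
    -- requires.
    have A₁ := interaction_sq_le n₁ hq₂ (fin₁ _ n₁ _ m₁) (fin₁ _ m₁ _ n₁) (fin₂ _ hq₂ _ m₂)
      (fin₂ _ m₂ _ hq₂) hα hg h1
    have A₂ := interaction_sq_le n₁ hq₂ (fin₁ _ n₁ _ m₁) (fin₁ _ m₁ _ n₁) (fin₂ _ hq₂ _ m₂)
      (fin₂ _ m₂ _ hq₂) hα' hg h2
    have B₁ := interaction_sq_le hq₁ n₂ (fin₁ _ hq₁ _ m₁) (fin₁ _ m₁ _ hq₁) (fin₂ _ n₂ _ m₂)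
      (fin₂ _ m₂ _ n₂) hα hg h1
    have B₂ := interaction_sq_le hq₁ n₂ (fin₁ _ hq₁ _ m₁) (fin₁ _ m₁ _ hq₁) (fin₂ _ n₂ _ m₂)
      (fin₂ _ m₂ _ n₂) hα' hg h2
    rw [Δ₁] at A₁ A₂
    rw [Δ₂] at B₁ B₂
    rw [sub_sub_cancel] at A₂ B₂
    have nonneg : ∀ x y : ℝ≥0∞, 0 ≤ α * x.toReal + (1 - α) * y.toReal := fun x y =>
      add_nonneg (mul_nonneg hα.1 ENNReal.toReal_nonneg) (mul_nonneg hα'.1 ENNReal.toReal_nonneg)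
    have nonneg' : ∀ x y : ℝ≥0∞, 0 ≤ (1 - α) * x.toReal + α * y.toReal := fun x y =>
      add_nonneg (mul_nonneg hα'.1 ENNReal.toReal_nonneg) (mul_nonneg hα.1 ENNReal.toReal_nonneg)
    have C₁ := four_mul_add_le (g := g) (nonneg (klDiv s₁ r₁) (klDiv r₁ s₁))
      (nonneg' (klDiv s₁ r₁) (klDiv r₁ s₁)) (nonneg' (klDiv q₂ r₂) (klDiv r₂ q₂))
      (nonneg (klDiv q₂ r₂) (klDiv r₂ q₂))
      (by convert A₁ using 2; ring) (by convert A₂ using 2; ring)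
    have C₂ := four_mul_add_le (g := g) (nonneg' (klDiv s₂ r₂) (klDiv r₂ s₂))
      (nonneg (klDiv s₂ r₂) (klDiv r₂ s₂)) (nonneg (klDiv q₁ r₁) (klDiv r₁ q₁))
      (nonneg' (klDiv q₁ r₁) (klDiv r₁ q₁))
      (by convert B₁ using 1 <;> ring) (by convert B₂ using 1 <;> ring)
    linarith)
  have h4 : gcorr f r₁ r₂ 𝒬₁ 𝒬₂ ^ 2 / 4 =
      ENNReal.ofReal ((gcorr f r₁ r₂ 𝒬₁ 𝒬₂).toReal ^ 2 / 4) := by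
    rw [ENNReal.ofReal_div_of_pos (by norm_num), ENNReal.ofReal_pow ENNReal.toReal_nonneg,
      ENNReal.ofReal_toReal hG]
    norm_num
  rw [h4, ← ENNReal.ofReal_mul (by positivity)]
  exact ENNReal.ofReal_le_ofReal (by linarith)

/-- Existence, uniqueness and global convergence of parallel CAVI for a two-block model. -/
theorem main (M : IsTwoBlock f T₁ T₂ ρ₁ ρ₂ 𝒬₁ 𝒬₂ c₁ c₂) :
    ∃ r₁ ∈ 𝒬₁, ∃ r₂ ∈ 𝒬₂, IsOptimal f r₁ r₂ ∧
      (∀ p₁ p₂, IsOptimal f p₁ p₂ → p₁ = r₁ ∧ p₂ = r₂) ∧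
      gcorr f r₁ r₂ 𝒬₁ 𝒬₂ ≤ ENNReal.ofReal (2 * √(c₁ * c₂)) ∧
      (∀ q₁ q₂, IsParallelCAVI f q₁ q₂ →
        (∀ t, 1 ≤ t → q₁ t ∈ 𝒬₁ ∧ q₂ t ∈ 𝒬₂) ∧
        (∀ t, q₁ t ∈ 𝒬₁ → q₂ t ∈ 𝒬₂ →
          weightedKL (1 / 2) ((q₁ (t + 1)).prod (q₂ (t + 1))) (r₁.prod r₂) ≤
            gcorr f r₁ r₂ 𝒬₁ 𝒬₂ ^ 2 / 4 *
              weightedKL (1 / 2) ((q₁ t).prod (q₂ t)) (r₁.prod r₂)) ∧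
        Tendsto (fun t => weightedKL (1 / 2) ((q₁ t).prod (q₂ t)) (r₁.prod r₂)) atTop (𝓝 0)) := by
  obtain ⟨r₁, r₂, hr₁, hr₂⟩ := M.exists_fixedPoint
  have m₁ : r₁ ∈ 𝒬₁ := hr₁ ▸ M.block₁.tilt_mem (statMean T₂ r₂)
  have m₂ : r₂ ∈ 𝒬₂ := hr₂ ▸ M.block₂.tilt_mem (statMean T₁ r₁)
  obtain ⟨hopt, huniq⟩ := M.isOptimal_of_fixedPoint hr₁ hr₂
  have hG := M.gcorr_le m₁ m₂
  refine ⟨r₁, m₁, r₂, m₂, hopt, huniq, hG, fun q₁ q₂ hq => ?_⟩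
  have hmem : ∀ t, q₁ (t + 1) ∈ 𝒬₁ ∧ q₂ (t + 1) ∈ 𝒬₂ := fun t => by
    rw [M.cavi_eq_left hq, M.cavi_eq_right hq]
    exact ⟨M.block₁.tilt_mem _, M.block₂.tilt_mem _⟩
  have hstep : ∀ t, q₁ t ∈ 𝒬₁ → q₂ t ∈ 𝒬₂ →
      weightedKL (1 / 2) ((q₁ (t + 1)).prod (q₂ (t + 1))) (r₁.prod r₂) ≤
        gcorr f r₁ r₂ 𝒬₁ 𝒬₂ ^ 2 / 4 *
          weightedKL (1 / 2) ((q₁ t).prod (q₂ t)) (r₁.prod r₂) := fun t h₁ h₂ => by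
    rw [M.cavi_eq_left hq, M.cavi_eq_right hq]
    exact M.weightedKL_step_le hr₁ hr₂ h₁ h₂
  refine ⟨fun t ht => ?_, hstep, ?_⟩
  · obtain ⟨s, rfl⟩ := Nat.exists_eq_add_of_le' ht
    exact hmem s
  set θ := gcorr f r₁ r₂ 𝒬₁ 𝒬₂ ^ 2 / 4 with hθ
  set W := fun t => weightedKL (1 / 2) ((q₁ t).prod (q₂ t)) (r₁.prod r₂) with hW
  have hc : 0 ≤ c₁ * c₂ := mul_nonneg M.block₁.nonneg M.block₂.nonneg
  have hθ1 : θ < 1 := by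
    calc θ ≤ ENNReal.ofReal (2 * √(c₁ * c₂)) ^ 2 / 4 := by rw [hθ]; gcongr
      _ = ENNReal.ofReal (c₁ * c₂) := by
        rw [← ENNReal.ofReal_pow (by positivity), mul_pow, Real.sq_sqrt hc,
          ENNReal.ofReal_mul (by norm_num)]
        rw [show ENNReal.ofReal (2 ^ 2) = 4 by norm_num]
        rw [mul_comm, mul_div_assoc, ENNReal.div_self (by norm_num) (by norm_num), mul_one]
      _ < 1 := by
        rw [← ENNReal.ofReal_one]
        exact (ENNReal.ofReal_lt_ofReal_iff one_pos).2 M.mul_lt_one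
  -- The geometric decay starts at `t = 1`: the initial point may lie outside the families, with `W
  -- 0 = ∞`.
  have hW1 : W 1 ≠ ∞ := by
    rw [hW]
    simp only [M.weightedKL_half_eq (hmem 0).1 (hmem 0).2 m₁ m₂]
    exact ENNReal.ofReal_ne_top
  have hle : ∀ t, W (t + 1) ≤ θ ^ t * W 1 := by
    intro t
    induction t with
    | zero => simp
    | succ t ih =>
      calc W (t + 1 + 1) ≤ θ * W (t + 1) := hstep (t + 1) (hmem t).1 (hmem t).2
        _ ≤ θ * (θ ^ t * W 1) := by gcongr
        _ = θ ^ (t + 1) * W 1 := by rw [pow_succ]; ring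
  have hlim : Tendsto (fun t => θ ^ t * W 1) atTop (𝓝 0) := by
    have h := ENNReal.Tendsto.mul_const (b := W 1)
      (ENNReal.tendsto_pow_atTop_nhds_zero_of_lt_one hθ1) (Or.inr hW1)
    rwa [zero_mul] at h
  exact (tendsto_add_atTop_iff_nat 1).1
    (tendsto_of_tendsto_of_tendsto_of_le_of_le tendsto_const_nhds hlim (fun _ => zero_le) hle)

end IsTwoBlock

end MeanField

/-! ### Spectral estimates for the normalised Gram matrix. -/

namespace Probit

variable {n p : ℕ}

lemma dotProduct_gram_mulVec (X : Matrix (Fin n) (Fin p) ℝ) (u v : Fin p → ℝ) :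
    u ⬝ᵥ (Xᵀ * X) *ᵥ v = (X *ᵥ u) ⬝ᵥ (X *ᵥ v) := by
  rw [← Matrix.mulVec_mulVec, Matrix.dotProduct_mulVec, Matrix.vecMul_transpose]

lemma dotProduct_precision_mulVec (X : Matrix (Fin n) (Fin p) ℝ) (κ : ℝ) (u v : Fin p → ℝ) :
    u ⬝ᵥ precision X κ *ᵥ v = (X *ᵥ u) ⬝ᵥ (X *ᵥ v) + κ * (u ⬝ᵥ v) := by
  rw [precision, Matrix.add_mulVec, dotProduct_add, dotProduct_gram_mulVec, Matrix.smul_mulVec,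
    Matrix.one_mulVec, dotProduct_smul, smul_eq_mul]

lemma precision_isHermitian (X : Matrix (Fin n) (Fin p) ℝ) (κ : ℝ) :
    (precision X κ).IsHermitian := by
  unfold precision
  refine Matrix.IsHermitian.add ?_ ?_
  · simpa using Matrix.isHermitian_conjTranspose_mul_self X
  · simp [Matrix.IsHermitian]

lemma precision_posDef (X : Matrix (Fin n) (Fin p) ℝ) {κ : ℝ} (hκ : 0 < κ) :
    (precision X κ).PosDef := by
  refine Matrix.PosDef.of_dotProduct_mulVec_pos (precision_isHermitian X κ) fun u hu => ?_
  rw [star_trivial, dotProduct_precision_mulVec]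
  have h1 := MeanField.dotProduct_self_nonneg' (X *ᵥ u)
  have h2 : 0 < u ⬝ᵥ u := (MeanField.dotProduct_self_nonneg' u).lt_of_ne
    fun h => hu (dotProduct_self_eq_zero.1 h.symm)
  positivity

lemma invSqrt_isHermitian (A : Matrix (Fin p) (Fin p) ℝ) : (invSqrt A).IsHermitian :=
  (IsSelfAdjoint.cfc : IsSelfAdjoint (invSqrt A))

/-- Functional calculus: `t^{-1/2} · t · t^{-1/2} = 1` on a positive spectrum, which is finite, so
continuity is automatic. -/
lemma invSqrt_mul_mul_invSqrt {A : Matrix (Fin p) (Fin p) ℝ} (hA : A.PosDef) :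
    invSqrt A * A * invSqrt A = 1 := by
  have hsa : IsSelfAdjoint A := hA.isHermitian.isSelfAdjoint
  have hpos : ∀ x ∈ spectrum ℝ A, 0 < x := by
    intro x hx
    rw [hA.isHermitian.spectrum_real_eq_range_eigenvalues] at hx
    obtain ⟨i, rfl⟩ := hx
    exact hA.eigenvalues_pos i
  have hc : ∀ f : ℝ → ℝ, ContinuousOn f (spectrum ℝ A) := fun f =>
    (Matrix.finite_real_spectrum (A := A)).continuousOn f
  have hid : cfc (fun t : ℝ => t) A = A := cfc_id' ℝ A
  calc invSqrt A * A * invSqrt A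
      = invSqrt A * cfc (fun t : ℝ => t) A * invSqrt A := by rw [hid]
    _ = cfc (fun t : ℝ => t ^ (-(1 / 2) : ℝ) * t * t ^ (-(1 / 2) : ℝ)) A := by
        unfold invSqrt
        rw [← cfc_mul _ _ A (hc _) (hc _), ← cfc_mul _ _ A (hc _) (hc _)]
    _ = cfc (fun _ : ℝ => (1 : ℝ)) A := by
        refine cfc_congr fun t ht => ?_
        have h0 := hpos t ht
        have h1 : t ^ (-(1 / 2) : ℝ) * t ^ (-(1 / 2) : ℝ) = t⁻¹ := by
          rw [← Real.rpow_add h0, ← Real.rpow_neg_one]; norm_num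
        show t ^ (-(1 / 2) : ℝ) * t * t ^ (-(1 / 2) : ℝ) = 1
        rw [mul_right_comm, h1, inv_mul_cancel₀ h0.ne']
    _ = 1 := cfc_const_one ℝ A

lemma dotProduct_mulVec_le_lambdaMax {A : Matrix (Fin p) (Fin p) ℝ} (hA : A.IsHermitian)
    (v : Fin p → ℝ) : v ⬝ᵥ A *ᵥ v ≤ lambdaMax A * (v ⬝ᵥ v) := by
  have hps : (algebraMap ℝ (Matrix (Fin p) (Fin p) ℝ) (lambdaMax A) - A).PosSemidef := by
    refine Matrix.posSemidef_iff_isHermitian_and_spectrum_nonneg.2 ⟨?_, ?_⟩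
    · refine Matrix.IsHermitian.sub ?_ hA
      rw [Algebra.algebraMap_eq_smul_one]
      simp [Matrix.IsHermitian]
    · rw [← spectrum.singleton_sub_eq]
      rintro _ ⟨a, rfl, b, hb, rfl⟩
      exact sub_nonneg.2 (le_csSup (Matrix.finite_real_spectrum (A := A)).bddAbove hb)
  have h := hps.dotProduct_mulVec_nonneg v
  rw [star_trivial, Matrix.sub_mulVec, dotProduct_sub, Algebra.algebraMap_eq_smul_one,
    Matrix.smul_mulVec, Matrix.one_mulVec, dotProduct_smul, smul_eq_mul] at h
  linarith

lemma lambdaMax_lt {A : Matrix (Fin p) (Fin p) ℝ} {c : ℝ} (hc : 0 < c)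
    (h : ∀ v ≠ 0, v ⬝ᵥ A *ᵥ v < c * (v ⬝ᵥ v)) : lambdaMax A < c := by
  rcases (spectrum ℝ A).eq_empty_or_nonempty with he | hne
  -- For the empty matrix the supremum defaults to `0`; this is where `0 < c` enters.
  · rw [lambdaMax, he, Real.sSup_empty]; exact hc
  have hmem : lambdaMax A ∈ spectrum ℝ A :=
    hne.csSup_mem (Matrix.finite_real_spectrum (A := A))
  rw [← Matrix.spectrum_toLin', ← Module.End.hasEigenvalue_iff_mem_spectrum] at hmem
  obtain ⟨v, hv⟩ := hmem.exists_hasEigenvector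
  have h1 : A *ᵥ v = lambdaMax A • v := by simpa using hv.apply_eq_smul
  have h2 := h v hv.2
  rw [h1, dotProduct_smul, smul_eq_mul] at h2
  exact lt_of_mul_lt_mul_right h2 (MeanField.dotProduct_self_nonneg' v)

/-- The normalised Gram matrix `(X'X + κI)^{-1/2} X'X (X'X + κI)^{-1/2}`. -/
noncomputable def normGram (X : Matrix (Fin n) (Fin p) ℝ) (κ : ℝ) : Matrix (Fin p) (Fin p) ℝ :=
  invSqrt (precision X κ) * (Xᵀ * X) * invSqrt (precision X κ)

lemma dotProduct_normGram_mulVec (X : Matrix (Fin n) (Fin p) ℝ) (κ : ℝ) (v : Fin p → ℝ) :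
    v ⬝ᵥ normGram X κ *ᵥ v = (X *ᵥ (invSqrt (precision X κ) *ᵥ v)) ⬝ᵥ
      (X *ᵥ (invSqrt (precision X κ) *ᵥ v)) := by
  have hS : (invSqrt (precision X κ))ᵀ = invSqrt (precision X κ) := by
    simpa using (invSqrt_isHermitian (precision X κ)).eq
  rw [← dotProduct_gram_mulVec, normGram, mul_assoc, ← Matrix.mulVec_mulVec,
    Matrix.dotProduct_mulVec, ← Matrix.mulVec_transpose, hS, ← Matrix.mulVec_mulVec]

lemma dotProduct_invSqrt_mulVec (X : Matrix (Fin n) (Fin p) ℝ) {κ : ℝ} (hκ : 0 < κ)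
    (v : Fin p → ℝ) : (invSqrt (precision X κ) *ᵥ v) ⬝ᵥ
      precision X κ *ᵥ (invSqrt (precision X κ) *ᵥ v) = v ⬝ᵥ v := by
  have hS : (invSqrt (precision X κ))ᵀ = invSqrt (precision X κ) := by
    simpa using (invSqrt_isHermitian (precision X κ)).eq
  have h1 := invSqrt_mul_mul_invSqrt (precision_posDef X hκ)
  have h2 : invSqrt (precision X κ) *ᵥ v = v ᵥ* invSqrt (precision X κ) := by
    rw [← Matrix.mulVec_transpose, hS]
  nth_rw 1 [h2]
  rw [← Matrix.dotProduct_mulVec, Matrix.mulVec_mulVec, Matrix.mulVec_mulVec, h1,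
    Matrix.one_mulVec]

/-- With `w = (X'X + κI)^{-1/2} v`, the form at `v` is `|Xw|²` while `|v|² = |Xw|² + κ|w|²`, and `w
≠ 0` when `v ≠ 0`. -/
lemma lambdaMax_normGram_lt_one (X : Matrix (Fin n) (Fin p) ℝ) {κ : ℝ} (hκ : 0 < κ) :
    lambdaMax (normGram X κ) < 1 := by
  refine lambdaMax_lt one_pos fun v hv => ?_
  have h1 := dotProduct_invSqrt_mulVec X hκ v
  rw [dotProduct_precision_mulVec] at h1
  rw [dotProduct_normGram_mulVec, one_mul, ← h1]
  have hne : invSqrt (precision X κ) *ᵥ v ≠ 0 := by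
    intro h
    rw [h] at h1
    simp only [Matrix.mulVec_zero, zero_dotProduct, mul_zero, add_zero] at h1
    exact hv (dotProduct_self_eq_zero.1 h1.symm)
  have h2 : 0 < (invSqrt (precision X κ) *ᵥ v) ⬝ᵥ (invSqrt (precision X κ) *ᵥ v) :=
    (MeanField.dotProduct_self_nonneg' _).lt_of_ne
      fun h => hne (dotProduct_self_eq_zero.1 h.symm)
  nlinarith

lemma corrBound_eq (X : Matrix (Fin n) (Fin p) ℝ) (κ : ℝ) :
    corrBound X κ = 2 * √(lambdaMax (normGram X κ)) := rfl

lemma sqrt_lambdaMax_lt_one (X : Matrix (Fin n) (Fin p) ℝ) {κ : ℝ} (hκ : 0 < κ) :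
    √(lambdaMax (normGram X κ)) < 1 := by
  rw [Real.sqrt_lt' one_pos, one_pow]
  exact lambdaMax_normGram_lt_one X hκ

/-- `‖Xu‖² ≤ λ_max ⟨u, (X'X + κI) u⟩`. -/
lemma dotProduct_mulVec_self_le (X : Matrix (Fin n) (Fin p) ℝ) {κ : ℝ} (hκ : 0 < κ)
    (u : Fin p → ℝ) : (X *ᵥ u) ⬝ᵥ (X *ᵥ u) ≤
      √(lambdaMax (normGram X κ)) ^ 2 * (u ⬝ᵥ precision X κ *ᵥ u) := by
  have h1 := invSqrt_mul_mul_invSqrt (precision_posDef X hκ)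
  obtain ⟨v, rfl⟩ : ∃ v, u = invSqrt (precision X κ) *ᵥ v :=
    ⟨(precision X κ * invSqrt (precision X κ)) *ᵥ u, by
      rw [Matrix.mulVec_mulVec, ← mul_assoc, h1, Matrix.one_mulVec]⟩
  have hH : (normGram X κ).IsHermitian := by
    have hS : (invSqrt (precision X κ))ᵀ = invSqrt (precision X κ) := by
      simpa using (invSqrt_isHermitian (precision X κ)).eq
    simp [normGram, Matrix.IsHermitian, Matrix.transpose_mul, hS, mul_assoc]
  have h2 := dotProduct_mulVec_le_lambdaMax hH v
  rw [dotProduct_normGram_mulVec] at h2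
  rw [dotProduct_invSqrt_mulVec X hκ]
  refine h2.trans (mul_le_mul_of_nonneg_right ?_ (MeanField.dotProduct_self_nonneg' v))
  -- `√λ ^ 2` is `max λ 0`, so the sign of `λ` need not be known.
  rcases le_total 0 (lambdaMax (normGram X κ)) with h | h
  · rw [Real.sq_sqrt h]
  · exact h.trans (sq_nonneg _)

end Probit

/-! ### Algebra of tilted measures. -/

namespace MeasureTheory

variable {α β : Type*} [MeasurableSpace α] [MeasurableSpace β]

/-- Tilts are normalised, so additive constants in the exponent are invisible; this is what
completing the square relies on below. -/
lemma tilted_add_const (μ : Measure α) {f : α → ℝ} [NeZero μ]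
    (hf : Integrable (fun x => Real.exp (f x)) μ) (c : ℝ) :
    μ.tilted (fun x => f x + c) = μ.tilted f := by
  have := isProbabilityMeasure_tilted hf
  rw [← tilted_const (μ.tilted f) c, tilted_tilted hf]
  rfl

lemma tilted_smul_measure (μ : Measure α) (f : α → ℝ) {c : ℝ≥0∞} (hc : c ≠ 0) (hc' : c ≠ ∞) :
    (c • μ).tilted f = μ.tilted f := by
  have hr : 0 < c.toReal := ENNReal.toReal_pos hc hc'
  ext s hs
  rw [tilted_apply' _ _ hs, tilted_apply' _ _ hs, Measure.restrict_smul, lintegral_smul_measure,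
    integral_smul_measure, smul_eq_mul, ← lintegral_const_mul' _ _ hc']
  congr with x
  rw [smul_eq_mul, mul_comm c.toReal, ← div_div, ENNReal.ofReal_div_of_pos hr,
    ENNReal.ofReal_toReal hc', ENNReal.mul_div_cancel hc hc']

lemma map_tilted_equiv (μ : Measure α) (e : α ≃ᵐ β) (f : β → ℝ) :
    (μ.tilted (fun x => f (e x))).map e = (μ.map e).tilted f := by
  ext s hs
  rw [e.map_apply, tilted_apply' _ _ (e.measurable hs), tilted_apply' _ _ hs,
    integral_map_equiv, e.restrict_map, lintegral_map_equiv]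

lemma pi_tilted {ι : Type*} [Fintype ι] {μ : ι → Measure α} [∀ i, SigmaFinite (μ i)]
    (f : ι → α → ℝ) :
    Measure.pi (fun i => (μ i).tilted (f i)) =
      (Measure.pi μ).tilted (fun x => ∑ i, f i (x i)) := by
  refine Measure.pi_eq fun s hs => ?_
  rw [tilted_apply_eq_ofReal_integral' _ (MeasurableSet.univ_pi hs)]
  simp_rw [fun i => tilted_apply_eq_ofReal_integral' (μ := μ i) (f i) (hs i)]
  simp_rw [Real.exp_sum, integral_div, Measure.restrict_pi_pi]
  rw [integral_fintype_prod_eq_prod (fun i x => Real.exp (f i x)),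
    integral_fintype_prod_eq_prod (fun i x => Real.exp (f i x)), ← Finset.prod_div_distrib,
    ENNReal.ofReal_prod_of_nonneg]
  intro i _
  exact div_nonneg (integral_nonneg fun x => (Real.exp_pos _).le)
    (integral_nonneg fun x => (Real.exp_pos _).le)

lemma prod_tilted {μ : Measure α} {ν : Measure β} [SFinite μ] [SFinite ν] {f : α → ℝ} {g : β → ℝ}
    (hf : AEMeasurable f μ) (hg : AEMeasurable g ν) :
    (μ.tilted f).prod (ν.tilted g) = (μ.prod ν).tilted (fun u => f u.1 + g u.2) := by
  unfold Measure.tilted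
  rw [prod_withDensity₀ (by fun_prop) (by fun_prop)]
  congr with u
  rw [← ENNReal.ofReal_mul (by positivity), div_mul_div_comm, ← Real.exp_add]
  simp_rw [Real.exp_add]
  rw [integral_prod_mul (fun x => Real.exp (f x)) (fun x => Real.exp (g x))]

end MeasureTheory

/-! ### Consequences of Gaussian tails for exponential tilts. -/

namespace MeanField

section Helper

variable {ι E : Type*} [Fintype ι] [MeasurableSpace E] {T : E → ι → ℝ} {ρ : Measure E}

lemma dotProduct_le_mul_add {ε : ℝ} (hε : 0 < ε) (u w : ι → ℝ) :
    u ⬝ᵥ w ≤ ε * (u ⬝ᵥ u) + (4 * ε)⁻¹ * (w ⬝ᵥ w) := by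
  simp only [dotProduct, Finset.mul_sum, ← Finset.sum_add_distrib]
  refine Finset.sum_le_sum fun i _ => ?_
  have h : ε * (u i * u i) + (4 * ε)⁻¹ * (w i * w i) - u i * w i =
      ε * (u i - (2 * ε)⁻¹ * w i) ^ 2 := by
    field_simp; ring
  have h2 : 0 ≤ ε * (u i - (2 * ε)⁻¹ * w i) ^ 2 := by positivity
  linarith

lemma measurable_dotProduct_const (hT : Measurable T) (w : ι → ℝ) :
    Measurable fun x => T x ⬝ᵥ w :=
  Finset.measurable_sum _ fun i _ => ((measurable_pi_apply i).comp hT).mul_const _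

lemma measurable_dotProduct_self' (hT : Measurable T) : Measurable fun x => T x ⬝ᵥ T x :=
  Finset.measurable_sum _ fun i _ =>
    ((measurable_pi_apply i).comp hT).mul ((measurable_pi_apply i).comp hT)

lemma integrable_exp_dotProduct_of_sq (hT : Measurable T) {ε : ℝ} (hε : 0 < ε)
    (h : Integrable (fun x => Real.exp (ε * (T x ⬝ᵥ T x))) ρ) (w : ι → ℝ) :
    Integrable (fun x => Real.exp (T x ⬝ᵥ w)) ρ := by
  refine (h.mul_const (Real.exp ((4 * ε)⁻¹ * (w ⬝ᵥ w)))).mono'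
    (measurable_dotProduct_const hT w).exp.aestronglyMeasurable ?_
  filter_upwards with x
  rw [Real.norm_eq_abs, Real.abs_exp, ← Real.exp_add]
  exact Real.exp_le_exp.2 (dotProduct_le_mul_add hε _ _)

/-- It suffices that the exponent `t` is integrable under the tilt, which follows from `|t| exp t ≤
exp (2t) + 1`. -/
lemma klDiv_expTilt_ne_top_of_sq [IsProbabilityMeasure ρ] (hT : Measurable T) {ε : ℝ}
    (hε : 0 < ε) (h : Integrable (fun x => Real.exp (ε * (T x ⬝ᵥ T x))) ρ) (w : ι → ℝ) :
    klDiv (expTilt T ρ w) ρ ≠ ∞ := by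
  have hexp := integrable_exp_dotProduct_of_sq hT hε h w
  refine klDiv_tilted_self_ne_top hexp ?_
  rw [integrable_tilted_iff hexp]
  refine ((integrable_exp_dotProduct_of_sq hT hε h ((2 : ℝ) • w)).add (integrable_const 1)).mono'
    ((measurable_dotProduct_const hT w).exp.mul
      (measurable_dotProduct_const hT w)).aestronglyMeasurable ?_
  filter_upwards with x
  simp only [smul_eq_mul, Real.norm_eq_abs, Pi.add_apply, dotProduct_smul]
  set t := T x ⬝ᵥ w
  rw [abs_mul, Real.abs_exp]
  have h2 : Real.exp (2 * t) = Real.exp t * Real.exp t := by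
    rw [← Real.exp_add, two_mul]
  rw [h2]
  have e0 := Real.exp_pos t
  rcases le_total 0 t with ht | ht
  · rw [abs_of_nonneg ht]
    nlinarith [Real.add_one_le_exp t]
  · rw [abs_of_nonpos ht]
    have h3 := Real.add_one_le_exp (-t)
    have h4 : Real.exp t * Real.exp (-t) = 1 := by rw [← Real.exp_add]; simp
    nlinarith

lemma integrable_dotProduct_self_of_sq [IsFiniteMeasure ρ] (hT : Measurable T) {ε : ℝ}
    (hε : 0 < ε) (h : Integrable (fun x => Real.exp (ε * (T x ⬝ᵥ T x))) ρ) {q : Measure E}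
    [IsFiniteMeasure q] (hq : klDiv q ρ ≠ ∞) : Integrable (fun x => T x ⬝ᵥ T x) q := by
  have h1 := integrable_of_klDiv_ne_top hq ((measurable_dotProduct_self' hT).const_mul ε)
    (fun x => mul_nonneg hε.le (dotProduct_self_nonneg' _)) h
  simpa [hε.ne'] using h1.const_mul ε⁻¹

lemma klDiv_right_expTilt_ne_top_of_sq [IsProbabilityMeasure ρ] (hT : Measurable T) {ε : ℝ}
    (hε : 0 < ε) (h : Integrable (fun x => Real.exp (ε * (T x ⬝ᵥ T x))) ρ) {q : Measure E}
    [IsProbabilityMeasure q] (hq : klDiv q ρ ≠ ∞) (w : ι → ℝ) :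
    klDiv q (expTilt T ρ w) ≠ ∞ := by
  refine klDiv_tilted_right_ne_top hq ?_ (integrable_exp_dotProduct_of_sq hT hε h w)
  refine ((integrable_dotProduct_self_of_sq hT hε h hq).add
    (integrable_const (w ⬝ᵥ w))).mono' (measurable_dotProduct_const hT w).aestronglyMeasurable ?_
  filter_upwards with x
  have a := dotProduct_self_nonneg' (T x)
  have b := dotProduct_self_nonneg' w
  rw [Real.norm_eq_abs, Pi.add_apply]
  refine abs_le_of_sq_le_sq ?_ (add_nonneg a b)
  nlinarith [sq_dotProduct_le (T x) w]

end Helper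

end MeanField

/-! ### Gaussian measures as tilts of Lebesgue measure. -/

namespace ProbabilityTheory

section Std

variable {V : Type*} [NormedAddCommGroup V] [InnerProductSpace ℝ V] [FiniteDimensional ℝ V]
  [MeasurableSpace V] [BorelSpace V]

lemma integrable_exp_neg_mul_sq_norm {b : ℝ} (hb : 0 < b) :
    Integrable (fun v : V => Real.exp (-b * ‖v‖ ^ 2)) := by
  have h := (GaussianFourier.integrable_cexp_neg_mul_sq_norm_add (V := V) (b := (b : ℂ))
    (by simpa using hb) 0 0).norm
  refine h.congr (ae_of_all _ fun v => ?_)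
  simp only [Complex.norm_exp, zero_mul, add_zero]
  congr 1
  norm_cast

variable (V) in
-- Both sides have the same characteristic function, by the Gaussian Fourier integral.
lemma stdGaussian_eq_tilted :
    stdGaussian V = (volume : Measure V).tilted (fun x => -(1 / 2) * ‖x‖ ^ 2) := by
  have hint : Integrable (fun x : V => Real.exp (-(1 / 2) * ‖x‖ ^ 2)) :=
    integrable_exp_neg_mul_sq_norm (by norm_num)
  have := isProbabilityMeasure_tilted hint
  refine Measure.ext_of_charFun (funext fun t => ?_)
  have hb : (0 : ℝ) < ((1 / 2 : ℂ)).re := by norm_num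
  have hZ : ((∫ x : V, Real.exp (-(1 / 2) * ‖x‖ ^ 2) : ℝ) : ℂ) =
      (Real.pi / (1 / 2 : ℂ)) ^ (Module.finrank ℝ V / 2 : ℂ) := by
    rw [← GaussianFourier.integral_cexp_neg_mul_sq_norm hb, ← integral_complex_ofReal]
    congr with x
    push_cast
    rfl
  have hZ0 : ((∫ x : V, Real.exp (-(1 / 2) * ‖x‖ ^ 2) : ℝ) : ℂ) ≠ 0 := by
    exact_mod_cast (integral_exp_pos hint).ne'
  have h := GaussianFourier.integral_cexp_neg_mul_sq_norm_add hb Complex.I t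
  rw [charFun_stdGaussian, charFun_apply, integral_tilted]
  have h2 : ∀ x : V, (Real.exp (-(1 / 2) * ‖x‖ ^ 2) / ∫ x : V, Real.exp (-(1 / 2) * ‖x‖ ^ 2)) •
      Complex.exp ((inner ℝ x t : ℝ) * Complex.I) =
      ((∫ x : V, Real.exp (-(1 / 2) * ‖x‖ ^ 2) : ℝ) : ℂ)⁻¹ *
        Complex.exp (-(1 / 2) * ‖x‖ ^ 2 + Complex.I * (inner ℝ t x : ℝ)) := by
    intro x
    rw [Complex.real_smul, Complex.exp_add, real_inner_comm, mul_comm Complex.I]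
    push_cast
    ring
  simp_rw [h2]
  rw [integral_const_mul, h, ← hZ, inv_mul_cancel_left₀ hZ0]
  congr 1
  rw [Complex.I_sq]
  ring

end Std

section Multivariate

variable {p : ℕ}

/-- The Lebesgue density of a nondegenerate multivariate Gaussian measure. -/
lemma multivariateGaussian_inv_eq_tilted {P : Matrix (Fin p) (Fin p) ℝ} (hP : P.PosDef)
    (m : EuclideanSpace ℝ (Fin p)) :
    multivariateGaussian m P⁻¹ = (volume : Measure (EuclideanSpace ℝ (Fin p))).tilted
      (fun β => -(1 / 2) * ((β - m).ofLp ⬝ᵥ P *ᵥ (β - m).ofLp)) := by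
  -- The Gaussian is the image of the standard one under `x ↦ m + Rx` with `R = √(P⁻¹)`. The
  -- identity `RPR = 1` turns the quadratic form into `|x|²`, and the constant Jacobian is lost in
  -- the normalisation.
  open scoped MatrixOrder in
  set R := CFC.sqrt P⁻¹ with hR
  have hRR : R * R = P⁻¹ := by
    open scoped MatrixOrder in
    exact CFC.sqrt_mul_sqrt_self _ hP.inv.posSemidef.nonneg
  have hRT : Rᵀ = R := by
    open scoped MatrixOrder in
    have h : IsSelfAdjoint R := (CFC.sqrt_nonneg P⁻¹).isSelfAdjoint
    simpa [IsSelfAdjoint, Matrix.star_eq_conjTranspose] using h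
  have hPu : IsUnit P.det := (Matrix.isUnit_iff_isUnit_det P).1 hP.isUnit
  have h1 : R * (R * P) = 1 := by rw [← mul_assoc, hRR, Matrix.nonsing_inv_mul _ hPu]
  have h2 : R * P * R = 1 := mul_eq_one_comm.1 h1
  let L : EuclideanSpace ℝ (Fin p) ≃L[ℝ] EuclideanSpace ℝ (Fin p) :=
    ContinuousLinearEquiv.equivOfInverse (Matrix.toEuclideanCLM (𝕜 := ℝ) R)
      (Matrix.toEuclideanCLM (𝕜 := ℝ) (R * P))
      (fun x => by rw [← mul_apply_eq_comp, ← map_mul, h2, map_one]; rfl)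
      (fun x => by rw [← mul_apply_eq_comp, ← map_mul, h1, map_one]; rfl)
  let e : EuclideanSpace ℝ (Fin p) ≃ᵐ EuclideanSpace ℝ (Fin p) :=
    L.toHomeomorph.toMeasurableEquiv.trans (MeasurableEquiv.addLeft m)
  have he : ∀ x, e x = m + Matrix.toEuclideanCLM (𝕜 := ℝ) R x := fun x => rfl
  have hf : (fun x : EuclideanSpace ℝ (Fin p) => -(1 / 2) * ‖x‖ ^ 2) =
      fun x => (fun β : EuclideanSpace ℝ (Fin p) =>
        -(1 / 2) * ((β - m).ofLp ⬝ᵥ P *ᵥ (β - m).ofLp)) (e x) := by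
    funext x
    simp only [he, add_sub_cancel_left, Matrix.ofLp_toEuclideanCLM]
    have h3 : R *ᵥ x.ofLp = x.ofLp ᵥ* R := by rw [← Matrix.mulVec_transpose, hRT]
    nth_rw 1 [h3]
    rw [← Matrix.dotProduct_mulVec, Matrix.mulVec_mulVec, Matrix.mulVec_mulVec, h2,
      Matrix.one_mulVec, EuclideanSpace.real_norm_sq_eq]
    simp [dotProduct, sq]
  have hmap : (volume : Measure (EuclideanSpace ℝ (Fin p))).map e =
      ENNReal.ofReal |(LinearMap.det (L : EuclideanSpace ℝ (Fin p) →ₗ[ℝ]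
        EuclideanSpace ℝ (Fin p)))⁻¹| • volume := by
    have hdet := (LinearEquiv.isUnit_det' L.toLinearEquiv).ne_zero
    have h := Measure.map_linearMap_addHaar_eq_smul_addHaar
      (volume : Measure (EuclideanSpace ℝ (Fin p))) hdet
    have hcomp : (e : EuclideanSpace ℝ (Fin p) → EuclideanSpace ℝ (Fin p)) =
      (fun x => m + x) ∘ (L : EuclideanSpace ℝ (Fin p) →ₗ[ℝ] EuclideanSpace ℝ (Fin p)) := rfl
    have hLm : Measurable (L : EuclideanSpace ℝ (Fin p) →ₗ[ℝ] EuclideanSpace ℝ (Fin p)) :=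
      L.continuous.measurable
    rw [hcomp, ← Measure.map_map (measurable_const_add m) hLm, h, Measure.map_smul,
      map_add_left_eq_self]
  have hdet : LinearMap.det (L : EuclideanSpace ℝ (Fin p) →ₗ[ℝ] EuclideanSpace ℝ (Fin p)) ≠ 0 :=
    (LinearEquiv.isUnit_det' L.toLinearEquiv).ne_zero
  have hstd : multivariateGaussian m P⁻¹ = (stdGaussian (EuclideanSpace ℝ (Fin p))).map e := rfl
  rw [hstd, stdGaussian_eq_tilted, hf,
    map_tilted_equiv _ e (fun β : EuclideanSpace ℝ (Fin p) =>
      -(1 / 2) * ((β - m).ofLp ⬝ᵥ P *ᵥ (β - m).ofLp)), hmap, tilted_smul_measure]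
  · rw [Ne, ENNReal.ofReal_eq_zero, not_le]
    exact abs_pos.2 (inv_ne_zero hdet)
  · exact ENNReal.ofReal_ne_top

variable {S : Matrix (Fin p) (Fin p) ℝ}

lemma map_dotProduct_multivariateGaussian (hS : S.PosSemidef) (m : EuclideanSpace ℝ (Fin p))
    (θ : Fin p → ℝ) :
    (multivariateGaussian m S).map (fun β => β.ofLp ⬝ᵥ θ) =
      gaussianReal (m.ofLp ⬝ᵥ θ) (θ ⬝ᵥ S *ᵥ θ).toNNReal := by
  let L : StrongDual ℝ (EuclideanSpace ℝ (Fin p)) := innerSL ℝ (WithLp.toLp 2 θ)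
  have hL : ∀ β, L β = β.ofLp ⬝ᵥ θ := fun β => by
    simp [L, EuclideanSpace.inner_eq_star_dotProduct]
  have hL' : (fun β : EuclideanSpace ℝ (Fin p) => β.ofLp ⬝ᵥ θ) = L := funext fun β => (hL β).symm
  rw [hL', IsGaussian.map_eq_gaussianReal L]
  congr 1
  · rw [IsGaussian.integral_dual, integral_id_multivariateGaussian, hL]
  · have h := covarianceBilin_self (μ := multivariateGaussian m S) IsGaussian.memLp_two_id
      (WithLp.toLp 2 θ)
    rw [covarianceBilin_multivariateGaussian hS] at h
    rw [h]
    rfl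

lemma integrable_exp_dotProduct_multivariateGaussian (hS : S.PosSemidef)
    (m : EuclideanSpace ℝ (Fin p)) (θ : Fin p → ℝ) :
    Integrable (fun β => Real.exp (β.ofLp ⬝ᵥ θ)) (multivariateGaussian m S) := by
  have h := integrable_exp_mul_gaussianReal (μ := m.ofLp ⬝ᵥ θ) (v := (θ ⬝ᵥ S *ᵥ θ).toNNReal) 1
  have hm : Measurable fun β : EuclideanSpace ℝ (Fin p) => β.ofLp ⬝ᵥ θ :=
    Finset.measurable_sum _ fun i _ => by fun_prop
  rw [← map_dotProduct_multivariateGaussian hS, integrable_map_measure (by fun_prop)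
    hm.aemeasurable] at h
  simpa [Function.comp_def] using h

lemma integral_exp_dotProduct_multivariateGaussian (hS : S.PosSemidef)
    (m : EuclideanSpace ℝ (Fin p)) (θ : Fin p → ℝ) :
    ∫ β, Real.exp (β.ofLp ⬝ᵥ θ) ∂(multivariateGaussian m S) =
      Real.exp (m.ofLp ⬝ᵥ θ + θ ⬝ᵥ S *ᵥ θ / 2) := by
  have h := mgf_gaussianReal (map_dotProduct_multivariateGaussian hS m θ) 1
  have h0 : 0 ≤ θ ⬝ᵥ S *ᵥ θ := by simpa using hS.dotProduct_mulVec_nonneg θ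
  simpa [mgf, Real.coe_toNNReal _ h0] using h

lemma integral_dotProduct_multivariateGaussian (m : EuclideanSpace ℝ (Fin p)) (θ : Fin p → ℝ) :
    ∫ β, β.ofLp ⬝ᵥ θ ∂(multivariateGaussian m S) = m.ofLp ⬝ᵥ θ := by
  let L : StrongDual ℝ (EuclideanSpace ℝ (Fin p)) := innerSL ℝ (WithLp.toLp 2 θ)
  have hL : ∀ β, L β = β.ofLp ⬝ᵥ θ := fun β => by
    simp [L, EuclideanSpace.inner_eq_star_dotProduct]
  simp_rw [← hL]
  rw [IsGaussian.integral_dual, integral_id_multivariateGaussian]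

lemma exists_integrable_exp_sq_multivariateGaussian (m : EuclideanSpace ℝ (Fin p)) :
    ∃ ε > 0, Integrable (fun β => Real.exp (ε * (β.ofLp ⬝ᵥ β.ofLp)))
      (multivariateGaussian m S) := by
  obtain ⟨C, hC, h⟩ := IsGaussian.exists_integrable_exp_sq (multivariateGaussian m S)
  refine ⟨C, hC, h.congr (ae_of_all _ fun β => ?_)⟩
  simp only [EuclideanSpace.real_norm_sq_eq]
  simp only [dotProduct, sq]

end Multivariate

end ProbabilityTheory

/-! ### The Gaussian block. -/

namespace Probit

variable {n p : ℕ}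

lemma integrable_exp_neg_precision (X : Matrix (Fin n) (Fin p) ℝ) {κ : ℝ} (hκ : 0 < κ)
    (m : EuclideanSpace ℝ (Fin p)) :
    Integrable (fun β : EuclideanSpace ℝ (Fin p) =>
      Real.exp (-(1 / 2) * ((β - m).ofLp ⬝ᵥ precision X κ *ᵥ (β - m).ofLp))) := by
  -- A tilt by a non-exponentially-integrable function is the zero measure, which a Gaussian is not.
  by_contra h
  have h1 := multivariateGaussian_inv_eq_tilted (precision_posDef X hκ) m
  rw [tilted_of_not_integrable h] at h1
  exact IsProbabilityMeasure.ne_zero (multivariateGaussian m (precision X κ)⁻¹) h1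

/-- The Gaussian family is the exponential family generated by the centred Gaussian. -/
lemma multivariateGaussian_eq_expTilt (X : Matrix (Fin n) (Fin p) ℝ) {κ : ℝ} (hκ : 0 < κ)
    (m : EuclideanSpace ℝ (Fin p)) :
    multivariateGaussian m (precision X κ)⁻¹ =
      MeanField.expTilt (fun β => β.ofLp) (multivariateGaussian 0 (precision X κ)⁻¹)
        (precision X κ *ᵥ m.ofLp) := by
  have hP := precision_posDef X hκ
  have hT : (precision X κ)ᵀ = precision X κ := by
    simpa using (precision_isHermitian X κ).eq
  rw [MeanField.expTilt, multivariateGaussian_inv_eq_tilted hP,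
    multivariateGaussian_inv_eq_tilted hP, tilted_tilted (integrable_exp_neg_precision X hκ 0),
    ← tilted_add_const _ (integrable_exp_neg_precision X hκ m)
      (1 / 2 * (m.ofLp ⬝ᵥ precision X κ *ᵥ m.ofLp))]
  congr with β
  have h : m.ofLp ⬝ᵥ precision X κ *ᵥ β.ofLp = β.ofLp ⬝ᵥ precision X κ *ᵥ m.ofLp := by
    rw [Matrix.dotProduct_mulVec, ← Matrix.mulVec_transpose, hT, dotProduct_comm]
  simp only [Pi.add_apply, sub_zero, WithLp.ofLp_sub, Matrix.mulVec_sub, dotProduct_sub,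
    sub_dotProduct, h]
  ring

/-- `XP⁻¹X'` obeys the same bound as the normalised Gram matrix. With `a = P⁻¹X'θ` and `Q = ⟨θ, Xa⟩
= ⟨a, Pa⟩`, Cauchy–Schwarz gives `Q² ≤ |θ|² |Xa|² ≤ |θ|² λ Q`. -/
lemma dotProduct_inv_mulVec_le (X : Matrix (Fin n) (Fin p) ℝ) {κ : ℝ} (hκ : 0 < κ)
    (θ : Fin n → ℝ) : (Xᵀ *ᵥ θ) ⬝ᵥ (precision X κ)⁻¹ *ᵥ (Xᵀ *ᵥ θ) ≤
      √(lambdaMax (normGram X κ)) ^ 2 * (θ ⬝ᵥ θ) := by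
  have hP := precision_posDef X hκ
  have hPu : IsUnit (precision X κ).det := (Matrix.isUnit_iff_isUnit_det _).1 hP.isUnit
  set a := (precision X κ)⁻¹ *ᵥ (Xᵀ *ᵥ θ) with ha
  have hPa : precision X κ *ᵥ a = Xᵀ *ᵥ θ := by
    rw [ha, Matrix.mulVec_mulVec, Matrix.mul_nonsing_inv _ hPu, Matrix.one_mulVec]
  have h1 := dotProduct_mulVec_self_le X hκ a
  rw [hPa, dotProduct_comm a] at h1
  have h2 : (Xᵀ *ᵥ θ) ⬝ᵥ a = θ ⬝ᵥ X *ᵥ a := by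
    rw [Matrix.dotProduct_mulVec θ X a, ← Matrix.mulVec_transpose]
  have h3 := MeanField.sq_dotProduct_le θ (X *ᵥ a)
  rw [← h2] at h3
  set Q := (Xᵀ *ᵥ θ) ⬝ᵥ a
  have hθ := MeanField.dotProduct_self_nonneg' θ
  set s := √(lambdaMax (normGram X κ))
  rcases le_or_gt Q 0 with hQ | hQ
  · exact hQ.trans (mul_nonneg (sq_nonneg s) hθ)
  · have h4 : Q * Q ≤ Q * (s ^ 2 * (θ ⬝ᵥ θ)) := by
      have := mul_le_mul_of_nonneg_left h1 hθ
      nlinarith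
    exact le_of_mul_le_mul_left h4 hQ

lemma mulVec_dotProduct_eq (X : Matrix (Fin n) (Fin p) ℝ) (β : Fin p → ℝ) (θ : Fin n → ℝ) :
    (X *ᵥ β) ⬝ᵥ θ = β ⬝ᵥ (Xᵀ *ᵥ θ) := by
  rw [dotProduct_comm, Matrix.dotProduct_mulVec, Matrix.mulVec_transpose, dotProduct_comm]

lemma measurable_ofLp' : Measurable fun β : EuclideanSpace ℝ (Fin p) => β.ofLp := by fun_prop

lemma measurable_mulVec_ofLp (X : Matrix (Fin n) (Fin p) ℝ) :
    Measurable fun β : EuclideanSpace ℝ (Fin p) => X *ᵥ β.ofLp :=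
  measurable_pi_lambda _ fun i => by
    show Measurable fun β : EuclideanSpace ℝ (Fin p) => ∑ j, X i j * β.ofLp j
    fun_prop

lemma exists_mulVec_self_le (X : Matrix (Fin n) (Fin p) ℝ) :
    ∃ K > 0, ∀ u : Fin p → ℝ, (X *ᵥ u) ⬝ᵥ (X *ᵥ u) ≤ K * (u ⬝ᵥ u) := by
  refine ⟨∑ i, (X i ⬝ᵥ X i) + 1, ?_, fun u => ?_⟩
  · have := Finset.sum_nonneg (s := Finset.univ)
      fun i (_ : i ∈ Finset.univ) => MeanField.dotProduct_self_nonneg' (X i)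
    linarith
  · have h0 := MeanField.dotProduct_self_nonneg' u
    rw [add_mul, Finset.sum_mul]
    have : (X *ᵥ u) ⬝ᵥ (X *ᵥ u) ≤ ∑ i, (X i ⬝ᵥ X i) * (u ⬝ᵥ u) :=
      Finset.sum_le_sum fun i _ => by
        rw [← sq]
        exact MeanField.sq_dotProduct_le (X i) u
    linarith

/-- The centred log-moment generating function of `Xβ` is exactly `θ'XP⁻¹X'θ / 2`, whence the
constant `λ`; writing it as `√λ ^ 2` makes it visibly nonnegative. -/
lemma isExpBlock_gaussian (X : Matrix (Fin n) (Fin p) ℝ) {κ : ℝ} (hκ : 0 < κ) :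
    MeanField.IsExpBlock (fun β : EuclideanSpace ℝ (Fin p) => X *ᵥ β.ofLp)
      (multivariateGaussian 0 (precision X κ)⁻¹) (gaussianFamily X κ)
      (√(lambdaMax (normGram X κ)) ^ 2) := by
  have hP := precision_posDef X hκ
  have hPu : IsUnit (precision X κ).det := (Matrix.isUnit_iff_isUnit_det _).1 hP.isUnit
  have hS : ((precision X κ)⁻¹).PosSemidef := hP.inv.posSemidef
  obtain ⟨ε, hε, hsq⟩ := exists_integrable_exp_sq_multivariateGaussian
    (S := (precision X κ)⁻¹) (0 : EuclideanSpace ℝ (Fin p))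
  refine ⟨measurable_mulVec_ofLp X, inferInstance, sq_nonneg _, ?_, ?_, ?_, ?_, ?_, ?_, ?_⟩
  · obtain ⟨K, hK, hle⟩ := exists_mulVec_self_le X
    refine ⟨ε / K, by positivity, hsq.mono' ?_ (ae_of_all _ fun β => ?_)⟩
    · exact ((MeanField.measurable_dotProduct_self' (measurable_mulVec_ofLp X)).const_mul
        _).exp.aestronglyMeasurable
    · rw [Real.norm_eq_abs, Real.abs_exp, Real.exp_le_exp, div_mul_eq_mul_div, div_le_iff₀ hK]
      calc _ ≤ ε * (K * (β.ofLp ⬝ᵥ β.ofLp)) := mul_le_mul_of_nonneg_left (hle _) hε.le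
        _ = _ := by ring
  · rintro _ ⟨m, rfl⟩
    infer_instance
  · rintro _ ⟨m, rfl⟩
    rw [multivariateGaussian_eq_expTilt X hκ]
    exact MeanField.klDiv_expTilt_ne_top_of_sq measurable_ofLp' hε hsq _
  · rintro _ ⟨m, rfl⟩ q _ hq
    rw [multivariateGaussian_eq_expTilt X hκ]
    exact MeanField.klDiv_right_expTilt_ne_top_of_sq measurable_ofLp' hε hsq hq _
  · rintro _ ⟨m, rfl⟩ θ
    simp_rw [mulVec_dotProduct_eq]
    exact integrable_exp_dotProduct_multivariateGaussian hS m _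
  · rintro _ ⟨m, rfl⟩ θ
    simp_rw [mulVec_dotProduct_eq]
    rw [integral_exp_dotProduct_multivariateGaussian hS, Real.log_exp]
    have hmean : MeanField.statMean (fun β : EuclideanSpace ℝ (Fin p) => X *ᵥ β.ofLp)
        (multivariateGaussian m (precision X κ)⁻¹) = X *ᵥ m.ofLp := by
      funext i
      have h := integral_dotProduct_multivariateGaussian (S := (precision X κ)⁻¹) m (X i)
      simp_rw [dotProduct_comm _ (X i)] at h
      exact h
    rw [hmean, mulVec_dotProduct_eq X m.ofLp θ]
    have := dotProduct_inv_mulVec_le X hκ θ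
    linarith
  · intro w
    -- Tilting by `⟨Xβ, w⟩ = ⟨β, X'w⟩` moves the mean to `P⁻¹X'w`.
    refine ⟨WithLp.toLp 2 ((precision X κ)⁻¹ *ᵥ (Xᵀ *ᵥ w)), ?_⟩
    rw [multivariateGaussian_eq_expTilt X hκ
      (WithLp.toLp 2 ((precision X κ)⁻¹ *ᵥ (Xᵀ *ᵥ w))), Matrix.mulVec_mulVec, Matrix.mul_nonsing_inv _ hPu, Matrix.one_mulVec]
    simp only [MeanField.expTilt, mulVec_dotProduct_eq]

end Probit

/-! ### Sub-Gaussianity from tilted variances; Gaussian integrals on a half line. -/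

namespace ProbabilityTheory

section Cgf

variable {Ω : Type*} [MeasurableSpace Ω] {q : Measure Ω} [IsProbabilityMeasure q] {X : Ω → ℝ}

/-- Second-order Taylor expansion of the cumulant generating function of the centred variable; its
second derivative at `u` is the variance under the tilt by `u`. -/
lemma cgf_le_of_variance_tilted_le_one_of_pos (hX : ∀ t, Integrable (fun ω => Real.exp (t * X ω)) q)
    (hV : ∀ u, Var[X; q.tilted (fun ω => u * X ω)] ≤ 1) {t : ℝ} (ht : 0 < t) :
    cgf X q t ≤ t * q[X] + t ^ 2 / 2 := by
  have hset : integrableExpSet X q = Set.univ := Set.eq_univ_of_forall hX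
  have hXi : Integrable X q := integrable_of_mem_interior_integrableExpSet (by simp [hset])
  set Y : Ω → ℝ := fun ω => X ω + -(q[X]) with hYdef
  have hY : ∀ u, (fun ω => u * Y ω) = fun ω => u * X ω + -(u * q[X]) := fun u => by
    funext ω; simp only [hYdef]; ring
  have hYint : ∀ u, Integrable (fun ω => Real.exp (u * Y ω)) q := fun u => by
    have h := (hX u).mul_const (Real.exp (-(u * q[X])))
    simp_rw [← Real.exp_add] at h
    exact h.congr (ae_of_all _ fun ω => congrArg Real.exp (congrFun (hY u) ω).symm)
  have hYset : integrableExpSet Y q = Set.univ := Set.eq_univ_of_forall hYint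
  have hY0 : q[Y] = 0 := by
    rw [hYdef, integral_add hXi (integrable_const _)]
    simp
  obtain ⟨u, -, hu⟩ := exists_cgf_eq_iteratedDeriv_two_cgf_mul ht hY0 (by simp [hYset])
  have hcgf : cgf Y q t = cgf X q t - t * q[X] := by
    rw [cgf, cgf, hYdef, mgf_add_const, Real.log_mul (mgf_pos (hX t)).ne' (Real.exp_pos _).ne',
      Real.log_exp]
    ring
  have hvar : iteratedDeriv 2 (cgf Y q) u ≤ 1 := by
    rw [← variance_tilted_mul (by simp [hYset]), hY u, tilted_add_const q (hX u)]
    have := isProbabilityMeasure_tilted (hX u)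
    rw [hYdef, variance_add_const]
    · exact hV u
    · exact hXi.aestronglyMeasurable.mono_ac (tilted_absolutelyContinuous _ _)
  have h2 : 0 < t ^ 2 := by positivity
  rw [hcgf] at hu
  nlinarith

/-- A random variable all of whose exponential tilts have variance at most one is sub-Gaussian. -/
lemma cgf_le_of_variance_tilted_le_one (hX : ∀ t, Integrable (fun ω => Real.exp (t * X ω)) q)
    (hV : ∀ u, Var[X; q.tilted (fun ω => u * X ω)] ≤ 1) (t : ℝ) :
    cgf X q t ≤ t * q[X] + t ^ 2 / 2 := by
  rcases lt_trichotomy t 0 with ht | rfl | ht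
  · have h := cgf_le_of_variance_tilted_le_one_of_pos (q := q) (X := -X)
      (fun s => by simpa using hX (-s)) (fun u => by simpa [variance_neg] using hV (-u))
      (neg_pos.2 ht)
    rw [cgf_neg, neg_neg] at h
    simpa [integral_neg] using h
  · simp
  · exact cgf_le_of_variance_tilted_le_one_of_pos hX hV ht

end Cgf

/-- Conditioning and tilting are both normalised reweightings, so they commute. -/
lemma cond_tilted {α : Type*} [MeasurableSpace α] {μ : Measure α} {f : α → ℝ} {s : Set α}
    (hf : Integrable (fun x => Real.exp (f x)) μ) (hs : MeasurableSet s) (hμs : μ s ≠ 0) :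
    cond (μ.tilted f) s = (μ.restrict s).tilted f := by
  have hne : μ ≠ 0 := fun h => hμs (by simp [h])
  have : NeZero μ := ⟨hne⟩
  have : NeZero (μ.restrict s) := ⟨by rwa [Ne, Measure.restrict_eq_zero]⟩
  have hZ := integral_exp_pos hf
  have hA : 0 < ∫ x in s, Real.exp (f x) ∂μ := integral_exp_pos hf.restrict
  ext t ht
  rw [cond_apply hs, tilted_apply_eq_ofReal_integral' _ hs,
    tilted_apply_eq_ofReal_integral' _ (hs.inter ht), tilted_apply_eq_ofReal_integral' _ ht,
    integral_div, integral_div, integral_div, Measure.restrict_restrict ht, Set.inter_comm t s,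
    ← ENNReal.ofReal_inv_of_pos (div_pos hA hZ), ← ENNReal.ofReal_mul (by positivity)]
  congr 1
  field_simp

lemma gaussianReal_one_eq_tilted (a : ℝ) :
    gaussianReal a 1 = (volume : Measure ℝ).tilted (fun x => -(1 / 2) * (x - a) ^ 2) := by
  have h1 := integral_gaussianPDFReal_eq_one a (v := 1) one_ne_zero
  have he : ∀ x, gaussianPDFReal a 1 x =
      (√(2 * Real.pi))⁻¹ * Real.exp (-(1 / 2) * (x - a) ^ 2) := fun x => by
    simp only [gaussianPDFReal, NNReal.coe_one, mul_one]
    congr 2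
    ring
  simp_rw [he] at h1
  rw [integral_const_mul] at h1
  rw [gaussianReal_of_var_ne_zero _ one_ne_zero, Measure.tilted]
  congr with x
  rw [gaussianPDF, he, eq_inv_of_mul_eq_one_left h1, mul_comm, ← div_eq_mul_inv]

lemma integrable_exp_neg_half_sq (a : ℝ) :
    Integrable (fun x : ℝ => Real.exp (-(1 / 2) * (x - a) ^ 2)) := by
  by_contra h
  have h1 := gaussianReal_one_eq_tilted a
  rw [tilted_of_not_integrable h] at h1
  exact IsProbabilityMeasure.ne_zero (gaussianReal a 1) h1

lemma integrable_exp_neg_half_sq_mul (a b c d : ℝ) :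
    Integrable (fun x : ℝ => (b * x ^ 2 + c * x + d) * Real.exp (-(1 / 2) * (x - a) ^ 2)) := by
  have h1 : Integrable (fun x : ℝ => x) (gaussianReal a 1) := IsGaussian.integrable_id
  have h2 : Integrable (fun x : ℝ => x ^ 2) (gaussianReal a 1) :=
    (IsGaussian.memLp_two_id (μ := gaussianReal a 1)).integrable_sq
  have h3 : Integrable (fun x : ℝ => b * x ^ 2 + c * x + d) (gaussianReal a 1) :=
    ((h2.const_mul b).add (h1.const_mul c)).add (integrable_const d)
  rw [gaussianReal_one_eq_tilted, integrable_tilted_iff (integrable_exp_neg_half_sq a)] at h3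
  simpa only [smul_eq_mul, mul_comm] using h3

lemma hasDerivAt_exp_neg_half_sq (a x : ℝ) :
    HasDerivAt (fun x : ℝ => Real.exp (-(1 / 2) * (x - a) ^ 2))
      (-(x - a) * Real.exp (-(1 / 2) * (x - a) ^ 2)) x := by
  have h : HasDerivAt (fun x : ℝ => Real.exp (-(1 / 2) * (x - a) ^ 2)) _ x :=
    ((((hasDerivAt_id' x).sub_const a).pow 2).const_mul (-(1 / 2) : ℝ)).exp
  refine h.congr_deriv ?_
  simp only [Pi.pow_apply]
  push_cast
  ring

/-- This and the next integral are Stein identities on the half line: exact derivatives of `φ` and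
`xφ`, where `φ` is the unnormalised Gaussian density. -/
lemma integral_Ioi_sub_mul_exp (a : ℝ) :
    ∫ x in Set.Ioi (0 : ℝ), -(x - a) * Real.exp (-(1 / 2) * (x - a) ^ 2) =
      -Real.exp (-(1 / 2) * a ^ 2) := by
  have hd : ∀ x ∈ Set.Ioi (0 : ℝ), HasDerivAt (fun x : ℝ => Real.exp (-(1 / 2) * (x - a) ^ 2))
      (-(x - a) * Real.exp (-(1 / 2) * (x - a) ^ 2)) x :=
    fun x _ => hasDerivAt_exp_neg_half_sq a x
  have hi : IntegrableOn (fun x : ℝ => -(x - a) * Real.exp (-(1 / 2) * (x - a) ^ 2))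
      (Set.Ioi 0) := by
    refine ((integrable_exp_neg_half_sq_mul a 0 (-1) a).congr (ae_of_all _ fun x => ?_)).integrableOn
    ring_nf
  have h := integral_Ioi_of_hasDerivAt_of_tendsto (by fun_prop) hd hi
    (tendsto_zero_of_hasDerivAt_of_integrableOn_Ioi hd hi
      (integrable_exp_neg_half_sq a).integrableOn)
  rw [h]
  simp

lemma integral_Ioi_mul_sub_mul_exp (a : ℝ) :
    ∫ x in Set.Ioi (0 : ℝ), (1 - x * (x - a)) * Real.exp (-(1 / 2) * (x - a) ^ 2) = 0 := by
  have hd : ∀ x ∈ Set.Ioi (0 : ℝ),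
      HasDerivAt (fun x : ℝ => x * Real.exp (-(1 / 2) * (x - a) ^ 2))
        ((1 - x * (x - a)) * Real.exp (-(1 / 2) * (x - a) ^ 2)) x := fun x _ => by
    have h : HasDerivAt (fun x : ℝ => x * Real.exp (-(1 / 2) * (x - a) ^ 2)) _ x :=
      (hasDerivAt_id' x).mul (hasDerivAt_exp_neg_half_sq a x)
    exact h.congr_deriv (by ring)
  have hi : IntegrableOn (fun x : ℝ => (1 - x * (x - a)) * Real.exp (-(1 / 2) * (x - a) ^ 2))
      (Set.Ioi 0) := by
    refine ((integrable_exp_neg_half_sq_mul a (-1) a 1).congr (ae_of_all _ fun x => ?_)).integrableOn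
    ring_nf
  have hi' : IntegrableOn (fun x : ℝ => x * Real.exp (-(1 / 2) * (x - a) ^ 2)) (Set.Ioi 0) := by
    refine ((integrable_exp_neg_half_sq_mul a 0 1 0).congr (ae_of_all _ fun x => ?_)).integrableOn
    ring_nf
  have h := integral_Ioi_of_hasDerivAt_of_tendsto (by fun_prop) hd hi
    (tendsto_zero_of_hasDerivAt_of_integrableOn_Ioi hd hi hi')
  rw [h]
  simp

end ProbabilityTheory

/-! ### The truncated normal block. -/

namespace Probit

/-- The half line supporting the truncated normal distribution. -/
def halfLine (y : Fin 2) : Set ℝ := if y = 1 then Set.Ioi 0 else Set.Iio 0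

lemma truncNormal_eq_cond (y : Fin 2) (a : ℝ) :
    truncNormal y a = cond (gaussianReal a 1) (halfLine y) := rfl

lemma measurableSet_halfLine (y : Fin 2) : MeasurableSet (halfLine y) := by
  unfold halfLine
  split_ifs
  exacts [measurableSet_Ioi, measurableSet_Iio]

lemma volume_halfLine_ne_zero (y : Fin 2) : volume (halfLine y) ≠ 0 := by
  unfold halfLine
  split_ifs <;> simp

lemma gaussianReal_halfLine_ne_zero (y : Fin 2) (a : ℝ) : gaussianReal a 1 (halfLine y) ≠ 0 :=
  fun h => volume_halfLine_ne_zero y (gaussianReal_absolutelyContinuous' a one_ne_zero h)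

instance isProbabilityMeasure_truncNormal (y : Fin 2) (a : ℝ) :
    IsProbabilityMeasure (truncNormal y a) :=
  cond_isProbabilityMeasure (gaussianReal_halfLine_ne_zero y a)

instance neZero_restrict_halfLine (y : Fin 2) :
    NeZero ((volume : Measure ℝ).restrict (halfLine y)) :=
  ⟨by rw [Ne, Measure.restrict_eq_zero]; exact volume_halfLine_ne_zero y⟩

lemma integrable_truncNormal {y : Fin 2} {a : ℝ} {g : ℝ → ℝ}
    (hg : Integrable g (gaussianReal a 1)) : Integrable g (truncNormal y a) := by
  rw [truncNormal_eq_cond, ProbabilityTheory.cond]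
  exact hg.restrict.smul_measure (ENNReal.inv_ne_top.2 (gaussianReal_halfLine_ne_zero y a))

lemma truncNormal_eq_tilted (y : Fin 2) (a : ℝ) :
    truncNormal y a = ((volume : Measure ℝ).restrict (halfLine y)).tilted
      (fun x => -(1 / 2) * (x - a) ^ 2) := by
  rw [truncNormal_eq_cond, gaussianReal_one_eq_tilted,
    cond_tilted (integrable_exp_neg_half_sq a) (measurableSet_halfLine y)
      (volume_halfLine_ne_zero y)]

/-- Completing the square: a tilt shifts the location and leaves the truncation unchanged, so a
variance bound uniform in `a` covers all tilts. -/
lemma truncNormal_tilted (y : Fin 2) (a u : ℝ) :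
    (truncNormal y a).tilted (fun x => u * x) = truncNormal y (a + u) := by
  rw [truncNormal_eq_tilted, truncNormal_eq_tilted,
    tilted_tilted (integrable_exp_neg_half_sq a).restrict,
    ← tilted_add_const _ (integrable_exp_neg_half_sq (a + u)).restrict (a * u + u ^ 2 / 2)]
  refine congrArg _ (funext fun x => ?_)
  simp only [Pi.add_apply]
  ring

lemma integrable_exp_mul_truncNormal (y : Fin 2) (a t : ℝ) :
    Integrable (fun x => Real.exp (t * x)) (truncNormal y a) :=
  integrable_truncNormal (integrable_exp_mul_gaussianReal t)

lemma memLp_two_truncNormal (y : Fin 2) (a : ℝ) : MemLp (fun x => x) 2 (truncNormal y a) :=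
  (memLp_two_iff_integrable_sq (by fun_prop)).2 (integrable_truncNormal
    (IsGaussian.memLp_two_id (μ := gaussianReal a 1)).integrable_sq)

lemma integrable_id_truncNormal (y : Fin 2) (a : ℝ) :
    Integrable (fun x => x) (truncNormal y a) :=
  (memLp_two_truncNormal y a).integrable (by norm_num)

/-- Let `m` be the mean. The Stein identities give `m ≥ a` and `E x² = 1 + a m`, so the variance is
`1 - m (m - a)`, and `m ≥ 0` on the positive half line. -/
lemma variance_truncNormal_one_le (a : ℝ) : Var[fun x => x; truncNormal 1 a] ≤ 1 := by
  have hq : truncNormal 1 a = ((volume : Measure ℝ).restrict (Set.Ioi 0)).tilted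
      (fun x => -(1 / 2) * (x - a) ^ 2) := by
    rw [truncNormal_eq_tilted]; rfl
  have i1 := integrable_id_truncNormal 1 a
  have i2 : Integrable (fun x => x ^ 2) (truncNormal 1 a) :=
    (memLp_two_truncNormal 1 a).integrable_sq
  have key : ∀ g : ℝ → ℝ, ∫ x, g x ∂(truncNormal 1 a) =
      (∫ x in Set.Ioi (0 : ℝ), Real.exp (-(1 / 2) * (x - a) ^ 2))⁻¹ *
        ∫ x in Set.Ioi (0 : ℝ), g x * Real.exp (-(1 / 2) * (x - a) ^ 2) := fun g => by
    rw [hq, integral_tilted, ← integral_const_mul]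
    congr with x
    rw [smul_eq_mul]
    ring
  have h1 := key (fun x => -(x - a))
  have h2 := key (fun x => 1 - x * (x - a))
  rw [integral_Ioi_sub_mul_exp] at h1
  rw [integral_Ioi_mul_sub_mul_exp, mul_zero] at h2
  have hZ : 0 ≤ (∫ x in Set.Ioi (0 : ℝ), Real.exp (-(1 / 2) * (x - a) ^ 2))⁻¹ :=
    inv_nonneg.2 (integral_nonneg fun x => (Real.exp_pos _).le)
  have hpos : 0 ≤ ∫ x, x ∂(truncNormal 1 a) := by
    rw [key]
    refine mul_nonneg hZ (setIntegral_nonneg measurableSet_Ioi fun x hx => ?_)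
    exact mul_nonneg (le_of_lt hx) (Real.exp_pos _).le
  have e1 : ∫ x, -(x - a) ∂(truncNormal 1 a) = a - ∫ x, x ∂(truncNormal 1 a) := by
    rw [integral_neg, integral_sub i1 (integrable_const a)]
    simp
  have e2 : ∫ x, 1 - x * (x - a) ∂(truncNormal 1 a) =
      1 - ∫ x, x ^ 2 ∂(truncNormal 1 a) + a * ∫ x, x ∂(truncNormal 1 a) := by
    have h : ∀ x : ℝ, 1 - x * (x - a) = 1 - x ^ 2 + a * x := fun x => by ring
    simp_rw [h]
    have i3 : Integrable (fun x : ℝ => 1 - x ^ 2) (truncNormal 1 a) := (integrable_const _).sub i2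
    rw [integral_add i3 (i1.const_mul a), integral_sub (integrable_const _) i2, integral_const_mul]
    simp
  rw [e1] at h1
  rw [e2] at h2
  have h3 : a ≤ ∫ x, x ∂(truncNormal 1 a) := by
    have := mul_nonneg hZ (Real.exp_pos (-(1 / 2) * a ^ 2)).le
    linarith
  rw [variance_eq_sub (memLp_two_truncNormal 1 a)]
  simp only [Pi.pow_apply]
  nlinarith [mul_nonneg hpos (sub_nonneg.2 h3)]

lemma truncNormal_zero_eq_map (a : ℝ) :
    truncNormal 0 a = (truncNormal 1 (-a)).map (fun x => -x) := by
  have hm : Measurable fun x : ℝ => -x := measurable_neg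
  have hpre : (fun x : ℝ => -x) ⁻¹' (halfLine 0) = halfLine 1 := by
    ext x; simp [halfLine]
  have hg : gaussianReal a 1 = (gaussianReal (-a) 1).map (fun x => -x) := by
    rw [gaussianReal_map_neg, neg_neg]
  rw [truncNormal_eq_cond, truncNormal_eq_cond, hg, ProbabilityTheory.cond,
    ProbabilityTheory.cond, Measure.restrict_map hm (measurableSet_halfLine 0),
    Measure.map_apply hm (measurableSet_halfLine 0), hpre, Measure.map_smul]

/-- Truncation to a half line does not increase the variance of a standard normal. -/
lemma variance_truncNormal_le (y : Fin 2) (a : ℝ) : Var[fun x => x; truncNormal y a] ≤ 1 := by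
  fin_cases y
  · show Var[fun x => x; truncNormal 0 a] ≤ 1
    rw [truncNormal_zero_eq_map, variance_map (by fun_prop) (by fun_prop)]
    exact (variance_fun_neg (X := fun x : ℝ => x)).trans_le (variance_truncNormal_one_le (-a))
  · exact variance_truncNormal_one_le a

lemma log_integral_exp_mul_truncNormal_le (y : Fin 2) (a t : ℝ) :
    Real.log (∫ x, Real.exp (t * x) ∂(truncNormal y a)) ≤
      t * ∫ x, x ∂(truncNormal y a) + t ^ 2 / 2 :=
  cgf_le_of_variance_tilted_le_one (X := fun x : ℝ => x) (integrable_exp_mul_truncNormal y a)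
    (fun u => by rw [truncNormal_tilted]; exact variance_truncNormal_le y _) t

variable {n : ℕ}

lemma pi_truncNormal_eq_expTilt (y : Fin n → Fin 2) (a b : Fin n → ℝ) :
    MeanField.expTilt (fun z => z) (Measure.pi fun i => truncNormal (y i) (a i)) b =
      Measure.pi fun i => truncNormal (y i) (a i + b i) := by
  simp_rw [← truncNormal_tilted]
  rw [pi_tilted]
  simp only [MeanField.expTilt, dotProduct, mul_comm]

/-- Coordinates are independent, so their log-moment generating functions add and the
one-dimensional constant `1` persists. -/
lemma isExpBlock_truncNormal (y : Fin n → Fin 2) :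
    MeanField.IsExpBlock (fun z : Fin n → ℝ => z) (Measure.pi fun i => truncNormal (y i) 0)
      (truncNormalFamily y) 1 := by
  have hexp : ∃ ε > 0, Integrable (fun z : Fin n → ℝ => Real.exp (ε * (z ⬝ᵥ z)))
      (Measure.pi fun i => truncNormal (y i) 0) := by
    obtain ⟨ε, hε, h⟩ := IsGaussian.exists_integrable_exp_sq (gaussianReal 0 1)
    refine ⟨ε, hε, ?_⟩
    have h' : ∀ i, Integrable (fun x : ℝ => Real.exp (ε * ‖x‖ ^ 2)) (truncNormal (y i) 0) :=
      fun i => integrable_truncNormal h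
    refine (Integrable.fintype_prod h').congr (ae_of_all _ fun z => ?_)
    simp only [← Real.exp_sum, dotProduct, Finset.mul_sum, Real.norm_eq_abs, sq_abs]
    simp only [sq]
  have hmem : ∀ a : Fin n → ℝ, Measure.pi (fun i => truncNormal (y i) (a i)) =
      MeanField.expTilt (fun z => z) (Measure.pi fun i => truncNormal (y i) 0) a := fun a => by
    have h := pi_truncNormal_eq_expTilt y 0 a
    simpa using h.symm
  obtain ⟨ε, hε, hsq⟩ := hexp
  refine ⟨measurable_id, inferInstance, zero_le_one, ⟨ε, hε, hsq⟩, ?_, ?_, ?_, ?_, ?_, ?_⟩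
  · rintro _ ⟨a, rfl⟩
    infer_instance
  · rintro _ ⟨a, rfl⟩
    rw [hmem]
    exact MeanField.klDiv_expTilt_ne_top_of_sq measurable_id hε hsq _
  · rintro _ ⟨a, rfl⟩ q _ hq
    rw [hmem]
    exact MeanField.klDiv_right_expTilt_ne_top_of_sq measurable_id hε hsq hq _
  · rintro _ ⟨a, rfl⟩ θ
    have h := Integrable.fintype_prod (f := fun i x => Real.exp (θ i * x))
      (fun i => integrable_exp_mul_truncNormal (y i) (a i) (θ i))
    simpa only [← Real.exp_sum, dotProduct, mul_comm] using h
  · rintro _ ⟨a, rfl⟩ θ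
    have hmean : MeanField.statMean (fun z : Fin n → ℝ => z)
        (Measure.pi fun i => truncNormal (y i) (a i)) = fun i => ∫ x, x ∂(truncNormal (y i) (a i)) :=
      funext fun i => integral_comp_eval (μ := fun i => truncNormal (y i) (a i))
        (f := fun x : ℝ => x) (by fun_prop)
    have hint : ∫ z, Real.exp (z ⬝ᵥ θ) ∂(Measure.pi fun i => truncNormal (y i) (a i)) =
        ∏ i, ∫ x, Real.exp (θ i * x) ∂(truncNormal (y i) (a i)) := by
      rw [← integral_fintype_prod_eq_prod (fun i x => Real.exp (θ i * x))]
      simp only [← Real.exp_sum, dotProduct, mul_comm]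
    rw [hmean, hint, Real.log_prod fun i _ =>
      (integral_exp_pos (integrable_exp_mul_truncNormal (y i) (a i) (θ i))).ne']
    simp only [dotProduct, Finset.mul_sum, ← Finset.sum_add_distrib]
    refine Finset.sum_le_sum fun i _ => ?_
    have := log_integral_exp_mul_truncNormal_le (y i) (a i) (θ i)
    linarith
  · intro w
    exact ⟨w, (hmem w).symm⟩

end Probit

/-! ### The probit posterior as a two-block model. -/

namespace Probit

variable {n p : ℕ}

/-- The logarithm of the joint density on the support of the likelihood. -/
noncomputable def logKernel (X : Matrix (Fin n) (Fin p) ℝ) (κ : ℝ)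
    (u : EuclideanSpace ℝ (Fin p) × (Fin n → ℝ)) : ℝ :=
  -(1 / 2) * ∑ i, (u.2 i - (X *ᵥ u.1.ofLp) i) ^ 2 - κ / 2 * (u.1.ofLp ⬝ᵥ u.1.ofLp)

/-- The open orthant of latent variables compatible with the labels. -/
def orthant (y : Fin n → Fin 2) : Set (Fin n → ℝ) := Set.univ.pi fun i => halfLine (y i)

/-- Lebesgue measure restricted to the latent variables compatible with the labels. -/
noncomputable def orthantMeasure (p : ℕ) (y : Fin n → Fin 2) :
    Measure (EuclideanSpace ℝ (Fin p) × (Fin n → ℝ)) :=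
  (volume : Measure (EuclideanSpace ℝ (Fin p))).prod (volume.restrict (orthant y))

lemma measurableSet_orthant (y : Fin n → Fin 2) : MeasurableSet (orthant y) :=
  MeasurableSet.univ_pi fun i => measurableSet_halfLine (y i)

lemma orthantMeasure_eq_restrict (y : Fin n → Fin 2) :
    orthantMeasure p y = volume.restrict (Prod.snd ⁻¹' orthant y) := by
  rw [orthantMeasure, ← Set.univ_prod, Measure.volume_eq_prod, ← Measure.prod_restrict,
    Measure.restrict_univ]

/-- Expanding the square collects `X'X` into the precision matrix and leaves a bilinear coupling of
the blocks. -/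
lemma logKernel_eq (X : Matrix (Fin n) (Fin p) ℝ) (κ : ℝ)
    (u : EuclideanSpace ℝ (Fin p) × (Fin n → ℝ)) :
    logKernel X κ u = -(1 / 2) * (u.1.ofLp ⬝ᵥ precision X κ *ᵥ u.1.ofLp) +
      -(1 / 2) * (u.2 ⬝ᵥ u.2) + (X *ᵥ u.1.ofLp) ⬝ᵥ u.2 := by
  rw [dotProduct_precision_mulVec, logKernel]
  have h : ∑ i, (u.2 i - (X *ᵥ u.1.ofLp) i) ^ 2 = u.2 ⬝ᵥ u.2 - 2 * ((X *ᵥ u.1.ofLp) ⬝ᵥ u.2) +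
      (X *ᵥ u.1.ofLp) ⬝ᵥ (X *ᵥ u.1.ofLp) := by
    simp only [dotProduct, Finset.mul_sum, ← Finset.sum_sub_distrib, ← Finset.sum_add_distrib]
    exact Finset.sum_congr rfl fun i _ => by ring
  rw [h]
  ring

lemma measurable_logKernel (X : Matrix (Fin n) (Fin p) ℝ) (κ : ℝ) :
    Measurable (logKernel X κ) := by
  have h : ∀ i, Measurable fun u : EuclideanSpace ℝ (Fin p) × (Fin n → ℝ) =>
      (X *ᵥ u.1.ofLp) i := fun i =>
    (measurable_pi_apply i).comp ((measurable_mulVec_ofLp X).comp measurable_fst)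
  unfold logKernel dotProduct
  fun_prop

/-- The point `0` is excluded because for label `0` the likelihood uses the closed half line and the
truncation the open one. -/
lemma labelFactor_eq {y : Fin 2} {x : ℝ} (hx : x ≠ 0) :
    ((y : ℕ) : ℝ) * (Set.Ioi (0 : ℝ)).indicator 1 x +
      (1 - ((y : ℕ) : ℝ)) * (Set.Iic (0 : ℝ)).indicator 1 x = (halfLine y).indicator 1 x := by
  fin_cases y
  · rcases hx.lt_or_gt with h | h
    · simp [halfLine, h, h.le]
    · simp [halfLine, h, h.le]
  · simp [halfLine]

lemma joint_eq_indicator (X : Matrix (Fin n) (Fin p) ℝ) (y : Fin n → Fin 2) (κ : ℝ)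
    {u : EuclideanSpace ℝ (Fin p) × (Fin n → ℝ)} (hu : ∀ i, u.2 i ≠ 0) :
    joint X y κ u = (Prod.snd ⁻¹' orthant y).indicator (fun u => Real.exp (logKernel X κ u)) u := by
  have h1 : ∏ i, (((y i : ℕ) : ℝ) * (Set.Ioi (0 : ℝ)).indicator 1 (u.2 i) +
      (1 - ((y i : ℕ) : ℝ)) * (Set.Iic (0 : ℝ)).indicator 1 (u.2 i)) =
      (orthant y).indicator 1 u.2 := by
    simp_rw [fun i => labelFactor_eq (y := y i) (hu i)]
    by_cases h : u.2 ∈ orthant y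
    · rw [Set.indicator_of_mem h]
      exact Finset.prod_eq_one fun i _ => Set.indicator_of_mem (h i (Set.mem_univ i)) _
    · rw [Set.indicator_of_notMem h]
      obtain ⟨i, hi⟩ : ∃ i, u.2 i ∉ halfLine (y i) := by
        by_contra! hcon
        exact h fun i _ => hcon i
      exact Finset.prod_eq_zero (Finset.mem_univ i) (Set.indicator_of_notMem hi _)
  have h2 : (∏ i, Real.exp (-(u.2 i - (X *ᵥ u.1.ofLp) i) ^ 2 / 2)) *
      Real.exp (-κ * ‖u.1‖ ^ 2 / 2) = Real.exp (logKernel X κ u) := by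
    rw [← Real.exp_sum, ← Real.exp_add, logKernel, EuclideanSpace.real_norm_sq_eq]
    congr 1
    simp only [dotProduct, ← sq]
    rw [sub_eq_add_neg]
    congr 1
    · rw [Finset.mul_sum]
      exact Finset.sum_congr rfl fun i _ => by ring
    · ring
  rw [joint, likelihood, h1, mul_assoc, h2]
  by_cases h : u.2 ∈ orthant y
  · rw [Set.indicator_of_mem h, Set.indicator_of_mem (show u ∈ Prod.snd ⁻¹' orthant y from h)]
    simp
  · rw [Set.indicator_of_notMem h, Set.indicator_of_notMem (show u ∉ Prod.snd ⁻¹' orthant y from h)]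
    simp

lemma ae_snd_ne_zero : ∀ᵐ u : EuclideanSpace ℝ (Fin p) × (Fin n → ℝ), ∀ i, u.2 i ≠ 0 := by
  have h : ∀ᵐ z : Fin n → ℝ, ∀ i, z i ≠ 0 := by
    rw [ae_all_iff]
    intro i
    exact Measure.ae_eval_ne (μ := fun _ => volume) i 0
  rw [Measure.volume_eq_prod]
  exact Measure.quasiMeasurePreserving_snd.ae h

lemma joint_ae_eq (X : Matrix (Fin n) (Fin p) ℝ) (y : Fin n → Fin 2) (κ : ℝ) :
    joint X y κ =ᵐ[volume]
      (Prod.snd ⁻¹' orthant y).indicator (fun u => Real.exp (logKernel X κ u)) :=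
  ae_snd_ne_zero.mono fun _ hu => joint_eq_indicator X y κ hu

lemma integral_joint_eq (X : Matrix (Fin n) (Fin p) ℝ) (y : Fin n → Fin 2) (κ : ℝ) :
    ∫ v, joint X y κ v = ∫ v, Real.exp (logKernel X κ v) ∂(orthantMeasure p y) := by
  rw [integral_congr_ae (joint_ae_eq X y κ), orthantMeasure_eq_restrict,
    integral_indicator (measurable_snd (measurableSet_orthant y))]

/-- The posterior is Lebesgue measure on the compatible orthant tilted by the log kernel. -/
lemma target_posterior_eq_tilted (X : Matrix (Fin n) (Fin p) ℝ) (y : Fin n → Fin 2) (κ : ℝ) :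
    MeanField.target (posterior X y κ) = (orthantMeasure p y).tilted (logKernel X κ) := by
  rw [MeanField.target, Measure.tilted, orthantMeasure_eq_restrict,
    ← withDensity_indicator (measurable_snd (measurableSet_orthant y))]
  refine withDensity_congr_ae ?_
  filter_upwards [joint_ae_eq X y κ] with u hu
  rw [posterior, hu, integral_joint_eq, orthantMeasure_eq_restrict]
  by_cases h : u ∈ Prod.snd ⁻¹' orthant y
  · rw [Set.indicator_of_mem h, Set.indicator_of_mem h]
  · rw [Set.indicator_of_notMem h, Set.indicator_of_notMem h]
    simp

lemma pi_truncNormal_zero_eq_tilted (y : Fin n → Fin 2) :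
    Measure.pi (fun i => truncNormal (y i) 0) =
      ((volume : Measure (Fin n → ℝ)).restrict (orthant y)).tilted
        (fun z => -(1 / 2) * (z ⬝ᵥ z)) := by
  simp_rw [truncNormal_eq_tilted]
  rw [pi_tilted, orthant, volume_pi, Measure.restrict_pi_pi]
  congr with z
  simp only [dotProduct, Finset.mul_sum, sub_zero, sq]

lemma prod_base_eq_tilted (X : Matrix (Fin n) (Fin p) ℝ) {κ : ℝ} (hκ : 0 < κ)
    (y : Fin n → Fin 2) :
    (multivariateGaussian 0 (precision X κ)⁻¹).prod (Measure.pi fun i => truncNormal (y i) 0) =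
      (orthantMeasure p y).tilted (fun u => -(1 / 2) * (u.1.ofLp ⬝ᵥ precision X κ *ᵥ u.1.ofLp) +
        -(1 / 2) * (u.2 ⬝ᵥ u.2)) := by
  rw [pi_truncNormal_zero_eq_tilted, multivariateGaussian_inv_eq_tilted (precision_posDef X hκ),
    prod_tilted, orthantMeasure]
  · simp only [sub_zero]
  · simp_rw [dotProduct_precision_mulVec]
    have h1 := MeanField.measurable_dotProduct_self' (measurable_ofLp' (p := p))
    have h2 := MeanField.measurable_dotProduct_self' (measurable_mulVec_ofLp X)
    simp only [sub_zero]
    fun_prop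
  · exact ((MeanField.measurable_dotProduct_self' measurable_id).const_mul _).aemeasurable

lemma integrable_exp_neg_mul_add (y : Fin n → Fin 2) {δ : ℝ} (hδ : 0 < δ) :
    Integrable (fun u => Real.exp (-δ * (u.1.ofLp ⬝ᵥ u.1.ofLp) + -δ * (u.2 ⬝ᵥ u.2)))
      (orthantMeasure p y) := by
  have h1 : Integrable fun β : EuclideanSpace ℝ (Fin p) => Real.exp (-δ * (β.ofLp ⬝ᵥ β.ofLp)) := by
    refine (integrable_exp_neg_mul_sq_norm hδ).congr (ae_of_all _ fun β => ?_)
    simp only [EuclideanSpace.real_norm_sq_eq]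
    simp only [dotProduct, sq]
  have h2 : Integrable fun z : Fin n → ℝ => Real.exp (-δ * (z ⬝ᵥ z)) := by
    refine (Integrable.fintype_prod (μ := fun _ : Fin n => (volume : Measure ℝ))
      (f := fun _ x => Real.exp (-δ * x ^ 2)) fun _ => integrable_exp_neg_mul_sq hδ).congr
      (ae_of_all _ fun z => ?_)
    simp only [← Real.exp_sum, dotProduct, Finset.mul_sum, sq]
  simp_rw [Real.exp_add]
  exact h1.mul_prod h2.restrict

lemma exists_logKernel_add_le (X : Matrix (Fin n) (Fin p) ℝ) {κ : ℝ} (hκ : 0 < κ) :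
    ∃ ε > 0, ∃ δ > 0, ∀ u : EuclideanSpace ℝ (Fin p) × (Fin n → ℝ), logKernel X κ u +
      ε * ((X *ᵥ u.1.ofLp) ⬝ᵥ (X *ᵥ u.1.ofLp) + u.2 ⬝ᵥ u.2) ≤
      -δ * (u.1.ofLp ⬝ᵥ u.1.ofLp) + -δ * (u.2 ⬝ᵥ u.2) := by
  obtain ⟨K, hK, hle⟩ := exists_mulVec_self_le X
  -- Write `R = |z - Xβ|²`. Since `|z|² ≤ 2R + 2|Xβ|²`, the total cost is at most `4εR + 5ε|Xβ|² +
  -- (κ/4)|β|²`. The choice of `ε` keeps `4ε ≤ 1/2` and `5εK ≤ κ/4`, within the available `R/2 +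
  -- (κ/2)|β|²`.
  set ε := min (1 / 8) (κ / (20 * K)) with hε
  have hε0 : 0 < ε := by positivity
  have hε1 : ε ≤ 1 / 8 := min_le_left _ _
  have hε2 : ε * K ≤ κ / 20 := by
    calc ε * K ≤ κ / (20 * K) * K := by gcongr; exact min_le_right _ _
      _ = κ / 20 := by field_simp
  refine ⟨ε, hε0, min ε (κ / 4), by positivity, fun u => ?_⟩
  have hb := hle u.1.ofLp
  have h0 := MeanField.dotProduct_self_nonneg' u.1.ofLp
  have hz := MeanField.dotProduct_self_nonneg' u.2
  have hx := MeanField.dotProduct_self_nonneg' (X *ᵥ u.1.ofLp)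
  have h2 : u.2 ⬝ᵥ u.2 ≤ 2 * ∑ i, (u.2 i - (X *ᵥ u.1.ofLp) i) ^ 2 +
      2 * ((X *ᵥ u.1.ofLp) ⬝ᵥ (X *ᵥ u.1.ofLp)) := by
    simp only [dotProduct, Finset.mul_sum, ← Finset.sum_add_distrib]
    refine Finset.sum_le_sum fun i _ => ?_
    nlinarith [sq_nonneg (u.2 i - 2 * (X *ᵥ u.1.ofLp) i)]
  have hr : 0 ≤ ∑ i, (u.2 i - (X *ᵥ u.1.ofLp) i) ^ 2 := Finset.sum_nonneg fun i _ => sq_nonneg _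
  unfold logKernel
  set R := ∑ i, (u.2 i - (X *ᵥ u.1.ofLp) i) ^ 2
  set a := (X *ᵥ u.1.ofLp) ⬝ᵥ (X *ᵥ u.1.ofLp)
  set b := u.1.ofLp ⬝ᵥ u.1.ofLp
  set z := u.2 ⬝ᵥ u.2
  have e1 : min ε (κ / 4) * z ≤ ε * z := by gcongr; exact min_le_left _ _
  have e2 : min ε (κ / 4) * b ≤ κ / 4 * b := by gcongr; exact min_le_right _ _
  have e3 : ε * a ≤ κ / 20 * b := by
    calc ε * a ≤ ε * (K * b) := by gcongr
      _ = ε * K * b := by ring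
      _ ≤ κ / 20 * b := by gcongr
  have e4 : ε * z ≤ ε * (2 * R + 2 * a) := by gcongr
  have e5 : ε * R ≤ 1 / 8 * R := by gcongr
  nlinarith

lemma integrable_exp_logKernel_add (X : Matrix (Fin n) (Fin p) ℝ) {κ : ℝ} (hκ : 0 < κ)
    (y : Fin n → Fin 2) : ∃ ε > 0, Integrable (fun u => Real.exp (logKernel X κ u +
      ε * ((X *ᵥ u.1.ofLp) ⬝ᵥ (X *ᵥ u.1.ofLp) + u.2 ⬝ᵥ u.2))) (orthantMeasure p y) := by
  obtain ⟨ε, hε, δ, hδ, hle⟩ := exists_logKernel_add_le (n := n) X hκ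
  refine ⟨ε, hε, (integrable_exp_neg_mul_add y hδ).mono' ?_ (ae_of_all _ fun u => ?_)⟩
  · have h1 : Measurable fun u : EuclideanSpace ℝ (Fin p) × (Fin n → ℝ) =>
        (X *ᵥ u.1.ofLp) ⬝ᵥ (X *ᵥ u.1.ofLp) :=
      (MeanField.measurable_dotProduct_self' (measurable_mulVec_ofLp X)).comp measurable_fst
    have h2 : Measurable fun u : EuclideanSpace ℝ (Fin p) × (Fin n → ℝ) => u.2 ⬝ᵥ u.2 :=
      (MeanField.measurable_dotProduct_self' (T := fun z : Fin n → ℝ => z)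
        measurable_id).comp measurable_snd
    exact ((measurable_logKernel X κ).add
      ((h1.add h2).const_mul ε)).exp.aestronglyMeasurable
  · rw [Real.norm_eq_abs, Real.abs_exp]
    exact Real.exp_le_exp.2 (hle u)

lemma integrable_exp_logKernel (X : Matrix (Fin n) (Fin p) ℝ) {κ : ℝ} (hκ : 0 < κ)
    (y : Fin n → Fin 2) :
    Integrable (fun u => Real.exp (logKernel X κ u)) (orthantMeasure p y) := by
  obtain ⟨ε, hε, h⟩ := integrable_exp_logKernel_add X hκ y
  refine h.mono' (measurable_logKernel X κ).exp.aestronglyMeasurable (ae_of_all _ fun u => ?_)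
  rw [Real.norm_eq_abs, Real.abs_exp, Real.exp_le_exp, le_add_iff_nonneg_right]
  exact mul_nonneg hε.le (add_nonneg (MeanField.dotProduct_self_nonneg' _)
    (MeanField.dotProduct_self_nonneg' _))

lemma integral_joint_pos (X : Matrix (Fin n) (Fin p) ℝ) {κ : ℝ} (hκ : 0 < κ)
    (y : Fin n → Fin 2) : 0 < ∫ v, joint X y κ v := by
  have hne : orthantMeasure p y ≠ 0 := fun h => by
    have h1 := prod_base_eq_tilted X hκ y
    rw [h, tilted_zero_measure] at h1
    exact IsProbabilityMeasure.ne_zero ((multivariateGaussian 0 (precision X κ)⁻¹).prod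
      (Measure.pi fun i => truncNormal (y i) 0)) h1
  have : NeZero (orthantMeasure p y) := ⟨hne⟩
  rw [integral_joint_eq]
  exact integral_exp_pos (integrable_exp_logKernel X hκ y)

lemma integrable_exp_base (X : Matrix (Fin n) (Fin p) ℝ) {κ : ℝ} (hκ : 0 < κ)
    (y : Fin n → Fin 2) : Integrable (fun u : EuclideanSpace ℝ (Fin p) × (Fin n → ℝ) =>
      Real.exp (-(1 / 2) * (u.1.ofLp ⬝ᵥ precision X κ *ᵥ u.1.ofLp) + -(1 / 2) * (u.2 ⬝ᵥ u.2)))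
      (orthantMeasure p y) := by
  by_contra h
  have h1 := prod_base_eq_tilted X hκ y
  rw [tilted_of_not_integrable h] at h1
  exact IsProbabilityMeasure.ne_zero ((multivariateGaussian 0 (precision X κ)⁻¹).prod
    (Measure.pi fun i => truncNormal (y i) 0)) h1

lemma integrable_prod_base_iff (X : Matrix (Fin n) (Fin p) ℝ) {κ : ℝ} (hκ : 0 < κ)
    (y : Fin n → Fin 2) (g : EuclideanSpace ℝ (Fin p) × (Fin n → ℝ) → ℝ) :
    Integrable (fun u => Real.exp ((X *ᵥ u.1.ofLp) ⬝ᵥ u.2 + g u))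
      ((multivariateGaussian 0 (precision X κ)⁻¹).prod (Measure.pi fun i => truncNormal (y i) 0)) ↔
      Integrable (fun u => Real.exp (logKernel X κ u + g u)) (orthantMeasure p y) := by
  rw [prod_base_eq_tilted X hκ, integrable_tilted_iff (integrable_exp_base X hκ y)]
  simp_rw [smul_eq_mul, ← Real.exp_add, logKernel_eq, add_assoc]

lemma target_posterior_eq (X : Matrix (Fin n) (Fin p) ℝ) {κ : ℝ} (hκ : 0 < κ)
    (y : Fin n → Fin 2) : MeanField.target (posterior X y κ) =
      ((multivariateGaussian 0 (precision X κ)⁻¹).prod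
        (Measure.pi fun i => truncNormal (y i) 0)).tilted
          (fun u => (X *ᵥ u.1.ofLp) ⬝ᵥ u.2) := by
  rw [target_posterior_eq_tilted, prod_base_eq_tilted X hκ,
    tilted_tilted (integrable_exp_base X hκ y)]
  exact congrArg _ (funext fun u => logKernel_eq X κ u)

/-- The truncated normals charge only the compatible orthant, so the value `Real.log 0 = 0` off the
support plays no role. -/
lemma ae_log_posterior_eq (X : Matrix (Fin n) (Fin p) ℝ) {κ : ℝ} (hκ : 0 < κ)
    (y : Fin n → Fin 2) (q₁ : Measure (EuclideanSpace ℝ (Fin p))) [SFinite q₁]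
    (a : Fin n → ℝ) :
    ∀ᵐ u ∂(q₁.prod (Measure.pi fun i => truncNormal (y i) (a i))),
      Real.log (posterior X y κ u) = logKernel X κ u - Real.log (∫ v, joint X y κ v) := by
  have h : ∀ᵐ z ∂(Measure.pi fun i => truncNormal (y i) (a i)), ∀ i, z i ∈ halfLine (y i) := by
    rw [ae_all_iff]
    intro i
    have h1 : ∀ᵐ x ∂(truncNormal (y i) (a i)), x ∈ halfLine (y i) :=
      ae_cond_mem (measurableSet_halfLine (y i))
    exact (Measure.quasiMeasurePreserving_eval (fun i => truncNormal (y i) (a i)) i).ae h1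
  have h2 : ∀ᵐ u ∂(q₁.prod (Measure.pi fun i => truncNormal (y i) (a i))),
      ∀ i, u.2 i ∈ halfLine (y i) := Measure.quasiMeasurePreserving_snd.ae h
  filter_upwards [h2] with u hu
  have hne : ∀ i, u.2 i ≠ 0 := fun i h0 => by
    have := hu i
    rw [h0] at this
    unfold halfLine at this
    split_ifs at this <;> simp at this
  rw [posterior, joint_eq_indicator X y κ hne,
    Set.indicator_of_mem (show u ∈ Prod.snd ⁻¹' orthant y from fun i _ => hu i),
    Real.log_div (Real.exp_pos _).ne' (integral_joint_pos X hκ y).ne', Real.log_exp]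

/-- Expected log-posterior over the product of the two families. -/
lemma integral_log_posterior (X : Matrix (Fin n) (Fin p) ℝ) {κ : ℝ} (hκ : 0 < κ)
    (y : Fin n → Fin 2) {q₁ : Measure (EuclideanSpace ℝ (Fin p))} {q₂ : Measure (Fin n → ℝ)}
    (hq₁ : q₁ ∈ gaussianFamily X κ) (hq₂ : q₂ ∈ truncNormalFamily y) :
    Integrable (fun u => Real.log (posterior X y κ u)) (q₁.prod q₂) ∧
      ∫ u, Real.log (posterior X y κ u) ∂(q₁.prod q₂) =
        ∫ β, -(1 / 2) * (β.ofLp ⬝ᵥ precision X κ *ᵥ β.ofLp) ∂q₁ +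
          ∫ z, -(1 / 2) * (z ⬝ᵥ z) ∂q₂ +
          MeanField.statMean (fun β : EuclideanSpace ℝ (Fin p) => X *ᵥ β.ofLp) q₁ ⬝ᵥ
            MeanField.statMean (fun z => z) q₂ - Real.log (∫ v, joint X y κ v) := by
  have B₁ := isExpBlock_gaussian X hκ
  have B₂ := isExpBlock_truncNormal y
  have i₁ := B₁.prob_mem _ hq₁
  have i₂ := B₂.prob_mem _ hq₂
  have k₁ := B₁.klDiv_base _ hq₁
  have k₂ := B₂.klDiv_base _ hq₂
  have hae : (fun u => Real.log (posterior X y κ u)) =ᵐ[q₁.prod q₂]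
      fun u => -(1 / 2) * (u.1.ofLp ⬝ᵥ precision X κ *ᵥ u.1.ofLp) +
        -(1 / 2) * (u.2 ⬝ᵥ u.2) + (X *ᵥ u.1.ofLp) ⬝ᵥ u.2 - Real.log (∫ v, joint X y κ v) := by
    obtain ⟨a, rfl⟩ := hq₂
    filter_upwards [ae_log_posterior_eq X hκ y q₁ a] with u hu
    rw [hu, logKernel_eq]
  have e₁ : Integrable (fun β : EuclideanSpace ℝ (Fin p) =>
      -(1 / 2) * (β.ofLp ⬝ᵥ precision X κ *ᵥ β.ofLp)) q₁ := by
    obtain ⟨ε, hε, hsq⟩ := exists_integrable_exp_sq_multivariateGaussian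
      (S := (precision X κ)⁻¹) (0 : EuclideanSpace ℝ (Fin p))
    have h1 := MeanField.integrable_dotProduct_self_of_sq measurable_ofLp' hε hsq k₁
    simp_rw [dotProduct_precision_mulVec]
    exact ((B₁.integrable_dotProduct_self k₁).add (h1.const_mul κ)).const_mul _
  have e₂ : Integrable (fun z : Fin n → ℝ => -(1 / 2) * (z ⬝ᵥ z)) q₂ :=
    (B₂.integrable_dotProduct_self k₂).const_mul _
  have e₃ := B₁.integrable_dotProduct_prod B₂ k₁ k₂
  have f₁ := e₁.comp_fst q₂
  have f₂ := e₂.comp_snd q₁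
  have f₁₂ : Integrable (fun u : EuclideanSpace ℝ (Fin p) × (Fin n → ℝ) =>
      -(1 / 2) * (u.1.ofLp ⬝ᵥ precision X κ *ᵥ u.1.ofLp) + -(1 / 2) * (u.2 ⬝ᵥ u.2))
      (q₁.prod q₂) := f₁.add f₂
  have f₁₂₃ : Integrable (fun u : EuclideanSpace ℝ (Fin p) × (Fin n → ℝ) =>
      -(1 / 2) * (u.1.ofLp ⬝ᵥ precision X κ *ᵥ u.1.ofLp) + -(1 / 2) * (u.2 ⬝ᵥ u.2) +
        (X *ᵥ u.1.ofLp) ⬝ᵥ u.2) (q₁.prod q₂) := f₁₂.add e₃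
  refine ⟨(f₁₂₃.sub (integrable_const _)).congr hae.symm, ?_⟩
  rw [integral_congr_ae hae, integral_sub f₁₂₃ (integrable_const _), integral_add f₁₂ e₃, integral_add f₁ f₂, B₁.integral_dotProduct_prod B₂ k₁ k₂,
    integral_fun_fst (f := fun β : EuclideanSpace ℝ (Fin p) =>
      -(1 / 2) * (β.ofLp ⬝ᵥ precision X κ *ᵥ β.ofLp)),
    integral_fun_snd (f := fun z : Fin n → ℝ => -(1 / 2) * (z ⬝ᵥ z))]
  simp

/-- In the interaction, a mixed second difference, all terms depending on one block cancel and only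
the bilinear part survives. -/
lemma isTwoBlock_posterior (X : Matrix (Fin n) (Fin p) ℝ) {κ : ℝ} (hκ : 0 < κ)
    (y : Fin n → Fin 2) :
    MeanField.IsTwoBlock (posterior X y κ) (fun β : EuclideanSpace ℝ (Fin p) => X *ᵥ β.ofLp)
      (fun z => z) (multivariateGaussian 0 (precision X κ)⁻¹)
      (Measure.pi fun i => truncNormal (y i) 0) (gaussianFamily X κ) (truncNormalFamily y)
      (√(lambdaMax (normGram X κ)) ^ 2) 1 where
  block₁ := isExpBlock_gaussian X hκ
  block₂ := isExpBlock_truncNormal y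
  mul_lt_one := by
    rw [mul_one]
    exact pow_lt_one₀ (Real.sqrt_nonneg _) (sqrt_lambdaMax_lt_one X hκ) two_ne_zero
  target_eq := target_posterior_eq X hκ y
  integrable_exp := by
    have h := (integrable_prod_base_iff X hκ y fun _ => 0).2
      (by simpa using integrable_exp_logKernel X hκ y)
    simpa using h
  integrable_exp_add := by
    obtain ⟨ε, hε, h⟩ := integrable_exp_logKernel_add X hκ y
    exact ⟨ε, hε, (integrable_prod_base_iff X hκ y _).2 h⟩
  interaction_eq := fun r₁ hr₁ r₂ hr₂ q₁ hq₁ q₂ hq₂ => by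
    rw [MeanField.interaction, (integral_log_posterior X hκ y hq₁ hq₂).2,
      (integral_log_posterior X hκ y hq₁ hr₂).2, (integral_log_posterior X hκ y hr₁ hq₂).2,
      (integral_log_posterior X hκ y hr₁ hr₂).2]
    simp only [sub_dotProduct, dotProduct_sub]
    ring

end Probit

theorem mainTheorem9 (n p : ℕ) (X : Matrix (Fin n) (Fin p) ℝ) (y : Fin n → Fin 2)
    (κ : ℝ) (hκ : 0 < κ) :
    -- the integrals defining the interaction term converge on the two families
    (∀ q₁ ∈ Probit.gaussianFamily X κ, ∀ q₂ ∈ Probit.truncNormalFamily y,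
      Integrable (fun u => Real.log (Probit.posterior X y κ u)) (q₁.prod q₂)) ∧
    -- the bound on the generalized correlation is always smaller than 2
    Probit.corrBound X κ < 2 ∧
    -- parallel CAVI can be run from every initialization in the mean-field class
    (∀ p₁ p₂, MeanField.IsMeanField (Probit.posterior X y κ) p₁ p₂ →
      ∃ q₁ q₂, MeanField.IsParallelCAVI (Probit.posterior X y κ) q₁ q₂ ∧
        q₁ 0 = p₁ ∧ q₂ 0 = p₂) ∧
    ∃ r₁ ∈ Probit.gaussianFamily X κ, ∃ r₂ ∈ Probit.truncNormalFamily y,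
      -- `r₁ ⊗ r₂` is the unique global minimiser of the objective
      MeanField.IsOptimal (Probit.posterior X y κ) r₁ r₂ ∧
      (∀ p₁ p₂, MeanField.IsOptimal (Probit.posterior X y κ) p₁ p₂ → p₁ = r₁ ∧ p₂ = r₂) ∧
      -- the bound on the generalized correlation
      Probit.probitGCorr X y κ r₁ r₂ ≤ ENNReal.ofReal (Probit.corrBound X κ) ∧
      -- global convergence of parallel CAVI
      (∀ q₁ q₂, MeanField.IsParallelCAVI (Probit.posterior X y κ) q₁ q₂ →
        (∀ t, 1 ≤ t → q₁ t ∈ Probit.gaussianFamily X κ ∧ q₂ t ∈ Probit.truncNormalFamily y) ∧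
        (∀ t, q₁ t ∈ Probit.gaussianFamily X κ → q₂ t ∈ Probit.truncNormalFamily y →
          MeanField.weightedKL (1 / 2) ((q₁ (t + 1)).prod (q₂ (t + 1))) (r₁.prod r₂) ≤
            Probit.probitGCorr X y κ r₁ r₂ ^ 2 / 4 *
              MeanField.weightedKL (1 / 2) ((q₁ t).prod (q₂ t)) (r₁.prod r₂)) ∧
        Tendsto (fun t => MeanField.weightedKL (1 / 2) ((q₁ t).prod (q₂ t)) (r₁.prod r₂))
          atTop (𝓝 0)) := by
  have M := Probit.isTwoBlock_posterior X hκ y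
  refine ⟨fun q₁ hq₁ q₂ hq₂ => (Probit.integral_log_posterior X hκ y hq₁ hq₂).1, ?_,
    fun p₁ p₂ hp => M.exists_isParallelCAVI hp, ?_⟩
  · rw [Probit.corrBound_eq]
    linarith [Probit.sqrt_lambdaMax_lt_one X hκ]
  · have h := M.main
    -- With `c₁ = √λ ^ 2` and `c₂ = 1`, the constant `2√(c₁c₂)` is `corrBound`.
    rwa [mul_one, Real.sqrt_sq (Real.sqrt_nonneg _), ← Probit.corrBound_eq] at h
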